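/- **Setting.** Let $X$ be a measurable space, $f:X\to\{-1,1\}$ a measurable target, and for a distribution $D$ on $X$ let $\mathrm{er}_D(h)=\Pr_{x\sim D}[h(x)\neq f(x)]$. Samples consist of i.i.d. labelled examples $(x,f(x))$, $x\sim D$. A randomized algorithm $A$ with sample size $n$ is *$\rho$-replicable* if for every distribution $D$ on $X$, $\Pr[A(S_1;r)=A(S_2;r)]\ge 1-\rho$, where $S_1,S_2$ are independent samples of size $n$ and the internal randomness $r$ is shared. For $\gamma\in(0,1/2)$, a *$p$-replicable weak learner with advantage $\gamma$* and sample complexity $m$ is a $p$-replicable algorithm $W$ with sample size $m$ which for every $D$ outputs, except with probability at most $p$, a hypothesis $h$ with $\mathrm{er}_D(h)\le 1/2-\gamma$ (in particular, a learner that never fails is allowed). For a weight $\mu$ on examples with values in $[0,1]$, *rejection sampling* keeps each example $z$ independently with probability $\mu(z)$ and returns the first (prescribed number of) kept examples, or fails if there are too few. The *threshold check* for $\phi$ at level $z$ draws $z_0$ uniformly from $[\frac34z,\frac32z]$ and returns $1$ if the empirical mean of $\phi$ on a fresh sample exceeds $z_0$, and $0$ otherwise. Below, $K$ is a constant. **$\mathrm{rBoost}^*_{\rho,\epsilon}$.**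 Put $g_0=0$. For $t=1,2,\dots,\lceil 256/(\epsilon\gamma^2)\rceil$: let $\mu_t=1$ where $g_{t-1}\le 0$ and $\mu_t=(1-\gamma)^{g_{t-1}/2}$ elsewhere; obtain $m$ examples by rejection sampling with $\mu_t$ from $\lceil K\log(\frac1{\rho\epsilon\gamma})\,m/\epsilon\rceil$ fresh examples; run $W$ on them to get $h_t$; put $g_t(x,y)=g_{t-1}(x,y)+h_t(x)y-\gamma/(2+\gamma)$; if $\lfloor 1/\gamma\rfloor$ divides $t$, make a threshold check for $\mu_t$ at level $\epsilon/2$ with $\lceil K\log(\frac1{\rho\epsilon\gamma})/(\rho^2\epsilon^3\gamma^2)\rceil$ fresh examples, and leave the loop if it returns $0$. Leave the loop also if rejection sampling fails. Return $\mathrm{sign}(\sum_t h_t)$. **$\mathrm{rMetaBoost}_{\rho,\epsilon}$.** Put $T=\lceil 8\log(2/\epsilon)\rceil$, $\rho_0=\rho/(6T)$, $\epsilon_0=1/16$, $M_1=0$, $c_1=0$, and let $m_0$ be the sample size of $\mathrm{rBoost}^*_{\rho_0,\epsilon_0}$. For $t=1,\dots,T$: let $\mu_t=\exp(M_t-c_t)$;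 obtain $m_0$ examples by rejection sampling with $\mu_t$ from $\lceil K\log(T/\rho)\,m_0/\epsilon\rceil$ fresh examples (stop if this fails); run $\mathrm{rBoost}^*_{\rho_0,\epsilon_0}$ on them to get $h_t$; put $N_{t+1}(x,y)=M_t(x,y)+\mathbb 1\{h_t(x)\ne y\}$; let $b_{t+1}$ be the result of a threshold check for $\mathbb 1\{N_{t+1}=c_t+1\}$ at level $\epsilon/16$ with $\lceil K\log(T/\rho)\,T^2/(\rho^2\epsilon)\rceil$ fresh examples; put $c_{t+1}=c_t+b_{t+1}$ and $M_{t+1}=\min(N_{t+1},c_{t+1})$. Return $H=\mathrm{sign}(\sum_t h_t)$. (Here $\mathrm{sign}(0)=1$, and after a failure the vote over the hypotheses obtained so far is returned.) **Theorem.** There are universal constants $c,C>0$ and $k,K\in\mathbb N$ such that for all $\rho,\epsilon\in(0,1)$, $\gamma\in(0,1/2)$, every target $f$, and every $p$-replicable weak learner $W$ with advantage $\gamma$ and sample complexity $m$, where $p=c\,\rho\gamma^2/\log(2/\epsilon)$ (that is, $p=\widetilde\Theta(\rho\gamma^2)$), the algorithm $\mathrm{rMetaBoost}_{\rho,\epsilon}$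 with the constant $K$ has the following properties. 1. It is $\rho$-replicable. 2. In every run it makes at most $C\log(2/\epsilon)/\gamma^2$ calls to $W$. 3. For every distribution $D$ on $X$, with probability at least $1-\rho$ it outputs a hypothesis $H$ with $\mathrm{er}_D(H)\le\epsilon$. 4. Its sample complexity is at most $$C\,\log^k\!\Big(\frac{2}{\rho\epsilon\gamma}\Big)\Big(\frac{m}{\epsilon\gamma^2}+\frac1{\rho^2\epsilon\gamma^3}\Big)=\widetilde O\Big(\frac{m}{\epsilon\gamma^2}+\frac1{\rho^2\epsilon\gamma^3}\Big).$$ -/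

import Mathlib

open MeasureTheory Set
open scoped unitInterval

noncomputable section

namespace ReplicableBoosting

/-! Labels `-1` and `1` are the Booleans `false` and `true`; a labelled example is a pair in
`X × Bool`, and a hypothesis is a function `X → Bool`. Algorithms see labelled examples only, never
the target function. Uniform random numbers live in the unit interval `I`. -/

/-- The real sign encoded by a label. -/
def sgn (b : Bool) : ℝ := if b then 1 else -1

section Learning

variable {X : Type*} [MeasurableSpace X]

/-- The law of the labelled example `(x, f x)` with `x ∼ D`. -/
def labelled (D : Measure X) (f : X → Bool) : Measure (X × Bool) :=
  D.map fun x => (x, f x)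

/-- The error of the hypothesis `h` for the target `f` under `D`. -/
def er (D : Measure X) (f h : X → Bool) : ℝ := D.real {x | h x ≠ f x}

/-- `A` reads a sample indexed by `ι` (so of size `Fintype.card ι`) and a seed `r ∼ ν`. It is
`ρ`-replicable for i.i.d. examples of law `P` if two runs on independent samples with the same seed
differ with probability at most `ρ`. (The bound is on the outer probability of "different", which
is the strong reading of `Pr[equal] ≥ 1 - ρ` if the event should fail to be measurable.) -/
def IsReplicable {ι Z R Y : Type*} [Fintype ι] [MeasurableSpace Z] [MeasurableSpace R]
    (P : Measure Z) (ν : Measure R) (A : (ι → Z) → R → Y) (ρ : ℝ) : Prop :=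
  (((Measure.pi fun _ : ι => P).prod (Measure.pi fun _ : ι => P)).prod ν)
    {ω | A ω.1.1 ω.2 ≠ A ω.1.2 ω.2} ≤ ENNReal.ofReal ρ

/-- `W` is a `p`-replicable weak learner with advantage `γ` and sample complexity `m` for the
target `f`, with internal randomness of law `ν`. For every distribution of the examples, it is
`p`-replicable and errs with probability at most `1 / 2 - γ`; the latter may fail with probability
at most `p` (a learner that never fails is a special case). The first two fields say that
predictions, and the event that two runs agree, are measurable. -/
structure IsReplicableWeakLearner {R : Type*} [MeasurableSpace R] (f : X → Bool) (ν : Measure R)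
    {m : ℕ} (W : (Fin m → X × Bool) → R → X → Bool) (γ p : ℝ) : Prop where
  measurable_eval : Measurable fun q : ((Fin m → X × Bool) × R) × X => W q.1.1 q.1.2 q.2
  measurableSet_agree : MeasurableSet
    {q : ((Fin m → X × Bool) × (Fin m → X × Bool)) × R | W q.1.1 q.2 = W q.1.2 q.2}
  replicable : ∀ D : Measure X, IsProbabilityMeasure D → IsReplicable (labelled D f) ν W p
  advantage : ∀ D : Measure X, IsProbabilityMeasure D →
    ((Measure.pi fun _ : Fin m => labelled D f).prod ν)
      {q | 1 / 2 - γ < er D f (W q.1 q.2)} ≤ ENNReal.ofReal p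

end Learning

section Subroutines

variable {Z : Type*}

/-- The threshold check: draw `z₀` uniformly from `[3z/4, 3z/2]` (by means of the uniform number
`u`) and return whether the empirical mean of `φ` exceeds `z₀`. -/
def rThreshold {n : ℕ} (S : Fin n → Z) (z : ℝ) (φ : Z → ℝ) (u : I) : Bool :=
  decide (3 / 4 * z + 3 / 4 * z * (u : ℝ) < (∑ i, φ (S i)) / n)

/-- Rejection sampling: the `i`-th example is accepted with probability `μ (S i)` (by means of the
uniform number `u i`). The result is the first `m` accepted examples, or `none` (failure) if there
are fewer. -/
def rejectionSampler (μ : Z → ℝ) (m : ℕ) {n : ℕ} (S : Fin n → Z) (u : Fin n → I) :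
    Option (Fin m → Z) :=
  let kept := (List.finRange n).filter fun i => decide ((u i : ℝ) ≤ μ (S i))
  if h : m ≤ kept.length then some fun j => S (kept.get (j.castLE h)) else none

end Subroutines

/-! ### The inner booster `rBoost*`

Throughout, `m` is the sample complexity of the weak learner and `K` is the constant hidden in the
`O(·)` of the sample sizes. -/

/-- The number of rounds after which the loop is cut off, so that the sample is finite. -/
def boostRounds (ε γ : ℝ) : ℕ := ⌈256 / (ε * γ ^ 2)⌉₊

/-- The number of fresh examples fed to the rejection sampler in a round. -/
def boostDraw (K : ℕ) (ρ ε γ : ℝ) (m : ℕ) : ℕ :=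
  ⌈K * Real.log (1 / (ρ * ε * γ)) * m / ε⌉₊

/-- Whether round `t + 1` ends with a threshold check: every `⌊1/γ⌋`-th round does. -/
abbrev IsCheckRound (γ : ℝ) (t : ℕ) : Prop := ⌊1 / γ⌋₊ ∣ t + 1

/-- The number of fresh examples used by the threshold check of round `t + 1`. -/
def boostCheck (K : ℕ) (ρ ε γ : ℝ) (t : ℕ) : ℕ :=
  if IsCheckRound γ t then ⌈K * Real.log (1 / (ρ * ε * γ)) / (ρ ^ 2 * ε ^ 3 * γ ^ 2)⌉₊ else 0

/-- The positions in the sample of `rBoost*`, grouped by round and by purpose. -/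
abbrev BoostIdx (K : ℕ) (ρ ε γ : ℝ) (m : ℕ) : Type :=
  (t : Fin (boostRounds ε γ)) × (Fin (boostDraw K ρ ε γ m) ⊕ Fin (boostCheck K ρ ε γ t))

/-- The internal randomness of `rBoost*`: in each round that of the rejection sampler, that of the
weak learner, and that of the threshold check. -/
abbrev BoostSeed (K : ℕ) (ρ ε γ : ℝ) (m : ℕ) (R : Type*) : Type _ :=
  Fin (boostRounds ε γ) → (Fin (boostDraw K ρ ε γ m) → I) × R × I

/-- The law of the internal randomness of `rBoost*`: all components are independent. -/
def boostSeedLaw (K : ℕ) (ρ ε γ : ℝ) (m : ℕ) {R : Type*} [MeasurableSpace R] (ν : Measure R) :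
    Measure (BoostSeed K ρ ε γ m R) :=
  Measure.pi fun _ => (Measure.pi fun _ => volume).prod (ν.prod volume)

/-- The variables of `rBoost*`: the function `g` on examples (of which the reweighting is a
function), the sum `vote` of the hypotheses so far, whether the loop has been left, and the number
of calls to the weak learner so far. -/
structure BoostState (X : Type*) where
  g : X × Bool → ℝ
  vote : X → ℝ
  halted : Bool
  calls : ℕ

/-- The weight of an example as a function of its value of `g`. -/
def smoothWeight (γ s : ℝ) : ℝ := if s ≤ 0 then 1 else (1 - γ) ^ (s / 2)

section Algorithms

variable {X R : Type*}

/-- One round of `rBoost*`. If the rejection sampler fails, the loop is left. -/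
def boostStep (K : ℕ) (ρ ε γ : ℝ) {m : ℕ} (W : (Fin m → X × Bool) → R → X → Bool)
    (S : BoostIdx K ρ ε γ m → X × Bool) (r : BoostSeed K ρ ε γ m R)
    (s : BoostState X) (t : Fin (boostRounds ε γ)) : BoostState X :=
  if s.halted then s else
    let μ : X × Bool → ℝ := fun z => smoothWeight γ (s.g z)
    match rejectionSampler μ m (fun i => S ⟨t, .inl i⟩) (r t).1 with
    | none => { s with halted := true }
    | some SW =>
      let h := W SW (r t).2.1
      { g := fun z => s.g z + sgn (h z.1) * sgn z.2 - γ / (2 + γ)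
        vote := fun x => s.vote x + sgn (h x)
        halted := decide (IsCheckRound γ t) &&
          !(rThreshold (fun i => S ⟨t, .inr i⟩) (ε / 2) μ (r t).2.2)
        calls := s.calls + 1 }

/-- `rBoost*`, returning the hypothesis and the number of calls to the weak learner. -/
def rBoostStar (K : ℕ) (ρ ε γ : ℝ) {m : ℕ} (W : (Fin m → X × Bool) → R → X → Bool)
    (S : BoostIdx K ρ ε γ m → X × Bool) (r : BoostSeed K ρ ε γ m R) : (X → Bool) × ℕ :=
  let s := Fin.foldl (boostRounds ε γ) (boostStep K ρ ε γ W S r) ⟨fun _ => 0, fun _ => 0, false, 0⟩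
  (fun x => decide (0 ≤ s.vote x), s.calls)

end Algorithms

/-! ### The main algorithm `rMetaBoost` -/

/-- The number `T` of rounds. -/
def metaRounds (ε : ℝ) : ℕ := ⌈8 * Real.log (2 / ε)⌉₊

/-- The replicability parameter for the calls to `rBoost*`; their error parameter is `1 / 16`. -/
def subRho (ρ ε : ℝ) : ℝ := ρ / (6 * metaRounds ε)

/-- The positions in the sample of a call to `rBoost*`. -/
abbrev SubIdx (K : ℕ) (ρ ε γ : ℝ) (m : ℕ) : Type := BoostIdx K (subRho ρ ε) (1 / 16) γ m

/-- The number of fresh examples fed to the rejection sampler in a round. -/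
def metaDraw (K : ℕ) (ρ ε γ : ℝ) (m : ℕ) : ℕ :=
  ⌈K * Real.log (metaRounds ε / ρ) * Fintype.card (SubIdx K ρ ε γ m) / ε⌉₊

/-- The number of fresh examples used by the threshold check of a round. -/
def metaCheck (K : ℕ) (ρ ε : ℝ) : ℕ :=
  ⌈K * Real.log (metaRounds ε / ρ) * (metaRounds ε : ℝ) ^ 2 / (ρ ^ 2 * ε)⌉₊

/-- The positions in the sample of `rMetaBoost`, grouped by round and by purpose. -/
abbrev MetaIdx (K : ℕ) (ρ ε γ : ℝ) (m : ℕ) : Type :=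
  Fin (metaRounds ε) × (Fin (metaDraw K ρ ε γ m) ⊕ Fin (metaCheck K ρ ε))

/-- The internal randomness of `rMetaBoost`: in each round that of the rejection sampler, that of
`rBoost*` (with that of the weak learner), and that of the threshold check. -/
abbrev MetaSeed (K : ℕ) (ρ ε γ : ℝ) (m : ℕ) (R : Type*) : Type _ :=
  Fin (metaRounds ε) →
    (Fin (metaDraw K ρ ε γ m) → I) × BoostSeed K (subRho ρ ε) (1 / 16) γ m R × I

/-- The law of the internal randomness of `rMetaBoost`: all components are independent. -/
def metaSeedLaw (K : ℕ) (ρ ε γ : ℝ) (m : ℕ) {R : Type*} [MeasurableSpace R] (ν : Measure R) :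
    Measure (MetaSeed K ρ ε γ m R) :=
  Measure.pi fun _ =>
    (Measure.pi fun _ => volume).prod ((boostSeedLaw K (subRho ρ ε) (1 / 16) γ m ν).prod volume)

/-- The variables of `rMetaBoost`: the capped counts `M`, the cap `c`, the sum `vote` of the
hypotheses so far, whether the algorithm was stopped, and the number of calls to the weak learner
so far. -/
structure MetaState (X : Type*) where
  M : X × Bool → ℕ
  c : ℕ
  vote : X → ℝ
  halted : Bool
  calls : ℕ

section Algorithms

variable {X R : Type*}

/-- One round of `rMetaBoost`. If the rejection sampler fails, the algorithm is stopped. -/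
def metaStep (K : ℕ) (ρ ε γ : ℝ) {m : ℕ} (W : (Fin m → X × Bool) → R → X → Bool)
    (S : MetaIdx K ρ ε γ m → X × Bool) (r : MetaSeed K ρ ε γ m R)
    (s : MetaState X) (t : Fin (metaRounds ε)) : MetaState X :=
  if s.halted then s else
    let μ : X × Bool → ℝ := fun z => Real.exp ((s.M z : ℝ) - s.c)
    match rejectionSampler μ (Fintype.card (SubIdx K ρ ε γ m)) (fun i => S (t, .inl i)) (r t).1 with
    | none => { s with halted := true }
    | some S₂ =>
      let out := rBoostStar K (subRho ρ ε) (1 / 16) γ W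
        (fun i => S₂ (Fintype.equivFin (SubIdx K ρ ε γ m) i)) (r t).2.1
      let h := out.1
      let N : X × Bool → ℕ := fun z => s.M z + if h z.1 ≠ z.2 then 1 else 0
      let b := rThreshold (fun i => S (t, .inr i)) (ε / 16)
        (fun z => if N z = s.c + 1 then 1 else 0) (r t).2.2
      let c' := s.c + b.toNat
      { M := fun z => min (N z) c'
        c := c'
        vote := fun x => s.vote x + sgn (h x)
        halted := false
        calls := s.calls + out.2 }

/-- `rMetaBoost`, returning the hypothesis and the number of calls to the weak learner. -/
def rMetaBoost (K : ℕ) (ρ ε γ : ℝ) {m : ℕ} (W : (Fin m → X × Bool) → R → X → Bool)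
    (S : MetaIdx K ρ ε γ m → X × Bool) (r : MetaSeed K ρ ε γ m R) : (X → Bool) × ℕ :=
  let s := Fin.foldl (metaRounds ε) (metaStep K ρ ε γ W S r)
    ⟨fun _ => 0, 0, fun _ => 0, false, 0⟩
  (fun x => decide (0 ≤ s.vote x), s.calls)

end Algorithms

end ReplicableBoosting

end

open ReplicableBoosting

open MeasureTheory Set
open scoped unitInterval ENNReal

noncomputable section

/-! Two runs with independent samples and a common seed are coupled. A round is good if the samplers
succeed on both samples, the learner's two outputs agree and are accurate (`CallSpec`), and the
threshold check gives one answer, correct up to a factor 2 (`ThresholdSpec`). As long as all rounds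
are good the two states coincide, so replicability and accuracy both follow from a single union
bound over rounds. Each round has its own examples and seeds: redrawing its block does not change
the state before it, and by `measure_le_of_resample` it suffices to bound the failure of a round for
a fixed state.

Accepted examples are independent draws from the reweighted law (`measure_rejectionSampler_mem_le`).
The two samplers share their randomness, so the selected samples are dependent; comparing each with
a third, independent sample repairs this at the price of a factor 2 (`measure_not_callSpec_le`). In
a check the random level falls close to the true mean with small probability only, and away from it
a Chernoff bound makes both answers equal (`measure_not_thresholdSpec_le`).

In `rBoost*` the weight is the derivative of a concave potential bounded by `2 / γ`. A hypothesis of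
advantage `γ` has correlation at least `2γ` times the density, while curvature and drift cost at
most `19γ/10` times the density (`weightPotential_add_le`). Hence the potential grows steadily while
the density is at least of order `ε`, and the loop must stop after `O(1/(εγ²))` rounds with low
density; as misclassified examples have weight at least `2/3`, the error is then small. Over `1/γ`
rounds the density at most halves, so `O(1/γ)` checks suffice for constant `ε`. Each may fail with
probability of order `ργ`, which leads to the term `1/(ρ²γ³)`.

In `rMetaBoost` the integral of `exp M` grows at most by `exp (1/4)` in a round. Raising the cap
only when enough mass overflows keeps the density above `ε/32`, and not raising it discards little
of the error counts. A final vote with error above `ε` would force a large capped count on a set of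
measure above `ε`, contrary to the exponential bound (`MetaInv.lawErr_le`). -/

namespace ReplicableBoosting

/-! ### Product measures: selecting and resampling coordinates. -/

section Product

/-- Selecting coordinates along an injection preserves product measures. -/
theorem measurePreserving_comp_injective {ι κ : Type*} [Fintype ι] [Fintype κ] {Z : ι → Type*}
    [∀ i, MeasurableSpace (Z i)] (P : ∀ i, Measure (Z i)) [∀ i, IsProbabilityMeasure (P i)]
    (e : κ → ι) (he : Function.Injective e) :
    MeasurePreserving (fun (x : ∀ i, Z i) j => x (e j)) (Measure.pi P)
      (Measure.pi fun j => P (e j)) := by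
  classical
  have hm : Measurable (fun (x : ∀ i, Z i) j => x (e j)) := by fun_prop
  refine ⟨hm, (Measure.pi_eq fun s hs => ?_).symm⟩
  rw [Measure.map_apply hm (MeasurableSet.univ_pi hs)]
  -- Coordinates outside the range of `e` are unconstrained; on the range the side is the given one,
  -- up to a cast along `e j = i`.
  let t : ∀ i, Set (Z i) := fun i => if h : ∃ j, e j = i then h.choose_spec ▸ s h.choose else univ
  have ht : ∀ j, t (e j) = s j := by
    intro j
    have h : ∃ j', e j' = e j := ⟨j, rfl⟩
    simp only [t, dif_pos h]
    have h2 : h.choose = j := he h.choose_spec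
    generalize hh : h.choose_spec = q
    clear hh
    revert q
    generalize h.choose = j' at h2
    subst h2
    intro q; rfl
  have hpre : (fun (x : ∀ i, Z i) j => x (e j)) ⁻¹' univ.pi s = univ.pi t := by
    ext x
    simp only [mem_preimage, mem_univ_pi]
    constructor
    · intro hx i
      by_cases h : ∃ j, e j = i
      · obtain ⟨j, rfl⟩ := h; rw [ht]; exact hx j
      · simp [t, h]
    · intro hx j; rw [← ht]; exact hx _
  rw [hpre, Measure.pi_pi, ← Finset.prod_subset (Finset.subset_univ (Finset.univ.image e)),
    Finset.prod_image (fun a _ b _ h => he h)]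
  · simp [ht]
  · intro i _ hi
    have h : ¬ ∃ j, e j = i := by simpa using hi
    simp [t, h]

/-- Replacing some coordinates of a point by those of an independent copy preserves the product
measure. -/
theorem measurePreserving_resample {ι : Type*} [Fintype ι] {Z : ι → Type*}
    [∀ i, MeasurableSpace (Z i)] (P : ∀ i, Measure (Z i)) [∀ i, IsProbabilityMeasure (P i)]
    (J : ι → Prop) [DecidablePred J] :
    MeasurePreserving (fun (p : (∀ i, Z i) × (∀ i, Z i)) i => if J i then p.2 i else p.1 i)
      ((Measure.pi P).prod (Measure.pi P)) (Measure.pi P) := by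
  have hm : Measurable (fun (p : (∀ i, Z i) × (∀ i, Z i)) i => if J i then p.2 i else p.1 i) := by
    refine measurable_pi_lambda _ fun i => ?_
    split_ifs <;> fun_prop
  refine ⟨hm, (Measure.pi_eq fun s hs => ?_).symm⟩
  rw [Measure.map_apply hm (MeasurableSet.univ_pi hs)]
  -- In each coordinate exactly one of the two copies is constrained, so the preimage of a box is a
  -- product of two boxes.
  have hpre : (fun (p : (∀ i, Z i) × (∀ i, Z i)) i => if J i then p.2 i else p.1 i) ⁻¹' univ.pi s =
      (univ.pi fun i => if J i then univ else s i) ×ˢ (univ.pi fun i => if J i then s i else univ) := by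
    ext ⟨x, y⟩
    simp only [mem_preimage, mem_univ_pi, mem_prod, ← forall_and]
    refine forall_congr' fun i => ?_
    split_ifs <;> simp
  rw [hpre, Measure.prod_prod, Measure.pi_pi, Measure.pi_pi, ← Finset.prod_mul_distrib]
  refine Finset.prod_congr rfl fun i _ => ?_
  split_ifs <;> simp

/-- A bound on sections bounds the measure of a set that is invariant in law under resampling. -/
theorem measure_le_of_resample {Ω : Type*} [MeasurableSpace Ω] {ℙ : Measure Ω}
    [IsProbabilityMeasure ℙ] {res : Ω × Ω → Ω} (hres : MeasurePreserving res (ℙ.prod ℙ) ℙ)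
    {B : Set Ω} (hB : MeasurableSet B) {δ : ℝ≥0∞} (h : ∀ ω, ℙ {ω' | res (ω, ω') ∈ B} ≤ δ) :
    ℙ B ≤ δ := by
  rw [← hres.measure_preimage hB.nullMeasurableSet, Measure.prod_apply (hres.measurable hB)]
  calc _ ≤ ∫⁻ _, δ ∂ℙ := lintegral_mono fun ω => h ω
    _ = δ := by simp

end Product

theorem exp_le_one_add_add_sq {x : ℝ} (hx : |x| ≤ 1) : Real.exp x ≤ 1 + x + x ^ 2 := by
  have := Real.abs_exp_sub_one_sub_id_le hx
  have := (abs_le.mp this).2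
  linarith

/-! ### Chernoff bounds for empirical means. -/

section Concentration

variable {Z : Type*} [MeasurableSpace Z] (P : Measure Z) [IsProbabilityMeasure P]

/-- Exponential Markov inequality. Values in `[0, 1]` give `φ ^ 2 ≤ φ`, so the mean also controls
the second-order term of the moment generating function. The sign of `l` selects the tail; `b` may
lie far above the mean. -/
theorem measure_pi_exp_tail {n : ℕ} {φ : Z → ℝ} (hφ : Measurable φ) (h0 : ∀ z, 0 ≤ φ z)
    (h1 : ∀ z, φ z ≤ 1) {l b : ℝ} (hl : |l| ≤ 1) (hb : ∫ z, φ z ∂P ≤ b) (c : ℝ) :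
    (Measure.pi fun _ : Fin n => P) {S | c ≤ l * (∑ i, φ (S i) - n * ∫ z, φ z ∂P)} ≤
      ENNReal.ofReal (Real.exp (n * b * l ^ 2 - c)) := by
  set a := ∫ z, φ z ∂P with ha
  have hint : Integrable φ P := by
    refine Integrable.of_bound hφ.aestronglyMeasurable 1 (ae_of_all _ fun z => ?_)
    rw [Real.norm_eq_abs, abs_of_nonneg (h0 z)]; exact h1 z
  have hb0 : 0 ≤ a := integral_nonneg h0
  -- moment generating function of one summand
  have hmgf : ∫ z, Real.exp (l * (φ z - a)) ∂P ≤ Real.exp (b * l ^ 2) := by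
    have hpt : ∀ z, Real.exp (l * φ z) ≤ 1 + (l + l ^ 2) * φ z := by
      intro z
      have hz : |l * φ z| ≤ 1 := by
        rw [abs_mul, abs_of_nonneg (h0 z)]
        exact mul_le_one₀ hl (h0 z) (h1 z)
      have := exp_le_one_add_add_sq hz
      have h3 : φ z ^ 2 ≤ φ z := by nlinarith [h0 z, h1 z]
      nlinarith [sq_nonneg l, mul_le_mul_of_nonneg_left h3 (sq_nonneg l)]
    have hI : ∫ z, Real.exp (l * φ z) ∂P ≤ 1 + (l + l ^ 2) * a := by
      have h4 : ∫ z, (1 + (l + l ^ 2) * φ z) ∂P = 1 + (l + l ^ 2) * a := by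
        rw [integral_add (integrable_const _) (hint.const_mul _), integral_const_mul]
        simp [ha]
      rw [← h4]
      refine integral_mono_of_nonneg (ae_of_all _ fun z => (Real.exp_pos _).le)
        ((integrable_const _).add (hint.const_mul _)) (ae_of_all _ hpt)
    have h5 : ∫ z, Real.exp (l * (φ z - a)) ∂P = Real.exp (-(l * a)) * ∫ z, Real.exp (l * φ z) ∂P := by
      rw [← integral_const_mul]
      congr 1; ext z; rw [← Real.exp_add]; congr 1; ring
    rw [h5]
    calc _ ≤ Real.exp (-(l * a)) * Real.exp ((l + l ^ 2) * a) := by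
          refine mul_le_mul_of_nonneg_left (hI.trans ?_) (Real.exp_pos _).le
          linarith [Real.add_one_le_exp ((l + l ^ 2) * a)]
      _ = Real.exp (a * l ^ 2) := by rw [← Real.exp_add]; congr 1; ring
      _ ≤ _ := Real.exp_le_exp.mpr (mul_le_mul_of_nonneg_right hb (sq_nonneg l))
  have hprod : ∀ S : Fin n → Z, Real.exp (l * (∑ i, φ (S i) - n * a)) =
      ∏ i, Real.exp (l * (φ (S i) - a)) := by
    intro S
    rw [← Real.exp_sum, ← Finset.mul_sum, Finset.sum_sub_distrib]; simp
  have hE : ∫ S, Real.exp (l * (∑ i, φ (S i) - n * a)) ∂(Measure.pi fun _ : Fin n => P) ≤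
      Real.exp (n * b * l ^ 2) := by
    simp_rw [hprod]
    rw [integral_fintype_prod_eq_prod (f := fun (_ : Fin n) z => Real.exp (l * (φ z - a)))]
    rw [Finset.prod_const, Finset.card_univ, Fintype.card_fin]
    calc _ ≤ Real.exp (b * l ^ 2) ^ n :=
          pow_le_pow_left₀ (integral_nonneg fun z => (Real.exp_pos _).le) hmgf n
      _ = _ := by rw [← Real.exp_nat_mul]; congr 1; ring
  have hmeas : Measurable fun S : Fin n → Z => Real.exp (l * (∑ i, φ (S i) - n * a)) := by fun_prop
  have hInt : Integrable (fun S : Fin n → Z => Real.exp (l * (∑ i, φ (S i) - n * a)))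
      (Measure.pi fun _ : Fin n => P) := by
    refine Integrable.of_bound hmeas.aestronglyMeasurable (Real.exp (n * (1 + |a|)))
      (ae_of_all _ fun S => ?_)
    rw [Real.norm_eq_abs, abs_of_pos (Real.exp_pos _)]
    refine Real.exp_le_exp.mpr ?_
    refine (le_abs_self _).trans ?_
    rw [abs_mul]
    have h6 : |∑ i, φ (S i) - n * a| ≤ n * (1 + |a|) := by
      have h7 : 0 ≤ ∑ i, φ (S i) := Finset.sum_nonneg fun i _ => h0 _
      have h8 : ∑ i, φ (S i) ≤ n := by
        calc _ ≤ ∑ i : Fin n, (1 : ℝ) := Finset.sum_le_sum fun i _ => h1 _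
          _ = n := by simp
      rw [abs_of_nonneg hb0]
      have : 0 ≤ (n : ℝ) * a := by positivity
      rw [abs_le]; constructor <;> nlinarith
    calc |l| * _ ≤ 1 * (n * (1 + |a|)) := mul_le_mul hl h6 (abs_nonneg _) zero_le_one
      _ = _ := one_mul _
  have hM := mul_meas_ge_le_integral_of_nonneg (μ := Measure.pi fun _ : Fin n => P)
    (ae_of_all _ fun S => (Real.exp_pos (l * (∑ i, φ (S i) - n * a))).le) hInt (Real.exp c)
  have hset : {S : Fin n → Z | c ≤ l * (∑ i, φ (S i) - n * a)} =
      {S | Real.exp c ≤ Real.exp (l * (∑ i, φ (S i) - n * a))} := by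
    ext S; simp
  rw [hset, ← ofReal_measureReal]
  refine ENNReal.ofReal_le_ofReal ?_
  rw [Real.exp_sub, le_div_iff₀ (Real.exp_pos c), mul_comm]
  exact hM.trans hE

/-- A multiplicative Chernoff bound for the empirical mean. -/
theorem measure_pi_abs_mean_sub_le {n : ℕ} {φ : Z → ℝ} (hφ : Measurable φ) (h0 : ∀ z, 0 ≤ φ z)
    (h1 : ∀ z, φ z ≤ 1) {η z : ℝ} (hη : 0 ≤ η) (hη1 : η ≤ 1) :
    (Measure.pi fun _ : Fin n => P)
      {S | η * max (∫ z, φ z ∂P) z < |(∑ i, φ (S i)) / n - ∫ z, φ z ∂P|} ≤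
      ENNReal.ofReal (2 * Real.exp (-(n * η ^ 2 * z / 4))) := by
  set a := ∫ z, φ z ∂P with ha
  rcases Nat.eq_zero_or_pos n with rfl | hn
  · refine prob_le_one.trans ?_
    rw [← ENNReal.ofReal_one]; apply ENNReal.ofReal_le_ofReal; simp
  have hn' : (0 : ℝ) < n := by exact_mod_cast hn
  set b := max a z with hb
  have hbz : z ≤ b := le_max_right _ _
  have hab : a ≤ b := le_max_left _ _
  -- The choice `|l| = η / 2` minimizes `b l² - |l| η b`, with value `-η² b / 4`.
  have key : ∀ l : ℝ, l = η / 2 ∨ l = -(η / 2) →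
      (Measure.pi fun _ : Fin n => P) {S | n * (η ^ 2 * b / 2) ≤ l * (∑ i, φ (S i) - n * a)} ≤
      ENNReal.ofReal (Real.exp (-(n * η ^ 2 * z / 4))) := by
    intro l hl
    have hl2 : l ^ 2 = η ^ 2 / 4 := by rcases hl with rfl | rfl <;> ring
    have hl1 : |l| ≤ 1 := by
      rw [abs_le]; rcases hl with rfl | rfl <;> constructor <;> linarith
    refine (measure_pi_exp_tail P hφ h0 h1 hl1 hab _).trans (ENNReal.ofReal_le_ofReal ?_)
    refine Real.exp_le_exp.mpr ?_
    rw [hl2]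
    have : n * η ^ 2 * z ≤ n * η ^ 2 * b := by gcongr
    linarith
  calc _ ≤ (Measure.pi fun _ : Fin n => P)
        ({S | n * (η ^ 2 * b / 2) ≤ (η / 2) * (∑ i, φ (S i) - n * a)} ∪
          {S | n * (η ^ 2 * b / 2) ≤ (-(η / 2)) * (∑ i, φ (S i) - n * a)}) := by
        refine measure_mono fun S hS => ?_
        simp only [mem_ofPred_eq, mem_union] at hS ⊢
        have h2 : (∑ i, φ (S i)) - n * a = n * ((∑ i, φ (S i)) / n - a) := by field_simp
        rw [h2]
        rcases lt_abs.mp hS with h | h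
        · left
          have := mul_le_mul_of_nonneg_left h.le (by positivity : 0 ≤ (n : ℝ) * (η / 2))
          linarith
        · right
          have := mul_le_mul_of_nonneg_left h.le (by positivity : 0 ≤ (n : ℝ) * (η / 2))
          linarith
    _ ≤ _ := measure_union_le _ _
    _ ≤ ENNReal.ofReal (Real.exp (-(n * η ^ 2 * z / 4))) +
        ENNReal.ofReal (Real.exp (-(n * η ^ 2 * z / 4))) :=
      add_le_add (key _ (Or.inl rfl)) (key _ (Or.inr rfl))
    _ = _ := by
      rw [← ENNReal.ofReal_add (Real.exp_pos _).le (Real.exp_pos _).le]; congr 1; ring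

end Concentration

theorem measurable_decide {Θ : Type*} [MeasurableSpace Θ] {p : Θ → Prop} [DecidablePred p]
    (hp : MeasurableSet {θ | p θ}) : Measurable fun θ => decide (p θ) := by
  refine measurable_to_bool ?_
  convert hp using 1
  ext θ; simp

/-! ### The threshold check on two samples with a common random level. -/

section Threshold

theorem volume_unitInterval_abs_sub_le (c d : ℝ) :
    volume {u : I | |(u : ℝ) - c| ≤ d} ≤ ENNReal.ofReal (2 * d) := by
  rw [unitInterval.volume_apply]
  calc _ ≤ volume (Icc (c - d) (c + d)) := by
        refine measure_mono ?_
        rintro _ ⟨u, hu, rfl⟩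
        have := abs_le.mp (show |(u : ℝ) - c| ≤ d from hu)
        constructor <;> linarith
    _ = _ := by rw [Real.volume_Icc]; congr 1; ring

variable {Z : Type*}

theorem rThreshold_eq_true {n : ℕ} {S : Fin n → Z} {z : ℝ} {φ : Z → ℝ} {u : I} :
    rThreshold S z φ u = true ↔ 3 / 4 * z + 3 / 4 * z * (u : ℝ) < (∑ i, φ (S i)) / n := by
  simp [rThreshold]

theorem rThreshold_eq_false {n : ℕ} {S : Fin n → Z} {z : ℝ} {φ : Z → ℝ} {u : I} :
    rThreshold S z φ u = false ↔ (∑ i, φ (S i)) / n ≤ 3 / 4 * z + 3 / 4 * z * (u : ℝ) := by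
  simp [rThreshold]

/-- The specification of the threshold check for a function of mean `a`, on two samples. -/
def ThresholdSpec (z a : ℝ) (b₁ b₂ : Bool) : Prop :=
  b₁ = b₂ ∧ (b₁ = true → z / 2 ≤ a) ∧ (b₁ = false → a ≤ 2 * z)

/-- For `a ≤ 2z` both empirical means deviate by at most `2ηz`, less than the distance of the level
from `a`, so they lie on the same side of the level. For larger `a` both are at least `7a/8`, above
every possible level. The bounds on `a` use `η ≤ 1/8` and the range `[3z/4, 3z/2]` of the level. -/
theorem thresholdSpec_of_close {n : ℕ} {S₁ S₂ : Fin n → Z} {z a η : ℝ} {φ : Z → ℝ} {u : I}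
    (hη : 0 ≤ η) (hη1 : η ≤ 1 / 8) (hz : 0 < z)
    (h₁ : |(∑ i, φ (S₁ i)) / n - a| ≤ η * max a z) (h₂ : |(∑ i, φ (S₂ i)) / n - a| ≤ η * max a z)
    (hu : 2 * η * z < |3 / 4 * z + 3 / 4 * z * (u : ℝ) - a|) :
    ThresholdSpec z a (rThreshold S₁ z φ u) (rThreshold S₂ z φ u) := by
  have hu0 := u.2.1
  have hu1 := u.2.2
  have hzu : z * (u : ℝ) ≤ z := by nlinarith
  have hzu0 : 0 ≤ z * (u : ℝ) := by positivity
  have := abs_le.mp h₁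
  have := abs_le.mp h₂
  refine ⟨?_, ?_, ?_⟩
  · rw [Bool.eq_iff_iff, rThreshold_eq_true, rThreshold_eq_true]
    rcases le_total a (2 * z) with ha | ha
    · have hm : η * max a z ≤ 2 * η * z := by
        have : max a z ≤ 2 * z := max_le ha (by linarith)
        nlinarith
      rcases lt_abs.mp hu with h | h
      · constructor <;> intro <;> linarith
      · constructor <;> intro <;> linarith
    · have hm : η * max a z ≤ 1 / 8 * a := by
        rw [max_eq_left (by linarith)]; nlinarith
      constructor <;> intro <;> linarith
  · rw [rThreshold_eq_true]; intro h
    rcases le_total a z with ha | ha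
    · rw [max_eq_right ha] at *; nlinarith
    · linarith
  · rw [rThreshold_eq_false]; intro h
    rcases le_total a z with ha | ha
    · linarith
    · rw [max_eq_left ha] at *; nlinarith

/-- The level is uniform on an interval of length `3z/4`, so it comes within `2ηz` of the mean with
probability at most `16η/3 ≤ 6η`. The other term consists of a two-sided Chernoff bound for each
sample. -/
theorem measure_not_thresholdSpec_le [MeasurableSpace Z] (P : Measure Z) [IsProbabilityMeasure P]
    {n : ℕ} {φ : Z → ℝ} (hφ : Measurable φ) (h0 : ∀ z, 0 ≤ φ z) (h1 : ∀ z, φ z ≤ 1) {η z : ℝ}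
    (hη : 0 ≤ η) (hη1 : η ≤ 1 / 8) (hz : 0 < z) :
    (((Measure.pi fun _ : Fin n => P).prod (Measure.pi fun _ : Fin n => P)).prod volume)
      {q : ((Fin n → Z) × (Fin n → Z)) × I | ¬ ThresholdSpec z (∫ z, φ z ∂P)
        (rThreshold q.1.1 z φ q.2) (rThreshold q.1.2 z φ q.2)} ≤
      ENNReal.ofReal (6 * η + 4 * Real.exp (-(n * η ^ 2 * z / 4))) := by
  set a := ∫ z, φ z ∂P
  set F : Set (Fin n → Z) := {S | η * max a z < |(∑ i, φ (S i)) / n - a|}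
  have hF := measure_pi_abs_mean_sub_le P (n := n) hφ h0 h1 (z := z) hη (by linarith)
  set V : Set I := {u | |(u : ℝ) - (4 * a / (3 * z) - 1)| ≤ 8 / 3 * η}
  have hV : volume V ≤ ENNReal.ofReal (6 * η) :=
    (volume_unitInterval_abs_sub_le _ _).trans (ENNReal.ofReal_le_ofReal (by linarith))
  calc _ ≤ (((Measure.pi fun _ : Fin n => P).prod (Measure.pi fun _ : Fin n => P)).prod volume)
        (((F ×ˢ univ) ×ˢ univ ∪ (univ ×ˢ F) ×ˢ univ) ∪ univ ×ˢ V) := by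
        refine measure_mono ?_
        rintro ⟨⟨S₁, S₂⟩, u⟩ h
        by_contra hc
        simp only [mem_union, mem_prod, mem_univ, and_true, true_and, not_or] at hc
        obtain ⟨⟨hc1, hc2⟩, hc3⟩ := hc
        simp only [F, mem_ofPred_eq, not_lt] at hc1 hc2
        refine h (thresholdSpec_of_close hη hη1 hz hc1 hc2 ?_)
        simp only [V, mem_ofPred_eq, not_le] at hc3
        have h4 : 3 / 4 * z + 3 / 4 * z * (u : ℝ) - a =
            3 / 4 * z * ((u : ℝ) - (4 * a / (3 * z) - 1)) := by field_simp; ring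
        rw [h4, abs_mul, abs_of_pos (by positivity : 0 < 3 / 4 * z)]
        nlinarith
    _ ≤ (ENNReal.ofReal (2 * Real.exp (-(n * η ^ 2 * z / 4))) +
          ENNReal.ofReal (2 * Real.exp (-(n * η ^ 2 * z / 4)))) + ENNReal.ofReal (6 * η) := by
        refine (measure_union_le _ _).trans (add_le_add ((measure_union_le _ _).trans
          (add_le_add ?_ ?_)) ?_)
        · simpa [Measure.prod_prod] using hF
        · simpa [Measure.prod_prod] using hF
        · simpa [Measure.prod_prod] using hV
    _ = _ := by
        have := Real.exp_pos (-(n * η ^ 2 * z / 4))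
        rw [← ENNReal.ofReal_add, ← ENNReal.ofReal_add]
        · congr 1; ring
        all_goals positivity

end Threshold

/-! ### Rejection sampling and the reweighted law. -/

section Sampler

variable {Z : Type*}

/-- The rejection sampler as a function of the acceptance pattern. -/
def selectAccepted (m : ℕ) {n : ℕ} (β : Fin n → Bool) (S : Fin n → Z) : Option (Fin m → Z) :=
  let kept := (List.finRange n).filter β
  if h : m ≤ kept.length then some fun j => S (kept.get (j.castLE h)) else none

theorem rejectionSampler_eq (μ : Z → ℝ) (m : ℕ) {n : ℕ} (S : Fin n → Z) (u : Fin n → I) :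
    rejectionSampler μ m S u = selectAccepted m (fun i => decide ((u i : ℝ) ≤ μ (S i))) S := rfl

/-- For a given pattern, the sampler fails or selects distinct accepted positions. -/
theorem selectAccepted_cases (m : ℕ) {n : ℕ} (β : Fin n → Bool) :
    ((∀ S : Fin n → Z, selectAccepted m β S = none) ∧ ∑ i, (if β i then (1 : ℝ) else 0) < m) ∨
    ∃ e : Fin m → Fin n, Function.Injective e ∧ (∀ j, β (e j) = true) ∧
      ∀ S : Fin n → Z, selectAccepted m β S = some fun j => S (e j) := by
  set kept := (List.finRange n).filter β with hk
  by_cases h : m ≤ kept.length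
  · right
    refine ⟨fun j => kept.get (j.castLE h), ?_, fun j => ?_, fun S => ?_⟩
    · have hnd : kept.Nodup := (List.nodup_finRange n).filter _
      exact hnd.injective_get.comp (Fin.castLE_injective h)
    · have := List.get_mem kept (j.castLE h)
      exact (List.mem_filter.mp this).2
    · simp only [selectAccepted]; rw [dif_pos h]
  · left
    refine ⟨fun S => ?_, ?_⟩
    · simp only [selectAccepted]; rw [dif_neg h]
    · have hlen : kept.length = (Finset.univ.filter fun i => β i = true).card := by
        have hnd : kept.Nodup := (List.nodup_finRange n).filter _
        rw [← List.toFinset_card_of_nodup hnd]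
        congr 1; ext i; simp [hk]
      rw [Finset.sum_boole, ← hlen]
      exact_mod_cast not_le.mp h

/-- The case of an empty request is kept apart, because then the number of draws may be zero and the
tail bound for failure is void. -/
theorem exists_rejectionSampler_zero (μ : Z → ℝ) {n : ℕ} (S : Fin n → Z) (u : Fin n → I) :
    ∃ SW, rejectionSampler μ 0 S u = some SW := by
  simp [rejectionSampler]

variable [MeasurableSpace Z]

/-- A function of the outcome of the rejection sampler is measurable if it is so for each kind of
outcome. -/
theorem measurable_rejectionSampler {Θ Y : Type*} [MeasurableSpace Θ] [MeasurableSpace Y] {n m : ℕ}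
    {μ : Θ → Z → ℝ} (hμ : Measurable fun p : Θ × Z => μ p.1 p.2) {S : Θ → Fin n → Z}
    (hS : Measurable S) {u : Θ → Fin n → I} (hu : Measurable u)
    {F : Θ → Option (Fin m → Z) → Y} (hnone : Measurable fun θ => F θ none)
    (hsome : Measurable fun p : Θ × (Fin m → Z) => F p.1 (some p.2)) :
    Measurable fun θ => F θ (rejectionSampler (μ θ) m (S θ) (u θ)) := by
  have hβ : Measurable fun θ => fun i => decide ((u θ i : ℝ) ≤ μ θ (S θ i)) := by
    refine measurable_pi_lambda _ fun i => measurable_decide ?_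
    refine measurableSet_le ?_ (hμ.comp (f := fun θ => (θ, S θ i)) (by fun_prop))
    exact measurable_subtype_coe.comp ((measurable_pi_apply i).comp hu)
  -- There are finitely many acceptance patterns, and for each of them the sampler always fails or
  -- is a fixed selection of coordinates.
  have hG : Measurable fun p : Θ × (Fin n → Bool) => F p.1 (selectAccepted m p.2 (S p.1)) := by
    refine measurable_from_prod_countable_left fun β => ?_
    rcases selectAccepted_cases (Z := Z) m β with ⟨h, _⟩ | ⟨e, _, _, h⟩
    · simp only [h]; exact hnone
    · simp only [h]
      exact hsome.comp (f := fun θ => (θ, fun j => S θ (e j))) (by fun_prop)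
  exact hG.comp (measurable_id.prodMk hβ)

/-- The acceptance region of the rejection sampler. -/
def acceptSet (μ : Z → ℝ) : Set (Z × I) := {q | (q.2 : ℝ) ≤ μ q.1}

omit [MeasurableSpace Z] in
theorem mem_acceptSet {μ : Z → ℝ} {q : Z × I} : q ∈ acceptSet μ ↔ (q.2 : ℝ) ≤ μ q.1 := Iff.rfl

theorem measurableSet_acceptSet {μ : Z → ℝ} (hμ : Measurable μ) : MeasurableSet (acceptSet μ) :=
  measurableSet_le (by fun_prop) (by fun_prop)

/-- The law of an accepted example. -/
def reweight (P : Measure Z) (μ : Z → ℝ) : Measure Z :=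
  (ProbabilityTheory.cond (P.prod volume) (acceptSet μ)).map Prod.fst

/-- Measurable functions with values in `[0, 1]`. -/
structure IsWeight (μ : Z → ℝ) : Prop where
  measurable : Measurable μ
  nonneg : ∀ z, 0 ≤ μ z
  le_one : ∀ z, μ z ≤ 1

theorem IsWeight.integrable {μ : Z → ℝ} (hμ : IsWeight μ) (P : Measure Z) [IsFiniteMeasure P] :
    Integrable μ P := by
  refine Integrable.of_bound hμ.measurable.aestronglyMeasurable 1 (ae_of_all _ fun z => ?_)
  rw [Real.norm_eq_abs, abs_of_nonneg (hμ.nonneg z)]; exact hμ.le_one z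

variable (P : Measure Z) [IsProbabilityMeasure P]

/-- Fubini: the fibre of the acceptance region over `z` is the interval `[0, μ z]`. -/
theorem measure_acceptSet_inter {μ : Z → ℝ} (hμ : IsWeight μ) {B : Set Z} (hB : MeasurableSet B) :
    (P.prod (volume : Measure I)) (acceptSet μ ∩ Prod.fst ⁻¹' B) =
      ENNReal.ofReal (∫ z in B, μ z ∂P) := by
  rw [Measure.prod_apply ((measurableSet_acceptSet hμ.measurable).inter (measurable_fst hB))]
  have : ∀ z, volume (Prod.mk z ⁻¹' (acceptSet μ ∩ Prod.fst ⁻¹' B) : Set I) =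
      B.indicator (fun z => ENNReal.ofReal (μ z)) z := by
    intro z
    by_cases hz : z ∈ B
    · rw [indicator_of_mem hz]
      have : (Prod.mk z ⁻¹' (acceptSet μ ∩ Prod.fst ⁻¹' B) : Set I) =
          Iic ⟨μ z, hμ.nonneg z, hμ.le_one z⟩ := by
        ext u; simp [mem_acceptSet, hz, ← Subtype.coe_le_coe]
      rw [this, unitInterval.volume_Iic]
    · rw [indicator_of_notMem hz]
      have : (Prod.mk z ⁻¹' (acceptSet μ ∩ Prod.fst ⁻¹' B) : Set I) = ∅ := by
        ext u; simp [hz]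
      rw [this, measure_empty]
  simp_rw [this]
  rw [lintegral_indicator hB, ofReal_integral_eq_lintegral_ofReal
    (hμ.integrable P).integrableOn (ae_of_all _ hμ.nonneg)]

theorem measure_acceptSet {μ : Z → ℝ} (hμ : IsWeight μ) :
    (P.prod (volume : Measure I)) (acceptSet μ) = ENNReal.ofReal (∫ z, μ z ∂P) := by
  have := measure_acceptSet_inter P hμ MeasurableSet.univ
  simpa using this

theorem measure_acceptSet_ne_zero {μ : Z → ℝ} (hμ : IsWeight μ) (ha : 0 < ∫ z, μ z ∂P) :
    (P.prod (volume : Measure I)) (acceptSet μ) ≠ 0 := by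
  rw [measure_acceptSet P hμ]; simpa using ha

theorem isProbabilityMeasure_reweight {μ : Z → ℝ} (hμ : IsWeight μ) (ha : 0 < ∫ z, μ z ∂P) :
    IsProbabilityMeasure (reweight P μ) := by
  have := ProbabilityTheory.cond_isProbabilityMeasure (measure_acceptSet_ne_zero P hμ ha)
  exact Measure.isProbabilityMeasure_map measurable_fst.aemeasurable

omit [IsProbabilityMeasure P] in
theorem reweight_absolutelyContinuous (μ : Z → ℝ) : reweight P μ ≪ P := by
  refine Measure.AbsolutelyContinuous.mk fun s hs h => ?_
  rw [reweight, Measure.map_apply measurable_fst hs]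
  refine ProbabilityTheory.cond_absolutelyContinuous ?_
  rw [show (Prod.fst ⁻¹' s : Set (Z × I)) = s ×ˢ univ by ext; simp, Measure.prod_prod, h, zero_mul]

theorem reweight_real_mul {μ : Z → ℝ} (hμ : IsWeight μ) (ha : 0 < ∫ z, μ z ∂P) {B : Set Z}
    (hB : MeasurableSet B) :
    (reweight P μ).real B * ∫ z, μ z ∂P = ∫ z in B, μ z ∂P := by
  have hB0 : 0 ≤ ∫ z in B, μ z ∂P := integral_nonneg hμ.nonneg
  rw [Measure.real, reweight, Measure.map_apply measurable_fst hB,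
    ProbabilityTheory.cond_apply (measurableSet_acceptSet hμ.measurable), measure_acceptSet P hμ,
    measure_acceptSet_inter P hμ hB, ENNReal.toReal_mul, ENNReal.toReal_inv,
    ENNReal.toReal_ofReal ha.le, ENNReal.toReal_ofReal hB0]
  field_simp

/-- An acceptance pattern is a box in the space of pairs (example, number), so the pairs stay
independent when the pattern is given. -/
theorem cond_pi {ι : Type*} [Fintype ι] {Y : Type*} [MeasurableSpace Y] (Q : Measure Y)
    [IsProbabilityMeasure Q] {G : ι → Set Y} (hG : ∀ i, MeasurableSet (G i))
    (h0 : ∀ i, Q (G i) ≠ 0) :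
    ProbabilityTheory.cond (Measure.pi fun _ : ι => Q) (univ.pi G) =
      Measure.pi fun i => ProbabilityTheory.cond Q (G i) := by
  have := fun i => ProbabilityTheory.cond_isProbabilityMeasure (h0 i)
  refine (Measure.pi_eq fun s hs => ?_).symm
  rw [ProbabilityTheory.cond_apply (MeasurableSet.univ_pi hG), ← pi_inter_distrib, Measure.pi_pi,
    Measure.pi_pi, ENNReal.prod_inv_distrib, ← Finset.prod_mul_distrib]
  · exact Finset.prod_congr rfl fun i _ => (ProbabilityTheory.cond_apply (hG i) _ _).symm
  · intro i _ j _ _; right; exact measure_ne_top _ _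

/-- The law of the outcome of the rejection sampler, on success, is dominated by the law of
independent accepted examples. -/
theorem measure_rejectionSampler_mem_le {μ : Z → ℝ} (hμ : IsWeight μ) (ha : 0 < ∫ z, μ z ∂P)
    {m n : ℕ} {E : Set (Fin m → Z)} (hE : MeasurableSet E) :
    ((Measure.pi fun _ : Fin n => P).prod (Measure.pi fun _ : Fin n => (volume : Measure I)))
      {q | ∃ SW, rejectionSampler μ m q.1 q.2 = some SW ∧ SW ∈ E} ≤
      (Measure.pi fun _ : Fin m => reweight P μ) E := by
  have hA := measurableSet_acceptSet hμ.measurable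
  set Q := P.prod (volume : Measure I)
  have hmp := measurePreserving_arrowProdEquivProdArrow Z I (Fin n) (fun _ => P) (fun _ => volume)
  rw [← hmp.measure_preimage_equiv]
  set β : (Fin n → Z × I) → Fin n → Bool := fun q i => decide ((q i).2 ≤ μ (q i).1)
  have hβ : Measurable β := by
    refine measurable_pi_lambda _ fun i => measurable_decide ?_
    exact measurableSet_le (by fun_prop) (hμ.measurable.comp (by fun_prop))
  have hprob : IsProbabilityMeasure (reweight P μ) := isProbabilityMeasure_reweight P hμ ha
  -- Given the pattern `b`, the pairs at accepted positions are independent and follow the law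
  -- conditioned on acceptance. So each pattern contributes at most its own probability times the
  -- product of reweighted laws, and these probabilities add up to one.
  have key : ∀ b : Fin n → Bool, (Measure.pi fun _ : Fin n => Q)
      {q | β q = b ∧ ∃ SW, selectAccepted m b (fun i => (q i).1) = some SW ∧ SW ∈ E} ≤
      (Measure.pi fun _ : Fin n => Q) (β ⁻¹' {b}) *
        (Measure.pi fun _ : Fin m => reweight P μ) E := by
    intro b
    rcases selectAccepted_cases (Z := Z) m b with ⟨h, _⟩ | ⟨e, he, heb, h⟩
    · simp [h]
    simp only [h, Option.some.injEq, exists_eq_left']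
    set G : Fin n → Set (Z × I) := fun i => if b i then acceptSet μ else (acceptSet μ)ᶜ
    have hG : ∀ i, MeasurableSet (G i) := by
      intro i; simp only [G]; split_ifs
      exacts [hA, hA.compl]
    have hbox : β ⁻¹' {b} = univ.pi G := by
      ext q
      simp only [mem_preimage, mem_singleton_iff, mem_univ_pi, funext_iff, β]
      refine forall_congr' fun i => ?_
      cases hb : b i <;> simp [G, hb, mem_acceptSet]
    set F : Set (Fin n → Z × I) := {q | (fun j => (q (e j)).1) ∈ E}
    have hFm : Measurable fun (q : Fin n → Z × I) => fun j => (q (e j)).1 := by fun_prop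
    have hset : {q | β q = b ∧ (fun j => (q (e j)).1) ∈ E} = univ.pi G ∩ F := by
      rw [← hbox]; rfl
    rw [hset, hbox]
    -- A pattern that has probability zero contributes nothing, and conditioning on it would be
    -- degenerate.
    by_cases h0 : ∃ i, Q (G i) = 0
    · obtain ⟨i, hi⟩ := h0
      refine (measure_mono inter_subset_left).trans ?_
      rw [Measure.pi_pi, Finset.prod_eq_zero (Finset.mem_univ i) hi]; simp
    push Not at h0
    rw [← ProbabilityTheory.cond_mul_eq_inter (MeasurableSet.univ_pi hG), mul_comm, cond_pi Q hG h0]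
    have := fun i => ProbabilityTheory.cond_isProbabilityMeasure (h0 i)
    have h1 : (fun j => ProbabilityTheory.cond Q (G (e j))) =
        fun _ : Fin m => ProbabilityTheory.cond Q (acceptSet μ) := by
      funext j; simp [G, heb]
    have h2 := (measurePreserving_comp_injective
      (fun i => ProbabilityTheory.cond Q (G i)) e he).map_eq
    have h3 : (Measure.pi fun i => ProbabilityTheory.cond Q (G i)).map
        (fun q j => (q (e j)).1) = Measure.pi fun _ : Fin m => reweight P μ := by
      rw [show (fun (q : Fin n → Z × I) (j : Fin m) => (q (e j)).1) =
        (fun (x : Fin m → Z × I) j => (x j).1) ∘ (fun q j => q (e j)) from rfl,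
        ← Measure.map_map (by fun_prop) (by fun_prop), h2, h1]
      have := ProbabilityTheory.cond_isProbabilityMeasure (measure_acceptSet_ne_zero P hμ ha)
      have : SigmaFinite ((ProbabilityTheory.cond Q (acceptSet μ)).map Prod.fst) :=
        inferInstanceAs (SigmaFinite (reweight P μ))
      rw [Measure.pi_map_pi (fun _ => measurable_fst.aemeasurable)]
      rfl
    rw [← h3, Measure.map_apply hFm hE]
    exact le_rfl
  calc _ ≤ (Measure.pi fun _ : Fin n => Q) (⋃ b : Fin n → Bool,
        {q | β q = b ∧ ∃ SW, selectAccepted m b (fun i => (q i).1) = some SW ∧ SW ∈ E}) := by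
        refine measure_mono fun q hq => ?_
        rw [mem_iUnion]
        exact ⟨β q, rfl, hq⟩
    _ ≤ ∑ b : Fin n → Bool, (Measure.pi fun _ : Fin n => Q) (β ⁻¹' {b}) *
          (Measure.pi fun _ : Fin m => reweight P μ) E :=
        (measure_iUnion_fintype_le _ _).trans (Finset.sum_le_sum fun b _ => key b)
    _ = _ := by
        rw [← Finset.sum_mul, sum_measure_preimage_singleton _
          fun b _ => hβ (measurableSet_singleton b)]
        simp

/-- The rejection sampler rarely fails if there are twice as many examples as needed on average. -/
theorem measure_rejectionSampler_none_le {μ : Z → ℝ} (hμ : IsWeight μ) {m n : ℕ}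
    (hm : m ≤ n * (∫ z, μ z ∂P) / 2) :
    ((Measure.pi fun _ : Fin n => P).prod (Measure.pi fun _ : Fin n => (volume : Measure I)))
      {q | rejectionSampler μ m q.1 q.2 = none} ≤
      ENNReal.ofReal (2 * Real.exp (-(n * (∫ z, μ z ∂P) / 16))) := by
  have hA := measurableSet_acceptSet hμ.measurable
  set Q := P.prod (volume : Measure I)
  set a := ∫ z, μ z ∂P
  have hmp := measurePreserving_arrowProdEquivProdArrow Z I (Fin n) (fun _ => P) (fun _ => volume)
  rw [← hmp.measure_preimage_equiv]
  have hint : ∫ q, (acceptSet μ).indicator (fun _ => (1 : ℝ)) q ∂Q = a := by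
    rw [integral_indicator hA]
    simp only [integral_const, measureReal_restrict_apply_univ, smul_eq_mul, mul_one]
    rw [Measure.real, measure_acceptSet P hμ, ENNReal.toReal_ofReal (integral_nonneg hμ.nonneg)]
  -- Failure leaves fewer than `m ≤ n a / 2` acceptances, a deviation of the acceptance frequency by
  -- more than half of its mean `a`.
  have h := measure_pi_abs_mean_sub_le Q (n := n) (φ := (acceptSet μ).indicator fun _ => (1 : ℝ))
    (measurable_const.indicator hA) (indicator_nonneg fun _ _ => zero_le_one)
    (fun z => indicator_apply_le' (fun _ => le_rfl) fun _ => zero_le_one) (η := 1 / 2) (z := a)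
    (by norm_num) (by norm_num)
  rw [hint, max_self] at h
  refine (measure_mono fun q hq => ?_).trans (h.trans (ENNReal.ofReal_le_ofReal ?_))
  · simp only [mem_preimage, mem_ofPred_eq] at hq ⊢
    rw [rejectionSampler_eq] at hq
    rcases selectAccepted_cases (Z := Z) m
      (fun i => decide ((q i).2 ≤ μ (q i).1)) with ⟨_, hlt⟩ | ⟨e, _, _, hs⟩
    · have hsum : ∑ i, (acceptSet μ).indicator (fun _ => (1 : ℝ)) (q i) < n * a / 2 := by
        refine lt_of_eq_of_lt ?_ (hlt.trans_le hm)
        refine Finset.sum_congr rfl fun i _ => ?_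
        by_cases hq : ((q i).2 : ℝ) ≤ μ (q i).1
        · rw [indicator_of_mem (mem_acceptSet.mpr hq)]; simp [hq]
        · rw [indicator_of_notMem (mem_acceptSet.not.mpr hq)]; simp [hq]
      have hn : (0 : ℝ) < n := by
        rcases Nat.eq_zero_or_pos n with rfl | hn
        · simp at hsum
        · exact_mod_cast hn
      rw [lt_abs]; right
      have : (∑ i, (acceptSet μ).indicator (fun _ => (1 : ℝ)) (q i)) / n < a / 2 := by
        rw [div_lt_iff₀ hn]; linarith
      linarith
    · exact absurd ((hs _).symm.trans hq) (Option.some_ne_none _)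
  · refine mul_le_mul_of_nonneg_left (Real.exp_le_exp.mpr ?_) zero_le_two
    apply le_of_eq; ring

end Sampler

/-! ### Laws of labelled examples and abstract replicable learners. -/

section Learner

variable {X : Type*} [MeasurableSpace X] {R : Type*} [MeasurableSpace R]

/-- The laws of labelled examples for the target `f`. -/
def IsLaw (f : X → Bool) (P : Measure (X × Bool)) : Prop :=
  IsProbabilityMeasure P ∧ ∀ᵐ z ∂P, z.2 = f z.1

/-- The error of a hypothesis under a law of labelled examples. -/
def lawErr (P : Measure (X × Bool)) (h : X → Bool) : ℝ := P.real {z | h z.1 ≠ z.2}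

/-- The weighted error of a hypothesis, not normalized. -/
def weightedErr (P : Measure (X × Bool)) (μ : X × Bool → ℝ) (h : X → Bool) : ℝ :=
  ∫ z, (if h z.1 ≠ z.2 then μ z else 0) ∂P

theorem isLaw_labelled {f : X → Bool} (hf : Measurable f) (D : Measure X) [IsProbabilityMeasure D] :
    IsLaw f (labelled D f) := by
  have hm : Measurable fun x => (x, f x) := measurable_id.prodMk hf
  refine ⟨Measure.isProbabilityMeasure_map hm.aemeasurable, ?_⟩
  rw [labelled, ae_map_iff hm.aemeasurable]
  · simp
  · exact measurableSet_eq_fun measurable_snd (hf.comp measurable_fst)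

/-- A law carried by the graph of `f` is determined by its first marginal. Thus a guarantee for all
`D` applies to all such laws, in particular to reweighted ones. -/
theorem IsLaw.eq_labelled {f : X → Bool} (hf : Measurable f) {P : Measure (X × Bool)}
    (hP : IsLaw f P) : P = labelled (P.map Prod.fst) f := by
  have hm : Measurable fun x => (x, f x) := measurable_id.prodMk hf
  rw [labelled, Measure.map_map hm measurable_fst]
  conv_lhs => rw [← Measure.map_id (μ := P)]
  refine Measure.map_congr ?_
  filter_upwards [hP.2] with z hz
  exact Prod.ext rfl hz

theorem IsLaw.reweight {f : X → Bool} {P : Measure (X × Bool)} (hP : IsLaw f P)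
    {μ : X × Bool → ℝ} (hμ : IsWeight μ) (ha : 0 < ∫ z, μ z ∂P) : IsLaw f (reweight P μ) :=
  have := hP.1
  ⟨isProbabilityMeasure_reweight P hμ ha, (reweight_absolutelyContinuous P μ).ae_le hP.2⟩

theorem measurableSet_ne_label {h : X → Bool} (hh : Measurable h) :
    MeasurableSet {z : X × Bool | h z.1 ≠ z.2} :=
  (measurableSet_eq_fun (hh.comp measurable_fst) measurable_snd).compl

theorem lawErr_labelled {f h : X → Bool} (hf : Measurable f) (hh : Measurable h) (D : Measure X) :
    lawErr (labelled D f) h = er D f h := by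
  have hm : Measurable fun x => (x, f x) := measurable_id.prodMk hf
  rw [lawErr, er, Measure.real, labelled, Measure.map_apply hm (measurableSet_ne_label hh)]
  rfl

/-- In this form an error bound `β` under the reweighted law becomes the bound `β ∫ μ` for the
weighted error, as used in both potential arguments. -/
theorem lawErr_reweight_mul {P : Measure (X × Bool)} [IsProbabilityMeasure P] {μ : X × Bool → ℝ}
    (hμ : IsWeight μ) (ha : 0 < ∫ z, μ z ∂P) {h : X → Bool} (hh : Measurable h) :
    lawErr (reweight P μ) h * ∫ z, μ z ∂P = weightedErr P μ h := by
  rw [lawErr, reweight_real_mul P hμ ha (measurableSet_ne_label hh),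
    ← integral_indicator (measurableSet_ne_label hh), weightedErr]
  congr 1; ext z
  simp [indicator_apply]

/-- A randomized learner, replicable and accurate up to probability `δ` for each law of the
examples. Replicability is stated in terms of an equivalence relation that is finer than equality
of the outputs, and measurable. -/
structure IsLearner {ι : Type*} [Fintype ι] (f : X → Bool) (ν : Measure R)
    (A : (ι → X × Bool) → R → X → Bool) (agree : R → (ι → X × Bool) → (ι → X × Bool) → Prop)
    (δ β : ℝ) : Prop where
  measurable_eval : Measurable fun q : ((ι → X × Bool) × R) × X => A q.1.1 q.1.2 q.2
  measurableSet_agree :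
    MeasurableSet {q : ((ι → X × Bool) × (ι → X × Bool)) × R | agree q.2 q.1.1 q.1.2}
  equivalence : ∀ r, Equivalence (agree r)
  eq_of_agree : ∀ {r S₁ S₂}, agree r S₁ S₂ → A S₁ r = A S₂ r
  replicable : ∀ P, IsLaw f P →
    (((Measure.pi fun _ : ι => P).prod (Measure.pi fun _ : ι => P)).prod ν)
      {q | ¬ agree q.2 q.1.1 q.1.2} ≤ ENNReal.ofReal δ
  accurate : ∀ P, IsLaw f P →
    ((Measure.pi fun _ : ι => P).prod ν) {q | β < lawErr P (A q.1 q.2)} ≤ ENNReal.ofReal δ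

theorem IsReplicableWeakLearner.isLearner {f : X → Bool} (hf : Measurable f) {ν : Measure R}
    {m : ℕ} {W : (Fin m → X × Bool) → R → X → Bool} {γ p : ℝ}
    (hW : IsReplicableWeakLearner f ν W γ p) :
    IsLearner f ν W (fun r S₁ S₂ => W S₁ r = W S₂ r) p (1 / 2 - γ) where
  measurable_eval := hW.measurable_eval
  measurableSet_agree := hW.measurableSet_agree
  equivalence r := ⟨fun _ => rfl, fun h => h.symm, fun h₁ h₂ => h₁.trans h₂⟩
  eq_of_agree h := h
  replicable P hP := by
    have := hP.1
    have hD : IsProbabilityMeasure (P.map Prod.fst) :=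
      Measure.isProbabilityMeasure_map measurable_fst.aemeasurable
    have := hW.replicable _ hD
    rw [← hP.eq_labelled hf] at this
    exact this
  accurate P hP := by
    have := hP.1
    have hD : IsProbabilityMeasure (P.map Prod.fst) :=
      Measure.isProbabilityMeasure_map measurable_fst.aemeasurable
    have h := hW.advantage _ hD
    have hh : ∀ S r, Measurable (W S r) := fun S r =>
      hW.measurable_eval.comp (measurable_prodMk_left (x := (S, r)))
    simp_rw [← lawErr_labelled hf (hh _ _), ← hP.eq_labelled hf] at h
    exact h

/-- A learner may be fed with a sample indexed by an equivalent type. -/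
theorem IsLearner.reindex {ι κ : Type*} [Fintype ι] [Fintype κ] {f : X → Bool} {ν : Measure R}
    [IsProbabilityMeasure ν]
    {A : (ι → X × Bool) → R → X → Bool} {agree : R → (ι → X × Bool) → (ι → X × Bool) → Prop}
    {δ β : ℝ} (hA : IsLearner f ν A agree δ β) (e : ι ≃ κ) :
    IsLearner f ν (fun (S : κ → X × Bool) r => A (fun i => S (e i)) r)
      (fun r S₁ S₂ => agree r (fun i => S₁ (e i)) (fun i => S₂ (e i))) δ β where
  measurable_eval :=
    hA.measurable_eval.comp
      (f := fun q : ((κ → X × Bool) × R) × X => (((fun i => q.1.1 (e i)), q.1.2), q.2))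
      (by fun_prop)
  measurableSet_agree :=
    measurableSet_preimage (f := fun q : ((κ → X × Bool) × (κ → X × Bool)) × R =>
      (((fun i => q.1.1 (e i)), (fun i => q.1.2 (e i))), q.2)) (by fun_prop) hA.measurableSet_agree
  equivalence r := ⟨fun _ => (hA.equivalence r).refl _, fun h => (hA.equivalence r).symm h,
    fun h₁ h₂ => (hA.equivalence r).trans h₁ h₂⟩
  eq_of_agree h := hA.eq_of_agree h
  replicable P hP := by
    have := hP.1
    have h := measurePreserving_comp_injective (fun _ : κ => P) e e.injective
    have h2 := (h.prod h).prod (MeasurePreserving.id ν)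
    refine le_trans ?_ (hA.replicable P hP)
    rw [← h2.map_eq]
    exact Measure.le_map_apply h2.measurable.aemeasurable _
  accurate P hP := by
    have := hP.1
    have h := measurePreserving_comp_injective (fun _ : κ => P) e e.injective
    have h2 := h.prod (MeasurePreserving.id ν)
    refine le_trans ?_ (hA.accurate P hP)
    rw [← h2.map_eq]
    exact Measure.le_map_apply h2.measurable.aemeasurable _

end Learner

/-- This inequality holds for outer measures, so it serves for events that are not known to be
measurable. -/
theorem measure_preimage_le_of_measurePreserving {Ω Ω' : Type*} [MeasurableSpace Ω]
    [MeasurableSpace Ω'] {ℙ : Measure Ω} {ℙ' : Measure Ω'} {g : Ω → Ω'}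
    (hg : MeasurePreserving g ℙ ℙ') (s : Set Ω') : ℙ (g ⁻¹' s) ≤ ℙ' s := by
  rw [← hg.map_eq]; exact Measure.le_map_apply hg.measurable.aemeasurable _

/-! ### Calls to a learner on reweighted examples. -/

section Call

variable {Z : Type*} [MeasurableSpace Z] (P : Measure Z) [IsProbabilityMeasure P]

/-- Fubini over the additional randomness `Y`, which will be the seed of the learner, alone or
together with an independent third sample. -/
theorem measure_rejectionSampler_prod_le {μ : Z → ℝ} (hμ : IsWeight μ) (ha : 0 < ∫ z, μ z ∂P)
    {m n : ℕ} {Y : Type*} [MeasurableSpace Y] (ν : Measure Y) [IsProbabilityMeasure ν]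
    {E : Set ((Fin m → Z) × Y)} (hE : MeasurableSet E) :
    (((Measure.pi fun _ : Fin n => P).prod (Measure.pi fun _ : Fin n => (volume : Measure I))).prod
      ν) {q | ∃ SW, rejectionSampler μ m q.1.1 q.1.2 = some SW ∧ (SW, q.2) ∈ E} ≤
      ((Measure.pi fun _ : Fin m => reweight P μ).prod ν) E := by
  have := isProbabilityMeasure_reweight P hμ ha
  have hmeas : MeasurableSet {q : ((Fin n → Z) × (Fin n → I)) × Y |
      ∃ SW, rejectionSampler μ m q.1.1 q.1.2 = some SW ∧ (SW, q.2) ∈ E} := by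
    refine measurableSet_setOfPred.mpr (measurable_rejectionSampler (μ := fun _ => μ)
      (hμ.measurable.comp measurable_snd) (S := fun q : ((Fin n → Z) × (Fin n → I)) × Y => q.1.1)
      (by fun_prop) (u := fun q => q.1.2) (by fun_prop)
      (F := fun q o => ∃ SW, o = some SW ∧ (SW, q.2) ∈ E) ?_ ?_)
    · simp
    · simp only [Option.some.injEq, exists_eq_left']
      refine measurableSet_setOfPred.mp (measurableSet_preimage (f := fun p :
        (((Fin n → Z) × (Fin n → I)) × Y) × (Fin m → Z) => (p.2, p.1.2)) (by fun_prop) hE)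
  rw [Measure.prod_apply_symm hmeas, Measure.prod_apply_symm hE]
  refine lintegral_mono fun y => ?_
  exact measure_rejectionSampler_mem_le P hμ ha (measurable_prodMk_right hE)

end Call

section CallSpec

variable {X : Type*} [MeasurableSpace X] {R : Type*} [MeasurableSpace R]

/-- The specification of a call to a learner on reweighted examples, for two samples. -/
def CallSpec {m n : ℕ} (P : Measure (X × Bool)) (A : (Fin m → X × Bool) → R → X → Bool)
    (agree : R → (Fin m → X × Bool) → (Fin m → X × Bool) → Prop) (β : ℝ) (μ : X × Bool → ℝ)
    (S₁ S₂ : Fin n → X × Bool) (u : Fin n → I) (r : R) : Prop :=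
  ∃ SW₁ SW₂, rejectionSampler μ m S₁ u = some SW₁ ∧ rejectionSampler μ m S₂ u = some SW₂ ∧
    agree r SW₁ SW₂ ∧ weightedErr P μ (A SW₁ r) ≤ β * ∫ z, μ z ∂P

theorem measurable_weightedErr {Θ : Type*} [MeasurableSpace Θ] (P : Measure (X × Bool))
    [IsProbabilityMeasure P] {μ : Θ → X × Bool → ℝ}
    (hμ : Measurable fun p : Θ × (X × Bool) => μ p.1 p.2) {h : Θ → X → Bool}
    (hh : Measurable fun p : Θ × X => h p.1 p.2) :
    Measurable fun θ => weightedErr P (μ θ) (h θ) := by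
  refine (StronglyMeasurable.integral_prod_right'
    (f := fun p : Θ × (X × Bool) => if h p.1 p.2.1 ≠ p.2.2 then μ p.1 p.2 else 0) ?_).measurable
  refine (Measurable.ite ?_ hμ measurable_const).stronglyMeasurable
  refine (measurableSet_eq_fun ?_ ?_).compl
  · exact hh.comp (f := fun p : Θ × (X × Bool) => (p.1, p.2.1)) (by fun_prop)
  · fun_prop

theorem measurable_integral_weight {Θ Z : Type*} [MeasurableSpace Θ] [MeasurableSpace Z]
    (P : Measure Z) [IsProbabilityMeasure P] {μ : Θ → Z → ℝ}
    (hμ : Measurable fun p : Θ × Z => μ p.1 p.2) : Measurable fun θ => ∫ z, μ θ z ∂P :=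
  (StronglyMeasurable.integral_prod_right' (f := fun p : Θ × Z => μ p.1 p.2)
    hμ.stronglyMeasurable).measurable

variable {f : X → Bool} {ν : Measure R} {m n : ℕ} {A : (Fin m → X × Bool) → R → X → Bool}
  {agree : R → (Fin m → X × Bool) → (Fin m → X × Bool) → Prop} {δ β : ℝ}

theorem measurableSet_callSpec (hA : IsLearner f ν A agree δ β) (P : Measure (X × Bool))
    [IsProbabilityMeasure P] {Θ : Type*} [MeasurableSpace Θ] {μ : Θ → X × Bool → ℝ}
    (hμ : Measurable fun p : Θ × (X × Bool) => μ p.1 p.2) {S₁ S₂ : Θ → Fin n → X × Bool}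
    (hS₁ : Measurable S₁) (hS₂ : Measurable S₂) {u : Θ → Fin n → I} (hu : Measurable u) {r : Θ → R}
    (hr : Measurable r) :
    MeasurableSet {θ | CallSpec P A agree β (μ θ) (S₁ θ) (S₂ θ) (u θ) (r θ)} := by
  refine measurableSet_setOfPred.mpr (measurable_rejectionSampler hμ hS₁ hu (F := fun θ o₁ =>
    ∃ SW₁ SW₂, o₁ = some SW₁ ∧ rejectionSampler (μ θ) m (S₂ θ) (u θ) = some SW₂ ∧
      agree (r θ) SW₁ SW₂ ∧ weightedErr P (μ θ) (A SW₁ (r θ)) ≤ β * ∫ z, μ θ z ∂P) ?_ ?_)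
  · simp
  refine measurable_rejectionSampler (Θ := Θ × (Fin m → X × Bool)) (μ := fun p => μ p.1)
    (hμ.comp (f := fun p : (Θ × (Fin m → X × Bool)) × (X × Bool) => (p.1.1, p.2)) (by fun_prop))
    (S := fun p => S₂ p.1) (by fun_prop) (u := fun p => u p.1) (by fun_prop)
    (F := fun p o₂ => ∃ SW₁ SW₂, some p.2 = some SW₁ ∧ o₂ = some SW₂ ∧ agree (r p.1) SW₁ SW₂ ∧
      weightedErr P (μ p.1) (A SW₁ (r p.1)) ≤ β * ∫ z, μ p.1 z ∂P) ?_ ?_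
  · simp
  simp only [Option.some.injEq, exists_and_left, exists_eq_left']
  refine Measurable.and ?_ (measurableSet_setOfPred.mp (measurableSet_le ?_ ?_))
  · refine measurableSet_setOfPred.mp ?_
    exact measurableSet_preimage (f := fun p : (Θ × (Fin m → X × Bool)) × (Fin m → X × Bool) =>
      ((p.1.2, p.2), r p.1.1)) (by fun_prop) hA.measurableSet_agree
  · refine measurable_weightedErr P
      (Θ := (Θ × (Fin m → X × Bool)) × (Fin m → X × Bool)) (μ := fun p => μ p.1.1)
      (h := fun p => A p.1.2 (r p.1.1)) ?_ ?_
    · exact hμ.comp (f := fun p : ((Θ × (Fin m → X × Bool)) × (Fin m → X × Bool)) × (X × Bool) =>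
        (p.1.1.1, p.2)) (by fun_prop)
    · exact hA.measurable_eval.comp (f := fun p : ((Θ × (Fin m → X × Bool)) ×
        (Fin m → X × Bool)) × X => ((p.1.1.2, r p.1.1.1), p.2)) (by fun_prop)
  · exact (measurable_const.mul (measurable_integral_weight P hμ)).comp
      (f := fun p : (Θ × (Fin m → X × Bool)) × (Fin m → X × Bool) => p.1.1) (by fun_prop)

/-- Calls to a replicable learner on reweighted examples rarely violate their specification. As the
two samplers share their randomness, the two samples are not independent; each of them is compared
with a third one that is. -/
theorem measure_not_callSpec_le [IsProbabilityMeasure ν] (hA : IsLearner f ν A agree δ β)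
    (hδ : 0 ≤ δ) {P : Measure (X × Bool)} (hP : IsLaw f P) {μ : X × Bool → ℝ} (hμ : IsWeight μ)
    (ha : 0 < ∫ z, μ z ∂P) {κ : ℝ} (hκ : 0 ≤ κ)
    (hfail : ((Measure.pi fun _ : Fin n => P).prod
      (Measure.pi fun _ : Fin n => (volume : Measure I)))
      {q | rejectionSampler μ m q.1 q.2 = none} ≤ ENNReal.ofReal κ) :
    (((Measure.pi fun _ : Fin n => P).prod (Measure.pi fun _ : Fin n => P)).prod
      ((Measure.pi fun _ : Fin n => (volume : Measure I)).prod ν))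
      {q | ¬ CallSpec P A agree β μ q.1.1 q.1.2 q.2.1 q.2.2} ≤ ENNReal.ofReal (2 * κ + 3 * δ) := by
  have := hP.1
  have hQ := hP.reweight hμ ha
  have := hQ.1
  set V := Measure.pi fun _ : Fin n => (volume : Measure I)
  set PS := Measure.pi fun _ : Fin n => P
  set G := Measure.pi fun _ : Fin m => reweight P μ
  set ℙ := (PS.prod PS).prod (V.prod ν)
  have hhm : ∀ S r, Measurable (A S r) := fun S r =>
    hA.measurable_eval.comp (measurable_prodMk_left (x := (S, r)))
  -- failures
  have hm1 : MeasurePreserving (fun q : ((Fin n → X × Bool) × (Fin n → X × Bool)) ×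
      ((Fin n → I) × R) => (q.1.1, q.2.1)) ℙ (PS.prod V) :=
    measurePreserving_fst.prod measurePreserving_fst
  have hm2 : MeasurePreserving (fun q : ((Fin n → X × Bool) × (Fin n → X × Bool)) ×
      ((Fin n → I) × R) => (q.1.2, q.2.1)) ℙ (PS.prod V) :=
    measurePreserving_snd.prod measurePreserving_fst
  have hf1 := (measure_preimage_le_of_measurePreserving hm1 _).trans hfail
  have hf2 := (measure_preimage_le_of_measurePreserving hm2 _).trans hfail
  -- inaccuracy
  have hmE : MeasurableSet {p : (Fin m → X × Bool) × R |
      β * ∫ z, μ z ∂P < weightedErr P μ (A p.1 p.2)} := by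
    refine measurableSet_lt measurable_const (measurable_weightedErr P
      (Θ := (Fin m → X × Bool) × R) (μ := fun _ => μ) (h := fun p => A p.1 p.2)
      (hμ.measurable.comp measurable_snd) hA.measurable_eval)
  have hacc : (G.prod ν) {p | β * ∫ z, μ z ∂P < weightedErr P μ (A p.1 p.2)} ≤
      ENNReal.ofReal δ := by
    refine le_trans (measure_mono fun p hp => ?_) (hA.accurate _ hQ)
    simp only [mem_ofPred_eq] at hp ⊢
    rw [← lawErr_reweight_mul hμ ha (hhm _ _)] at hp
    exact lt_of_mul_lt_mul_right hp ha.le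
  have hm3 : MeasurePreserving (fun q : ((Fin n → X × Bool) × (Fin n → X × Bool)) ×
      ((Fin n → I) × R) => ((q.1.1, q.2.1), q.2.2)) ℙ ((PS.prod V).prod ν) :=
    ((measurePreserving_prodAssoc PS V ν).symm).comp
      (measurePreserving_fst.prod (MeasurePreserving.id _))
  have hf3 := (measure_preimage_le_of_measurePreserving hm3 _).trans
    ((measure_rejectionSampler_prod_le P hμ ha ν hmE).trans hacc)
  -- disagreement, by means of a third sample
  have hmD : MeasurableSet {p : (Fin m → X × Bool) × ((Fin m → X × Bool) × R) |
      ¬ agree p.2.2 p.1 p.2.1} :=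
    measurableSet_preimage (f := fun p : (Fin m → X × Bool) × ((Fin m → X × Bool) × R) =>
      ((p.1, p.2.1), p.2.2)) (by fun_prop) hA.measurableSet_agree.compl
  have hdis : (G.prod (G.prod ν)) {p | ¬ agree p.2.2 p.1 p.2.1} ≤ ENNReal.ofReal δ := by
    have h1 := (measurePreserving_prodAssoc G G ν).symm
    exact (measure_preimage_le_of_measurePreserving h1 _).trans (hA.replicable _ hQ)
  have hdis2 := (measure_rejectionSampler_prod_le (n := n) P hμ ha (G.prod ν) hmD).trans hdis
  have hcore : MeasurePreserving (fun q : ((Fin n → I) × R) × (Fin m → X × Bool) =>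
      (q.1.1, (q.2, q.1.2))) ((V.prod ν).prod G) (V.prod (G.prod ν)) :=
    ((MeasurePreserving.id V).prod (Measure.measurePreserving_swap (μ := ν) (ν := G))).comp
      (measurePreserving_prodAssoc V ν G)
  have hm4 : MeasurePreserving (fun q : (((Fin n → X × Bool) × (Fin n → X × Bool)) ×
      ((Fin n → I) × R)) × (Fin m → X × Bool) => ((q.1.1.1, q.1.2.1), (q.2, q.1.2.2)))
      (ℙ.prod G) ((PS.prod V).prod (G.prod ν)) :=
    ((measurePreserving_prodAssoc PS V (G.prod ν)).symm).comp
      ((measurePreserving_fst.prod hcore).comp (measurePreserving_prodAssoc (PS.prod PS) _ G))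
  have hm5 : MeasurePreserving (fun q : (((Fin n → X × Bool) × (Fin n → X × Bool)) ×
      ((Fin n → I) × R)) × (Fin m → X × Bool) => ((q.1.1.2, q.1.2.1), (q.2, q.1.2.2)))
      (ℙ.prod G) ((PS.prod V).prod (G.prod ν)) :=
    ((measurePreserving_prodAssoc PS V (G.prod ν)).symm).comp
      ((measurePreserving_snd.prod hcore).comp (measurePreserving_prodAssoc (PS.prod PS) _ G))
  have hf4 := (measure_preimage_le_of_measurePreserving hm4 _).trans hdis2
  have hf5 := (measure_preimage_le_of_measurePreserving hm5 _).trans hdis2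
  set D : Set (((Fin n → X × Bool) × (Fin n → X × Bool)) × ((Fin n → I) × R)) :=
    {q | ∃ SW₁ SW₂, rejectionSampler μ m q.1.1 q.2.1 = some SW₁ ∧
      rejectionSampler μ m q.1.2 q.2.1 = some SW₂ ∧ ¬ agree q.2.2 SW₁ SW₂}
  have hD : ℙ D ≤ ENNReal.ofReal δ + ENNReal.ofReal δ := by
    -- A third sample `g` with the reweighted law is adjoined. As `agree` is an equivalence
    -- relation, two selected samples that disagree cannot both agree with `g`; each selected sample
    -- disagrees with `g` with probability at most `δ`.
    have h1 : ℙ D = (ℙ.prod G) (D ×ˢ univ) := by rw [Measure.prod_prod, measure_univ, mul_one]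
    rw [h1]
    refine (measure_mono ?_).trans ((measure_union_le _ _).trans (add_le_add hf4 hf5))
    rintro ⟨q, g⟩ ⟨⟨SW₁, SW₂, h₁, h₂, h₃⟩, -⟩
    by_cases h : agree q.2.2 SW₁ g
    · right
      exact ⟨SW₂, h₂, fun h' => h₃ ((hA.equivalence _).trans h ((hA.equivalence _).symm h'))⟩
    · left; exact ⟨SW₁, h₁, h⟩
  -- The failures cost `2κ`, inaccuracy on the first sample `δ`, and disagreement `2δ`.
  refine (measure_mono ?_).trans ((measure_union_le _ _).trans (add_le_add
    ((measure_union_le _ _).trans (add_le_add hf1 hf2))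
    ((measure_union_le _ _).trans (add_le_add hf3 hD)))) |>.trans ?_
  · intro q hq
    by_contra hc
    simp only [mem_union, mem_preimage, mem_ofPred_eq, not_or] at hc
    obtain ⟨⟨hc1, hc2⟩, hc3, hc4⟩ := hc
    obtain ⟨SW₁, h₁⟩ := Option.ne_none_iff_exists'.mp hc1
    obtain ⟨SW₂, h₂⟩ := Option.ne_none_iff_exists'.mp hc2
    refine hq ⟨SW₁, SW₂, h₁, h₂, ?_, ?_⟩
    · by_contra h; exact hc4 ⟨SW₁, SW₂, h₁, h₂, h⟩
    · by_contra h; exact hc3 ⟨SW₁, h₁, not_le.mp h⟩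
  · rw [← ENNReal.ofReal_add hκ hκ, ← ENNReal.ofReal_add hδ hδ, ← ENNReal.ofReal_add hδ (by positivity),
      ← ENNReal.ofReal_add (by positivity) (by positivity)]
    refine ENNReal.ofReal_le_ofReal (by linarith)

end CallSpec

/-! ### Loops as iterations. -/

section Iteration

/-- The state after `k` rounds of a loop of `N` rounds. -/
def iterRounds {τ : Type*} {N : ℕ} (step : τ → Fin N → τ) (s₀ : τ) : ℕ → τ
  | 0 => s₀
  | k + 1 => if h : k < N then step (iterRounds step s₀ k) ⟨k, h⟩ else iterRounds step s₀ k

theorem iterRounds_succ {τ : Type*} {N : ℕ} (step : τ → Fin N → τ) (s₀ : τ) (t : Fin N) :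
    iterRounds step s₀ (t + 1) = step (iterRounds step s₀ t) t := by
  simp [iterRounds]

/-- Two loop lengths are allowed for the sake of the induction in `foldl_eq_iterRounds`; with equal
lengths this expresses that a state depends on earlier rounds only. -/
theorem iterRounds_congr {τ : Type*} {N M : ℕ} {step : τ → Fin N → τ} {step' : τ → Fin M → τ}
    (s₀ : τ) {k : ℕ} (hk : k ≤ N) (hk' : k ≤ M)
    (h : ∀ t (ht : t < k) s, step s ⟨t, ht.trans_le hk⟩ = step' s ⟨t, ht.trans_le hk'⟩) :
    iterRounds step s₀ k = iterRounds step' s₀ k := by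
  induction k with
  | zero => rfl
  | succ k ih =>
    rw [iterRounds, iterRounds, dif_pos (Nat.lt_of_succ_le hk), dif_pos (Nat.lt_of_succ_le hk'),
      ih (Nat.le_of_succ_le hk) (Nat.le_of_succ_le hk') fun t ht s => h t (ht.trans k.lt_succ_self) s]
    exact h k k.lt_succ_self _

theorem foldl_eq_iterRounds {τ : Type*} {N : ℕ} (step : τ → Fin N → τ) (s₀ : τ) :
    Fin.foldl N step s₀ = iterRounds step s₀ N := by
  induction N with
  | zero => simp [iterRounds]
  | succ N ih =>
    rw [Fin.foldl_succ_last, ih]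
    have h := iterRounds_succ step s₀ (Fin.last N)
    rw [Fin.val_last] at h
    rw [h]
    congr 1
    exact iterRounds_congr s₀ le_rfl N.le_succ fun t ht s => rfl

end Iteration

/-! ### The weight function of `rBoost*` and its concave potential. -/

section Potential

variable {γ : ℝ}

theorem smoothWeight_pos (hγ : γ < 1) (s : ℝ) : 0 < smoothWeight γ s := by
  unfold smoothWeight; split_ifs
  · exact zero_lt_one
  · exact Real.rpow_pos_of_pos (by linarith) _

theorem smoothWeight_eq_max (γ s : ℝ) :
    smoothWeight γ s = (1 - γ) ^ (max s 0 / 2) := by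
  unfold smoothWeight; split_ifs with h
  · rw [max_eq_right h]; simp
  · rw [max_eq_left (not_le.mp h).le]

theorem smoothWeight_le_one (hγ0 : 0 ≤ γ) (hγ : γ < 1) (s : ℝ) : smoothWeight γ s ≤ 1 := by
  rw [smoothWeight_eq_max]
  exact Real.rpow_le_one (by linarith) (by linarith) (by positivity)

/-- The weight decays at most exponentially. -/
theorem smoothWeight_mul_rpow_le (hγ0 : 0 ≤ γ) (hγ : γ < 1) {s s' d : ℝ} (hd : 0 ≤ d)
    (h : s' ≤ s + d) : smoothWeight γ s * (1 - γ) ^ (d / 2) ≤ smoothWeight γ s' := by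
  rw [smoothWeight_eq_max, smoothWeight_eq_max, ← Real.rpow_add (by linarith)]
  refine Real.rpow_le_rpow_of_exponent_ge (by linarith) (by linarith) ?_
  have : max s' 0 ≤ max s 0 + d :=
    max_le (h.trans (by gcongr; exact le_max_left _ _)) (add_nonneg (le_max_right _ _) hd)
  linarith

theorem measurable_smoothWeight (γ : ℝ) : Measurable (smoothWeight γ) := by
  unfold smoothWeight
  exact Measurable.ite measurableSet_Iic measurable_const
    (measurable_const.pow (measurable_id.div_const 2))

/-- An antiderivative of the weight function. -/
def weightPotential (γ s : ℝ) : ℝ :=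
  if s ≤ 0 then s else 2 / (-Real.log (1 - γ)) * (1 - (1 - γ) ^ (s / 2))

theorem measurable_weightPotential (γ : ℝ) : Measurable (weightPotential γ) := by
  unfold weightPotential
  exact Measurable.ite measurableSet_Iic measurable_id (measurable_const.mul
    (measurable_const.sub (measurable_const.pow (measurable_id.div_const 2))))

theorem le_neg_log_one_sub (hγ : γ < 1) : γ ≤ -Real.log (1 - γ) := by
  have := Real.log_le_sub_one_of_pos (by linarith : 0 < 1 - γ)
  linarith

/-- The integral of the weight over the positive half-line is `2 / (-log (1 - γ))`, and `-log (1 -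
γ) ≥ γ`. -/
theorem weightPotential_le (hγ0 : 0 < γ) (hγ : γ < 1) (s : ℝ) : weightPotential γ s ≤ 2 / γ := by
  have h1 := le_neg_log_one_sub hγ
  unfold weightPotential; split_ifs with h
  · exact h.trans (by positivity)
  · have h2 : 2 / (-Real.log (1 - γ)) ≤ 2 / γ := by gcongr
    have h3 : 0 ≤ (1 - γ) ^ (s / 2) := Real.rpow_nonneg (by linarith) _
    have h4 : 0 ≤ 2 / (-Real.log (1 - γ)) := div_nonneg zero_le_two (hγ0.le.trans h1)
    nlinarith

/-- The potential is concave, as its derivative `smoothWeight γ` is nonincreasing. The cases given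
by the signs of `a` and `b` are trivial or follow from `1 + x ≤ exp x`. -/
theorem weightPotential_le_tangent (hγ0 : 0 < γ) (hγ : γ < 1) (a b : ℝ) :
    weightPotential γ a ≤ weightPotential γ b + smoothWeight γ b * (a - b) := by
  have hl := le_neg_log_one_sub hγ
  set l := -Real.log (1 - γ) with hldef
  have hl0 : 0 < l := hγ0.trans_le hl
  have hexp : ∀ x : ℝ, (1 - γ) ^ (x / 2) = Real.exp (-(l * x / 2)) := by
    intro x; rw [Real.rpow_def_of_pos (by linarith)]; congr 1; rw [hldef]; ring
  have hlin : ∀ x : ℝ, 2 / l * (1 - Real.exp (-(l * x / 2))) ≤ x := by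
    intro x
    have h := Real.add_one_le_exp (-(l * x / 2))
    have h2 : 2 / l * (1 - Real.exp (-(l * x / 2))) ≤ 2 / l * (l * x / 2) :=
      mul_le_mul_of_nonneg_left (by linarith) (by positivity)
    have h3 : 2 / l * (l * x / 2) = x := by field_simp
    linarith
  simp only [weightPotential, smoothWeight, hexp, ← hldef]
  by_cases hb : b ≤ 0
  · rw [if_pos hb, if_pos hb]
    split_ifs with ha
    · linarith
    · linarith [hlin a]
  · rw [if_neg hb, if_neg hb]
    push Not at hb
    have hpb := Real.exp_pos (-(l * b / 2))
    split_ifs with ha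
    · have h1 : Real.exp (-(l * b / 2)) * b ≤ 2 / l * (1 - Real.exp (-(l * b / 2))) := by
        have h := Real.add_one_le_exp (l * b / 2)
        have h4 : Real.exp (-(l * b / 2)) * (l * b / 2 + 1) ≤ 1 := by
          calc _ ≤ Real.exp (-(l * b / 2)) * Real.exp (l * b / 2) :=
                mul_le_mul_of_nonneg_left h hpb.le
            _ = 1 := by rw [← Real.exp_add]; simp
        have h5 : Real.exp (-(l * b / 2)) * b =
            2 / l * (Real.exp (-(l * b / 2)) * (l * b / 2)) := by field_simp
        rw [h5]
        exact mul_le_mul_of_nonneg_left (by linarith) (by positivity)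
      have h2 : Real.exp (-(l * b / 2)) ≤ 1 := Real.exp_le_one_iff.mpr (by nlinarith)
      nlinarith
    · have h1 := mul_le_mul_of_nonneg_left (hlin (a - b)) hpb.le
      have h2 : Real.exp (-(l * b / 2)) * Real.exp (-(l * (a - b) / 2)) =
          Real.exp (-(l * a / 2)) := by rw [← Real.exp_add]; congr 1; ring
      have h3 : Real.exp (-(l * b / 2)) * (2 / l * (1 - Real.exp (-(l * (a - b) / 2)))) =
          2 / l * (Real.exp (-(l * b / 2)) - Real.exp (-(l * a / 2))) := by rw [← h2]; ring
      rw [h3] at h1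
      have h4 : 2 / l * (Real.exp (-(l * b / 2)) - Real.exp (-(l * a / 2))) =
          2 / l * (1 - Real.exp (-(l * a / 2))) - 2 / l * (1 - Real.exp (-(l * b / 2))) := by ring
      linarith

theorem one_sub_le_sqrt_one_sub (hγ0 : 0 ≤ γ) (hγ : γ ≤ 1 / 2) :
    1 - 3 / 5 * γ ≤ (1 - γ) ^ ((1 : ℝ) / 2) := by
  rw [← Real.sqrt_eq_rpow]
  exact Real.le_sqrt_of_sq_le (by nlinarith)

/-- The increase of the potential in a round. -/
theorem weightPotential_add_le (hγ0 : 0 < γ) (hγ : γ ≤ 1 / 2) (s : ℝ) {τ : ℝ}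
    (hτ : τ = 1 ∨ τ = -1) :
    weightPotential γ s + smoothWeight γ s * (τ - 19 / 10 * γ) ≤
      weightPotential γ (s + τ - γ / (2 + γ)) := by
  have hγ1 : γ < 1 := by linarith
  set θ := γ / (2 + γ) with hθ
  have hθ0 : 0 ≤ θ := by positivity
  have hθ1 : θ ≤ γ / 2 := by rw [hθ]; gcongr; linarith
  -- The tangent at the new point bounds the increase from below; the weight there is then compared
  -- with the old one, from below after a correct vote and from above after a wrong one.
  have ht := weightPotential_le_tangent hγ0 hγ1 s (s + τ - θ)
  have hw := smoothWeight_pos hγ1 s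
  have hw' := smoothWeight_pos hγ1 (s + τ - θ)
  rcases hτ with rfl | rfl
  · have h1 : smoothWeight γ s * (1 - γ) ^ ((1 : ℝ) / 2) ≤ smoothWeight γ (s + 1 - θ) :=
      smoothWeight_mul_rpow_le hγ0.le hγ1 zero_le_one (by linarith)
    have h2 := mul_le_mul_of_nonneg_left (one_sub_le_sqrt_one_sub hγ0.le hγ) hw.le
    have h3 : smoothWeight γ s * (1 - 3 / 5 * γ) * (1 - θ) ≤
        smoothWeight γ (s + 1 - θ) * (1 - θ) :=
      mul_le_mul_of_nonneg_right (h2.trans h1) (by linarith)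
    have h4 : smoothWeight γ s * (1 - 19 / 10 * γ) ≤
        smoothWeight γ s * ((1 - 3 / 5 * γ) * (1 - θ)) :=
      mul_le_mul_of_nonneg_left (by nlinarith) hw.le
    nlinarith
  -- A wrong vote is the critical case. The weight may grow by the factor `(1 - γ) ^ (-(1 + θ) /
  -- 2)`, made linear by Bernoulli's inequality; for `γ = 1/2` the two sides of `h3` are `1.92` and
  -- `1.95`. It matters that `19/10` is below `2`.
  · have h1 : smoothWeight γ (s + -1 - θ) * (1 - γ) ^ ((1 + θ) / 2) ≤ smoothWeight γ s :=
      smoothWeight_mul_rpow_le hγ0.le hγ1 (by linarith) (by linarith)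
    have hα0 : 0 ≤ (1 + θ) / 2 := by linarith
    have hα1 : (1 + θ) / 2 ≤ 1 := by linarith
    have hB := rpow_one_add_le_one_add_mul_self (s := γ / (1 - γ))
      (by have : 0 ≤ γ / (1 - γ) := div_nonneg hγ0.le (by linarith)
          linarith) hα0 hα1
    have hinv : (1 + γ / (1 - γ)) = (1 - γ)⁻¹ := by
      have : 1 - γ ≠ 0 := by linarith
      field_simp; ring
    rw [hinv, Real.inv_rpow (by linarith)] at hB
    have hp : 0 < (1 - γ) ^ ((1 + θ) / 2) := Real.rpow_pos_of_pos (by linarith) _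
    have h2 : smoothWeight γ (s + -1 - θ) ≤ smoothWeight γ s * (1 + (1 + θ) / 2 * (γ / (1 - γ))) := by
      calc _ ≤ smoothWeight γ s * ((1 - γ) ^ ((1 + θ) / 2))⁻¹ := by
            rw [← div_eq_mul_inv, le_div_iff₀ hp]; exact h1
        _ ≤ _ := mul_le_mul_of_nonneg_left hB hw.le
    have h3 : (1 + θ) * (1 + (1 + θ) / 2 * (γ / (1 - γ))) ≤ 1 + 19 / 10 * γ := by
      have e1 : 1 + θ = 2 * (1 + γ) / (2 + γ) := by rw [hθ]; field_simp; ring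
      have hg : 0 < 1 - γ := by linarith
      rw [e1]
      have e2 : 2 * (1 + γ) / (2 + γ) * (1 + 2 * (1 + γ) / (2 + γ) / 2 * (γ / (1 - γ))) =
          (2 * (1 + γ) * ((2 + γ) * (1 - γ) + (1 + γ) * γ)) / ((2 + γ) ^ 2 * (1 - γ)) := by
        field_simp
      rw [e2, div_le_iff₀ (by positivity)]
      nlinarith [mul_pos hγ0 hγ0, mul_nonneg hγ0.le (by linarith : 0 ≤ 1 / 2 - γ),
        mul_nonneg (mul_pos hγ0 hγ0).le (by linarith : 0 ≤ 1 / 2 - γ),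
        mul_nonneg (mul_pos hγ0 (mul_pos hγ0 hγ0)).le (by linarith : 0 ≤ 1 / 2 - γ)]
    have h4 := mul_le_mul_of_nonneg_right h2 (by linarith : 0 ≤ 1 + θ)
    have h5 := mul_le_mul_of_nonneg_left h3 hw.le
    nlinarith

/-- Over `1 / γ` rounds the weight decreases at most by half. -/
theorem half_le_one_sub_rpow (hγ0 : 0 < γ) (hγ : γ ≤ 1 / 2) {j : ℝ} (hj0 : 0 ≤ j)
    (hj : j ≤ 1 / γ) : 1 / 2 ≤ (1 - γ) ^ (j / 2) := by
  -- Bernoulli's inequality gives `(1/2) ^ (2γ) ≤ 1 - γ`, which is then raised to the power `j / 2`.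
  have hB := rpow_one_add_le_one_add_mul_self (s := -(1 / 2)) (by norm_num)
    (p := 2 * γ) (by linarith) (by linarith)
  have hjγ : γ * j ≤ 1 := by rw [le_div_iff₀ hγ0] at hj; linarith
  calc (1 / 2 : ℝ) = (1 / 2) ^ (1 : ℝ) := by simp
    _ ≤ (1 / 2) ^ (γ * j) := Real.rpow_le_rpow_of_exponent_ge (by norm_num) (by norm_num) hjγ
    _ = ((1 + -(1 / 2)) ^ (2 * γ)) ^ (j / 2) := by
        rw [← Real.rpow_mul (by norm_num)]; congr 1 <;> ring
    _ ≤ (1 - γ) ^ (j / 2) := Real.rpow_le_rpow (Real.rpow_nonneg (by norm_num) _)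
        (by linarith) (by linarith)

end Potential

/-! ### A round of `rBoost*` and its measurability. -/

section BoostRound

variable {X R : Type*}

/-- The state after a round of `rBoost*`, given the outcome `o` of the rejection sampler, the
examples `w` for the threshold check, and the seeds of the weak learner and the threshold check. -/
def boostUpdate (γ ε : ℝ) {m b : ℕ} (W : (Fin m → X × Bool) → R → X → Bool) (chk : Bool)
    (s : BoostState X) (o : Option (Fin m → X × Bool)) (w : Fin b → X × Bool) (r : R) (u : I) :
    BoostState X :=
  match o with
  | none => { s with halted := true }
  | some SW =>
    let h := W SW r
    { g := fun z => s.g z + sgn (h z.1) * sgn z.2 - γ / (2 + γ)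
      vote := fun x => s.vote x + sgn (h x)
      halted := chk && !(rThreshold w (ε / 2) (fun z => smoothWeight γ (s.g z)) u)
      calls := s.calls + 1 }

/-- A round of `rBoost*` as a function of its fresh examples and its randomness. -/
def boostRound (γ ε : ℝ) {m a b : ℕ} (W : (Fin m → X × Bool) → R → X → Bool) (chk : Bool)
    (s : BoostState X) (v : Fin a → X × Bool) (w : Fin b → X × Bool)
    (q : (Fin a → I) × R × I) : BoostState X :=
  if s.halted then s else
    boostUpdate γ ε W chk s (rejectionSampler (fun z => smoothWeight γ (s.g z)) m v q.1) w q.2.1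
      q.2.2

theorem boostStep_eq (K : ℕ) (ρ ε γ : ℝ) {m : ℕ} (W : (Fin m → X × Bool) → R → X → Bool)
    (S : BoostIdx K ρ ε γ m → X × Bool) (r : BoostSeed K ρ ε γ m R)
    (s : BoostState X) (t : Fin (boostRounds ε γ)) :
    boostStep K ρ ε γ W S r s t = boostRound γ ε W (decide (IsCheckRound γ t)) s
      (fun i => S ⟨t, .inl i⟩) (fun i => S ⟨t, .inr i⟩) (r t) := by
  unfold boostStep boostRound boostUpdate
  rfl

variable [MeasurableSpace X] [MeasurableSpace R]

/-- Measurable dependence of a state on parameters. -/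
structure MeasurableBoost {Θ : Type*} [MeasurableSpace Θ] (s : Θ → BoostState X) : Prop where
  g : Measurable fun p : Θ × (X × Bool) => (s p.1).g p.2
  vote : Measurable fun p : Θ × X => (s p.1).vote p.2
  halted : Measurable fun θ => (s θ).halted

theorem measurable_sgn : Measurable sgn := measurable_from_top

theorem MeasurableBoost.weight {Θ : Type*} [MeasurableSpace Θ] {s : Θ → BoostState X}
    (hs : MeasurableBoost s) (γ : ℝ) :
    Measurable fun p : Θ × (X × Bool) => smoothWeight γ ((s p.1).g p.2) :=
  (measurable_smoothWeight γ).comp hs.g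

theorem measurable_rThreshold {Θ Z : Type*} [MeasurableSpace Θ] [MeasurableSpace Z] {n : ℕ}
    {w : Θ → Fin n → Z} (hw : Measurable w) (z : ℝ) {φ : Θ → Z → ℝ}
    (hφ : Measurable fun p : Θ × Z => φ p.1 p.2) {u : Θ → I} (hu : Measurable u) :
    Measurable fun θ => rThreshold (w θ) z (φ θ) (u θ) := by
  unfold rThreshold
  refine measurable_decide (measurableSet_lt (by fun_prop) (Measurable.div_const ?_ _))
  refine Finset.measurable_fun_sum _ fun i _ => ?_
  exact hφ.comp (f := fun θ => (θ, w θ i)) (by fun_prop)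

variable {Θ : Type*} [MeasurableSpace Θ] {m a b : ℕ} {W : (Fin m → X × Bool) → R → X → Bool}
  {s : Θ → BoostState X}

theorem MeasurableBoost.boostRound (γ ε : ℝ) (chk : Bool)
    (hW : Measurable fun q : ((Fin m → X × Bool) × R) × X => W q.1.1 q.1.2 q.2)
    (hs : MeasurableBoost s) {v : Θ → Fin a → X × Bool} (hv : Measurable v)
    {w : Θ → Fin b → X × Bool} (hw : Measurable w) {q : Θ → (Fin a → I) × R × I}
    (hq : Measurable q) :
    MeasurableBoost fun θ => boostRound γ ε W chk (s θ) (v θ) (w θ) (q θ) := by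
  have hthr := measurable_rThreshold hw (ε / 2)
    (φ := fun θ z => smoothWeight γ ((s θ).g z)) (hs.weight γ) (u := fun θ => (q θ).2.2)
    (by fun_prop)
  constructor
  · have h : Measurable fun p : Θ × (X × Bool) => (boostUpdate γ ε W chk (s p.1) (rejectionSampler
        (fun z => smoothWeight γ ((s p.1).g z)) m (v p.1) (q p.1).1) (w p.1) (q p.1).2.1
        (q p.1).2.2).g p.2 := by
      refine measurable_rejectionSampler (Θ := Θ × (X × Bool))
        (μ := fun p z => smoothWeight γ ((s p.1).g z)) ((hs.weight γ).comp
          (f := fun p : (Θ × (X × Bool)) × (X × Bool) => (p.1.1, p.2)) (by fun_prop))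
        (S := fun p => v p.1) (by fun_prop) (u := fun p => (q p.1).1) (by fun_prop)
        (F := fun p o => (boostUpdate γ ε W chk (s p.1) o (w p.1) (q p.1).2.1 (q p.1).2.2).g p.2)
        hs.g ?_
      refine Measurable.sub (Measurable.add (hs.g.comp measurable_fst) (Measurable.mul
        (measurable_sgn.comp ?_) (measurable_sgn.comp (by fun_prop)))) measurable_const
      exact hW.comp (f := fun p : (Θ × (X × Bool)) × (Fin m → X × Bool) =>
        ((p.2, (q p.1.1).2.1), p.1.2.1)) (by fun_prop)
    have e : (fun p : Θ × (X × Bool) => (ReplicableBoosting.boostRound γ ε W chk (s p.1) (v p.1)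
        (w p.1) (q p.1)).g p.2) = fun p => if (s p.1).halted = true then (s p.1).g p.2 else
        (boostUpdate γ ε W chk (s p.1) (rejectionSampler
        (fun z => smoothWeight γ ((s p.1).g z)) m (v p.1) (q p.1).1) (w p.1) (q p.1).2.1
        (q p.1).2.2).g p.2 := by
      funext p; unfold ReplicableBoosting.boostRound; split_ifs <;> rfl
    rw [e]
    exact Measurable.ite ((hs.halted.comp measurable_fst) (measurableSet_singleton true)) hs.g h
  · have h : Measurable fun p : Θ × X => (boostUpdate γ ε W chk (s p.1) (rejectionSampler
        (fun z => smoothWeight γ ((s p.1).g z)) m (v p.1) (q p.1).1) (w p.1) (q p.1).2.1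
        (q p.1).2.2).vote p.2 := by
      refine measurable_rejectionSampler (Θ := Θ × X)
        (μ := fun p z => smoothWeight γ ((s p.1).g z)) ((hs.weight γ).comp
          (f := fun p : (Θ × X) × (X × Bool) => (p.1.1, p.2)) (by fun_prop))
        (S := fun p => v p.1) (by fun_prop) (u := fun p => (q p.1).1) (by fun_prop)
        (F := fun p o => (boostUpdate γ ε W chk (s p.1) o (w p.1) (q p.1).2.1 (q p.1).2.2).vote p.2)
        hs.vote ?_
      refine Measurable.add (hs.vote.comp measurable_fst) (measurable_sgn.comp ?_)
      exact hW.comp (f := fun p : (Θ × X) × (Fin m → X × Bool) =>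
        ((p.2, (q p.1.1).2.1), p.1.2)) (by fun_prop)
    have e : (fun p : Θ × X => (ReplicableBoosting.boostRound γ ε W chk (s p.1) (v p.1)
        (w p.1) (q p.1)).vote p.2) = fun p => if (s p.1).halted = true then (s p.1).vote p.2 else
        (boostUpdate γ ε W chk (s p.1) (rejectionSampler
        (fun z => smoothWeight γ ((s p.1).g z)) m (v p.1) (q p.1).1) (w p.1) (q p.1).2.1
        (q p.1).2.2).vote p.2 := by
      funext p; unfold ReplicableBoosting.boostRound; split_ifs <;> rfl
    rw [e]
    exact Measurable.ite ((hs.halted.comp measurable_fst) (measurableSet_singleton true)) hs.vote h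
  · have h : Measurable fun p : Θ => (boostUpdate γ ε W chk (s p) (rejectionSampler
        (fun z => smoothWeight γ ((s p).g z)) m (v p) (q p).1) (w p) (q p).2.1
        (q p).2.2).halted := by
      refine measurable_rejectionSampler
        (μ := fun p z => smoothWeight γ ((s p).g z)) (hs.weight γ) hv (by fun_prop)
        (F := fun p o => (boostUpdate γ ε W chk (s p) o (w p) (q p).2.1 (q p).2.2).halted)
        measurable_const ?_
      exact (measurable_from_top (f := fun c : Bool => chk && !c)).comp (hthr.comp measurable_fst)
    have e : (fun p : Θ => (ReplicableBoosting.boostRound γ ε W chk (s p) (v p)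
        (w p) (q p)).halted) = fun p => if (s p).halted = true then (s p).halted else
        (boostUpdate γ ε W chk (s p) (rejectionSampler
        (fun z => smoothWeight γ ((s p).g z)) m (v p) (q p).1) (w p) (q p).2.1
        (q p).2.2).halted := by
      funext p; unfold ReplicableBoosting.boostRound; split_ifs <;> rfl
    rw [e]
    exact Measurable.ite (hs.halted (measurableSet_singleton true)) hs.halted h

omit [MeasurableSpace X] [MeasurableSpace R] in
theorem sgn_injective : Function.Injective sgn := by
  intro a b h
  cases a <;> cases b <;> simp [sgn] at h ⊢ <;> norm_num at h

omit [MeasurableSpace X] [MeasurableSpace R] in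
-- The votes determine the hypotheses since `sgn` is injective. Equality of states, which involves
-- functions on `X`, is thus reduced to agreement of the weak learner, an event assumed to be
-- measurable, and to an equality of Booleans.
theorem boostUpdate_some_eq_iff {γ ε : ℝ} {chk : Bool} {s : BoostState X}
    {SW₁ SW₂ : Fin m → X × Bool} {w₁ w₂ : Fin b → X × Bool} {r : R} {u : I} :
    boostUpdate γ ε W chk s (some SW₁) w₁ r u = boostUpdate γ ε W chk s (some SW₂) w₂ r u ↔
      W SW₁ r = W SW₂ r ∧
      (chk && !(rThreshold w₁ (ε / 2) (fun z => smoothWeight γ (s.g z)) u)) =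
      (chk && !(rThreshold w₂ (ε / 2) (fun z => smoothWeight γ (s.g z)) u)) := by
  simp only [boostUpdate, BoostState.mk.injEq, and_true]
  constructor
  · rintro ⟨-, h, h'⟩
    refine ⟨funext fun x => sgn_injective ?_, h'⟩
    have := congrFun h x
    simpa using this
  · rintro ⟨h, h'⟩
    rw [h]; exact ⟨rfl, rfl, h'⟩

theorem measurableSet_boostRound_eq (γ ε : ℝ) (chk : Bool)
    (hW : MeasurableSet {q : ((Fin m → X × Bool) × (Fin m → X × Bool)) × R |
      W q.1.1 q.2 = W q.1.2 q.2})
    (hs : MeasurableBoost s) {v₁ v₂ : Θ → Fin a → X × Bool} (hv₁ : Measurable v₁)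
    (hv₂ : Measurable v₂) {w₁ w₂ : Θ → Fin b → X × Bool} (hw₁ : Measurable w₁)
    (hw₂ : Measurable w₂) {q : Θ → (Fin a → I) × R × I} (hq : Measurable q) :
    MeasurableSet {θ | boostRound γ ε W chk (s θ) (v₁ θ) (w₁ θ) (q θ) =
      boostRound γ ε W chk (s θ) (v₂ θ) (w₂ θ) (q θ)} := by
  have hthr₁ := measurable_rThreshold hw₁ (ε / 2)
    (φ := fun θ z => smoothWeight γ ((s θ).g z)) (hs.weight γ) (u := fun θ => (q θ).2.2)
    (by fun_prop)
  have hthr₂ := measurable_rThreshold hw₂ (ε / 2)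
    (φ := fun θ z => smoothWeight γ ((s θ).g z)) (hs.weight γ) (u := fun θ => (q θ).2.2)
    (by fun_prop)
  have hhalt : MeasurableSet {θ | (s θ).halted = true} :=
    hs.halted (measurableSet_singleton true)
  have key : Measurable fun θ => boostUpdate γ ε W chk (s θ) (rejectionSampler
        (fun z => smoothWeight γ ((s θ).g z)) m (v₁ θ) (q θ).1) (w₁ θ) (q θ).2.1 (q θ).2.2 =
      boostUpdate γ ε W chk (s θ) (rejectionSampler
        (fun z => smoothWeight γ ((s θ).g z)) m (v₂ θ) (q θ).1) (w₂ θ) (q θ).2.1 (q θ).2.2 := by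
    refine measurable_rejectionSampler
      (μ := fun p z => smoothWeight γ ((s p).g z)) (hs.weight γ) hv₁ (by fun_prop)
      (F := fun θ o => boostUpdate γ ε W chk (s θ) o (w₁ θ) (q θ).2.1 (q θ).2.2 =
        boostUpdate γ ε W chk (s θ) (rejectionSampler
        (fun z => smoothWeight γ ((s θ).g z)) m (v₂ θ) (q θ).1) (w₂ θ) (q θ).2.1 (q θ).2.2) ?_ ?_
    · refine measurable_rejectionSampler
        (μ := fun p z => smoothWeight γ ((s p).g z)) (hs.weight γ) hv₂ (by fun_prop)
        (F := fun θ o => boostUpdate γ ε W chk (s θ) none (w₁ θ) (q θ).2.1 (q θ).2.2 =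
        boostUpdate γ ε W chk (s θ) o (w₂ θ) (q θ).2.1 (q θ).2.2) ?_ ?_
      · simp [boostUpdate]
      · simp [boostUpdate]
    · refine measurable_rejectionSampler (Θ := Θ × (Fin m → X × Bool))
        (μ := fun p z => smoothWeight γ ((s p.1).g z)) ((hs.weight γ).comp
          (f := fun p : (Θ × (Fin m → X × Bool)) × (X × Bool) => (p.1.1, p.2)) (by fun_prop))
        (S := fun p => v₂ p.1) (by fun_prop) (u := fun p => (q p.1).1) (by fun_prop)
        (F := fun p o => boostUpdate γ ε W chk (s p.1) (some p.2) (w₁ p.1) (q p.1).2.1 (q p.1).2.2 =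
        boostUpdate γ ε W chk (s p.1) o (w₂ p.1) (q p.1).2.1 (q p.1).2.2) ?_ ?_
      · simp [boostUpdate]
      · simp only [boostUpdate_some_eq_iff]
        refine Measurable.and (measurableSet_setOfPred.mp ?_) (measurableSet_setOfPred.mp ?_)
        · exact measurableSet_preimage (f := fun p : (Θ × (Fin m → X × Bool)) ×
            (Fin m → X × Bool) => ((p.1.2, p.2), (q p.1.1).2.1)) (by fun_prop) hW
        · refine measurableSet_eq_fun ?_ ?_
          · exact (measurable_from_top (f := fun c : Bool => chk && !c)).comp
              (hthr₁.comp (measurable_fst.comp measurable_fst))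
          · exact (measurable_from_top (f := fun c : Bool => chk && !c)).comp
              (hthr₂.comp (measurable_fst.comp measurable_fst))
  have e : {θ | boostRound γ ε W chk (s θ) (v₁ θ) (w₁ θ) (q θ) =
      boostRound γ ε W chk (s θ) (v₂ θ) (w₂ θ) (q θ)} = {θ | (s θ).halted = true} ∪
      {θ | boostUpdate γ ε W chk (s θ) (rejectionSampler
        (fun z => smoothWeight γ ((s θ).g z)) m (v₁ θ) (q θ).1) (w₁ θ) (q θ).2.1 (q θ).2.2 =
      boostUpdate γ ε W chk (s θ) (rejectionSampler
        (fun z => smoothWeight γ ((s θ).g z)) m (v₂ θ) (q θ).1) (w₂ θ) (q θ).2.1 (q θ).2.2} := by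
    ext θ
    simp only [boostRound, mem_ofPred_eq, mem_union]
    by_cases h : (s θ).halted = true <;> simp [h]
  rw [e]
  exact hhalt.union (measurableSet_setOfPred.mpr key)

end BoostRound

/-! ### The invariant of `rBoost*`. -/

section BoostInvariant

variable {X R : Type*} [MeasurableSpace X] [MeasurableSpace R]

/-- The specification of a round of `rBoost*`, for two samples. -/
def BoostSpec (P : Measure (X × Bool)) (γ ε : ℝ) {m a b : ℕ}
    (W : (Fin m → X × Bool) → R → X → Bool) (chk : Bool) (s : BoostState X)
    (v₁ v₂ : Fin a → X × Bool) (w₁ w₂ : Fin b → X × Bool) (q : (Fin a → I) × R × I) : Prop :=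
  CallSpec P W (fun r S₁ S₂ => W S₁ r = W S₂ r) (1 / 2 - γ) (fun z => smoothWeight γ (s.g z))
    v₁ v₂ q.1 q.2.1 ∧
  (chk = true → ThresholdSpec (ε / 2) (∫ z, smoothWeight γ (s.g z) ∂P)
    (rThreshold w₁ (ε / 2) (fun z => smoothWeight γ (s.g z)) q.2.2)
    (rThreshold w₂ (ε / 2) (fun z => smoothWeight γ (s.g z)) q.2.2))

/-- The hypothesis given by a vote. -/
def voteHyp (vote : X → ℝ) (x : X) : Bool := decide (0 ≤ vote x)

/-- The invariant of the loop of `rBoost*` after `t` rounds. -/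
structure BoostInv (P : Measure (X × Bool)) (γ ε : ℝ) (t : ℕ) (s : BoostState X) : Prop where
  measurable_g : Measurable s.g
  g_eq : ∀ z, s.g z = s.vote z.1 * sgn z.2 - t * (γ / (2 + γ))
  abs_vote_le : ∀ x, |s.vote x| ≤ t
  density : (1 - γ) ^ (((t % ⌊1 / γ⌋₊ : ℕ) + 1 : ℝ) / 2) * (ε / 4) ≤
    ∫ z, smoothWeight γ (s.g z) ∂P
  potential : γ / 10 * (t * (ε / 8)) ≤ ∫ z, weightPotential γ (s.g z) ∂P

theorem isWeight_smoothWeight {γ : ℝ} (hγ0 : 0 < γ) (hγ : γ < 1) {g : X × Bool → ℝ}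
    (hg : Measurable g) : IsWeight fun z => smoothWeight γ (g z) :=
  ⟨(measurable_smoothWeight γ).comp hg, fun _ => (smoothWeight_pos hγ _).le,
    fun _ => smoothWeight_le_one hγ0.le hγ _⟩

omit [MeasurableSpace X] in
theorem sgn_mul_sgn (a b : Bool) : sgn a * sgn b = if a ≠ b then -1 else 1 := by
  cases a <;> cases b <;> simp [sgn]

omit [MeasurableSpace X] in
theorem abs_sgn (b : Bool) : |sgn b| = 1 := by cases b <;> simp [sgn]

variable {P : Measure (X × Bool)} [IsProbabilityMeasure P] {γ ε : ℝ} {t : ℕ} {s : BoostState X}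

omit [IsProbabilityMeasure P] in
-- The residue of `t` plus one is at most `1/γ`, so the decay since the last check costs at most a
-- factor 2.
theorem BoostInv.density_ge (hγ0 : 0 < γ) (hγ : γ < 1 / 2) (hε : 0 < ε)
    (hs : BoostInv P γ ε t s) : ε / 8 ≤ ∫ z, smoothWeight γ (s.g z) ∂P := by
  have hk : 0 < ⌊1 / γ⌋₊ := Nat.floor_pos.mpr (by rw [le_div_iff₀ hγ0]; linarith)
  have h1 : ((t % ⌊1 / γ⌋₊ : ℕ) + 1 : ℝ) ≤ 1 / γ := by
    have h2 : t % ⌊1 / γ⌋₊ + 1 ≤ ⌊1 / γ⌋₊ := Nat.mod_lt _ hk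
    calc ((t % ⌊1 / γ⌋₊ : ℕ) + 1 : ℝ) ≤ (⌊1 / γ⌋₊ : ℝ) := by exact_mod_cast h2
      _ ≤ 1 / γ := Nat.floor_le (by positivity)
  have h3 := half_le_one_sub_rpow hγ0 hγ.le (by positivity) h1
  have := hs.density
  nlinarith

theorem integrable_weightPotential {g : X × Bool → ℝ} (hγ0 : 0 < γ) (hγ : γ < 1)
    (hg : Measurable g) {B : ℝ} (hB : ∀ z, |g z| ≤ B) :
    Integrable (fun z => weightPotential γ (g z)) P := by
  refine Integrable.of_bound ((measurable_weightPotential γ).comp hg).aestronglyMeasurable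
    (B + 2 / γ) (ae_of_all _ fun z => ?_)
  have h1 := weightPotential_le hγ0 hγ (g z)
  have h2 := weightPotential_le_tangent hγ0 hγ 0 (g z)
  have h3 := smoothWeight_pos hγ (g z)
  have h4 := smoothWeight_le_one hγ0.le hγ (g z)
  have h5 : weightPotential γ 0 = 0 := by simp [weightPotential]
  have h6 := abs_le.mp (hB z)
  have h7 : 0 ≤ B := (abs_nonneg _).trans (hB z)
  have h8 : smoothWeight γ (g z) * (0 - g z) ≤ B := by
    rcases le_total 0 (g z) with h | h <;> nlinarith
  have h9 : (0 : ℝ) < 2 / γ := by positivity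
  rw [Real.norm_eq_abs, abs_le]
  constructor <;> linarith

omit [IsProbabilityMeasure P] in
theorem BoostInv.abs_g_le (hγ0 : 0 < γ) (hs : BoostInv P γ ε t s) (z : X × Bool) :
    |s.g z| ≤ 2 * t := by
  rw [hs.g_eq]
  have h1 := hs.abs_vote_le z.1
  have h2 : γ / (2 + γ) ≤ 1 := by rw [div_le_one (by linarith)]; linarith
  have h3 : 0 ≤ γ / (2 + γ) := by positivity
  have h4 : |s.vote z.1 * sgn z.2| ≤ t := by rwa [abs_mul, abs_sgn, mul_one]
  have h5 : |(t : ℝ) * (γ / (2 + γ))| ≤ t := by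
    rw [abs_of_nonneg (by positivity)]
    exact mul_le_of_le_one_right (by positivity) h2
  calc _ ≤ |s.vote z.1 * sgn z.2| + |(t : ℝ) * (γ / (2 + γ))| := abs_sub _ _
    _ ≤ 2 * t := by linarith

/-- A weighted error of at most `(1/2 - γ) ∫ μ` becomes a correlation of at least `2γ ∫ μ`, to be
compared with the loss `19γ/10` in `weightPotential_add_le`. -/
theorem integral_weight_mul_sgn {μ : X × Bool → ℝ} (hμ : IsWeight μ) {h : X → Bool}
    (hh : Measurable h) :
    ∫ z, μ z * (sgn (h z.1) * sgn z.2) ∂P = ∫ z, μ z ∂P - 2 * weightedErr P μ h := by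
  have hi := hμ.integrable P
  have hi2 : Integrable (fun z => if h z.1 ≠ z.2 then μ z else 0) P := by
    have := hi.indicator (measurableSet_ne_label hh)
    refine this.congr (ae_of_all _ fun z => ?_)
    simp [indicator_apply]
  rw [weightedErr, ← integral_const_mul, ← integral_sub hi (hi2.const_mul 2)]
  congr 1; ext z
  rw [sgn_mul_sgn]
  split_ifs <;> ring

/-- An error of the vote means that the margin was small before the last vote. -/
theorem lawErr_voteHyp_le (hγ0 : 0 < γ) (hγ : γ < 1 / 2) (hs : BoostInv P γ ε t s)
    {h : X → Bool} (hh : Measurable h) (hv : Measurable s.vote) :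
    lawErr P (voteHyp fun x => s.vote x + sgn (h x)) ≤
      3 / 2 * ∫ z, smoothWeight γ (s.g z) ∂P := by
  have hwt := isWeight_smoothWeight hγ0 (by linarith) hs.measurable_g
  have hm : Measurable (voteHyp fun x => s.vote x + sgn (h x)) :=
    measurable_decide (measurableSet_le measurable_const (hv.add (measurable_sgn.comp hh)))
  have hS := measurableSet_ne_label hm
  -- If the new vote errs, then the old margin was at most 1, so `g ≤ 1` and the weight is at least
  -- `√(1 - γ) ≥ 7/10`.
  have hpt : ∀ z : X × Bool, voteHyp (fun x => s.vote x + sgn (h x)) z.1 ≠ z.2 →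
      2 / 3 ≤ smoothWeight γ (s.g z) := by
    intro z hz
    have h1 : (s.vote z.1 + sgn (h z.1)) * sgn z.2 ≤ 0 := by
      rcases hb : z.2 with _ | _
      · rw [hb] at hz
        simp only [voteHyp, ne_eq, Bool.not_eq_false, decide_eq_true_eq] at hz
        have : sgn false = -1 := by simp [sgn]
        rw [this]; linarith
      · rw [hb] at hz
        simp only [voteHyp, ne_eq, Bool.not_eq_true, decide_eq_false_iff_not, not_le] at hz
        simpa [sgn] using hz.le
    have h2 : -1 ≤ sgn (h z.1) * sgn z.2 := by rw [sgn_mul_sgn]; split_ifs <;> norm_num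
    have h3 : s.g z ≤ 0 + 1 := by
      rw [hs.g_eq]
      have : 0 ≤ (t : ℝ) * (γ / (2 + γ)) := by positivity
      linarith
    have h4 := smoothWeight_mul_rpow_le hγ0.le (by linarith) zero_le_one h3
    have h5 := one_sub_le_sqrt_one_sub hγ0.le hγ.le
    have h6 : smoothWeight γ 0 = 1 := by simp [smoothWeight]
    rw [h6, one_mul] at h4
    linarith
  have hI : ∫ z in {z : X × Bool | voteHyp (fun x => s.vote x + sgn (h x)) z.1 ≠ z.2},
      (2 / 3 : ℝ) ∂P ≤ ∫ z, smoothWeight γ (s.g z) ∂P := by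
    calc _ ≤ ∫ z in {z : X × Bool | voteHyp (fun x => s.vote x + sgn (h x)) z.1 ≠ z.2},
          smoothWeight γ (s.g z) ∂P :=
          setIntegral_mono_on (integrable_const _) (hwt.integrable P).integrableOn hS hpt
      _ ≤ _ := setIntegral_le_integral (hwt.integrable P) (ae_of_all _ hwt.nonneg)
  rw [setIntegral_const, smul_eq_mul] at hI
  rw [lawErr]
  linarith

omit [MeasurableSpace R] in
/-- A round that meets its specification leads to the same state for both samples, and preserves
the invariant, or leaves the loop with an accurate hypothesis. -/
theorem BoostInv.boostRound (hγ0 : 0 < γ) (hγ : γ < 1 / 2) (hε : 0 < ε)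
    {m a b : ℕ} {W : (Fin m → X × Bool) → R → X → Bool}
    (hW : ∀ S r, Measurable (W S r)) (hs : BoostInv P γ ε t s) (hv : Measurable s.vote)
    {chk : Bool} (hchk : chk = decide (IsCheckRound γ t))
    (hhalt : s.halted = false) {v₁ v₂ : Fin a → X × Bool} {w₁ w₂ : Fin b → X × Bool}
    {q : (Fin a → I) × R × I} (hspec : BoostSpec P γ ε W chk s v₁ v₂ w₁ w₂ q) :
    boostRound γ ε W chk s v₁ w₁ q = boostRound γ ε W chk s v₂ w₂ q ∧
    ((boostRound γ ε W chk s v₁ w₁ q).halted = false →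
      BoostInv P γ ε (t + 1) (boostRound γ ε W chk s v₁ w₁ q)) ∧
    ((boostRound γ ε W chk s v₁ w₁ q).halted = true →
      lawErr P (voteHyp (boostRound γ ε W chk s v₁ w₁ q).vote) ≤ 3 / 2 * ε) := by
  have hγ1 : γ < 1 := by linarith
  obtain ⟨⟨SW₁, SW₂, h₁, h₂, hagree, herr⟩, hthr⟩ := hspec
  have e₁ : ReplicableBoosting.boostRound γ ε W chk s v₁ w₁ q =
      boostUpdate γ ε W chk s (some SW₁) w₁ q.2.1 q.2.2 := by
    simp [ReplicableBoosting.boostRound, hhalt, h₁]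
  have e₂ : ReplicableBoosting.boostRound γ ε W chk s v₂ w₂ q =
      boostUpdate γ ε W chk s (some SW₂) w₂ q.2.1 q.2.2 := by
    simp [ReplicableBoosting.boostRound, hhalt, h₂]
  have hden := hs.density_ge hγ0 hγ hε
  have hwt := isWeight_smoothWeight hγ0 hγ1 hs.measurable_g
  set h := W SW₁ q.2.1 with hh
  have hhm : Measurable h := hW _ _
  refine ⟨?_, ?_, ?_⟩
  · rw [e₁, e₂, boostUpdate_some_eq_iff]
    refine ⟨hagree, ?_⟩
    cases chk with
    | false => rfl
    | true => rw [(hthr rfl).1]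
  · rw [e₁]
    intro hh'
    set a := ∫ z, smoothWeight γ (s.g z) ∂P with ha
    have hgm : Measurable fun z : X × Bool => s.g z + sgn (h z.1) * sgn z.2 - γ / (2 + γ) := by
      refine (hs.measurable_g.add ((measurable_sgn.comp (hhm.comp measurable_fst)).mul
        (measurable_sgn.comp measurable_snd))).sub measurable_const
    have hwt' := isWeight_smoothWeight hγ0 hγ1 hgm
    have hθ0 : 0 ≤ γ / (2 + γ) := by positivity
    have hθ1 : γ / (2 + γ) ≤ 1 := by rw [div_le_one (by linarith)]; linarith
    -- A vote raises `g` by at most 1, so a round diminishes the density at most by the factor `√(1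
    -- - γ)`.
    have hdec : (1 - γ) ^ ((1 : ℝ) / 2) * a ≤
        ∫ z, smoothWeight γ (s.g z + sgn (h z.1) * sgn z.2 - γ / (2 + γ)) ∂P := by
      rw [← integral_const_mul]
      refine integral_mono ((hwt.integrable P).const_mul _) (hwt'.integrable P) fun z => ?_
      rw [mul_comm]
      refine smoothWeight_mul_rpow_le hγ0.le hγ1 zero_le_one ?_
      have h2 : sgn (h z.1) * sgn z.2 ≤ 1 := by rw [sgn_mul_sgn]; split_ifs <;> norm_num
      linarith
    refine ⟨hgm, fun z => ?_, fun x => ?_, ?_, ?_⟩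
    · simp only [boostUpdate, hs.g_eq]; push_cast; ring
    · simp only [boostUpdate]; push_cast
      calc _ ≤ |s.vote x| + |sgn (h x)| := abs_add_le _ _
        _ ≤ t + 1 := by rw [abs_sgn]; linarith [hs.abs_vote_le x]
    · refine le_trans ?_ hdec
      -- A passed check at level `ε/2` certifies density `ε/4` for the weight before the update. The
      -- update itself explains the exponent `1/2` at residue zero, hence the summand 1 in the
      -- invariant.
      by_cases hc : IsCheckRound γ t
      · have hmod : (t + 1) % ⌊1 / γ⌋₊ = 0 := Nat.mod_eq_zero_of_dvd hc
        rw [hmod]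
        have hct : chk = true := by rw [hchk]; simpa using hc
        have hthr' := hthr hct
        have : rThreshold w₁ (ε / 2) (fun z => smoothWeight γ (s.g z)) q.2.2 = true := by
          simpa [boostUpdate, hct] using hh'
        have h3 := hthr'.2.1 this
        have h4 : (0 : ℝ) ≤ (1 - γ) ^ ((1 : ℝ) / 2) := Real.rpow_nonneg (by linarith) _
        norm_num
        norm_num at h4
        exact mul_le_mul_of_nonneg_left (by linarith) h4
      · have hmod : (t + 1) % ⌊1 / γ⌋₊ = t % ⌊1 / γ⌋₊ + 1 := by
          have hk : 0 < ⌊1 / γ⌋₊ := Nat.floor_pos.mpr (by rw [le_div_iff₀ hγ0]; linarith)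
          rw [← Nat.mod_add_mod]
          refine Nat.mod_eq_of_lt (lt_of_le_of_ne (Nat.mod_lt _ hk) fun h => hc ?_)
          rw [IsCheckRound, Nat.dvd_iff_mod_eq_zero, ← Nat.mod_add_mod, h, Nat.mod_self]
        rw [hmod]
        have h5 : (((t % ⌊1 / γ⌋₊ + 1 : ℕ) : ℝ) + 1) / 2 =
            1 / 2 + (((t % ⌊1 / γ⌋₊ : ℕ) : ℝ) + 1) / 2 := by push_cast; ring
        rw [h5, Real.rpow_add (by linarith), mul_assoc]
        exact mul_le_mul_of_nonneg_left hs.density (Real.rpow_nonneg (by linarith) _)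
    · have hip := integrable_weightPotential (P := P) hγ0 hγ1 hs.measurable_g (hs.abs_g_le hγ0)
      have hB : ∀ z : X × Bool, |s.g z + sgn (h z.1) * sgn z.2 - γ / (2 + γ)| ≤ 2 * t + 2 := by
        intro z
        have h2 : |sgn (h z.1) * sgn z.2| = 1 := by rw [abs_mul, abs_sgn, abs_sgn, one_mul]
        have h3 := abs_le.mp (hs.abs_g_le hγ0 z)
        have h4 := abs_le.mp h2.le
        rw [abs_le]; constructor <;> linarith
      have hip' := integrable_weightPotential (P := P) hγ0 hγ1 hgm hB
      have hms := integral_weight_mul_sgn (P := P) hwt hhm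
      have his : Integrable (fun z => smoothWeight γ (s.g z) * (sgn (h z.1) * sgn z.2)) P := by
        refine (hwt.integrable P).mul_bdd (c := 1) ?_ (ae_of_all _ fun z => ?_)
        · exact (((measurable_sgn.comp (hhm.comp measurable_fst)).mul
            (measurable_sgn.comp measurable_snd))).aestronglyMeasurable
        · rw [Real.norm_eq_abs, abs_mul, abs_sgn, abs_sgn, one_mul]
      -- Integrated, the increase is at least `(2γ - 19γ/10) a = γ a / 10`, where `a ≥ ε / 8`.
      have hle : ∫ z, (weightPotential γ (s.g z) + (smoothWeight γ (s.g z) *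
          (sgn (h z.1) * sgn z.2) - 19 / 10 * γ * smoothWeight γ (s.g z))) ∂P ≤
          ∫ z, weightPotential γ (s.g z + sgn (h z.1) * sgn z.2 - γ / (2 + γ)) ∂P := by
        refine integral_mono (hip.add (his.sub ((hwt.integrable P).const_mul _))) hip' fun z => ?_
        have hτ : sgn (h z.1) * sgn z.2 = 1 ∨ sgn (h z.1) * sgn z.2 = -1 := by
          rw [sgn_mul_sgn]; split_ifs <;> simp
        have := weightPotential_add_le hγ0 hγ.le (s.g z) hτ
        simp only
        linarith
      have hi1 : Integrable (fun z => smoothWeight γ (s.g z) * (sgn (h z.1) * sgn z.2) -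
          19 / 10 * γ * smoothWeight γ (s.g z)) P := his.sub ((hwt.integrable P).const_mul _)
      rw [integral_add hip hi1, integral_sub his ((hwt.integrable P).const_mul _),
        integral_const_mul, hms, ← ha] at hle
      refine le_trans ?_ hle
      have := hs.potential
      push_cast
      nlinarith
  · rw [e₁]
    intro hh'
    simp only [boostUpdate, Bool.and_eq_true, Bool.not_eq_true'] at hh' ⊢
    -- A negative check at level `ε/2` bounds the density by `ε`.
    have h3 := (hthr hh'.1).2.2 hh'.2
    have h4 := lawErr_voteHyp_le hγ0 hγ hs hhm hv
    linarith

theorem BoostInv.init (hγ0 : 0 < γ) (hγ : γ < 1) (hε : 0 < ε) (hε1 : ε ≤ 1) :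
    BoostInv P γ ε 0 ⟨fun _ => 0, fun _ => 0, false, 0⟩ where
  measurable_g := measurable_const
  g_eq z := by simp
  abs_vote_le x := by simp
  density := by
    have h1 : (1 - γ) ^ ((1 : ℝ) / 2) ≤ 1 :=
      Real.rpow_le_one (by linarith) (by linarith) (by norm_num)
    have h2 : 0 ≤ (1 - γ) ^ ((1 : ℝ) / 2) := Real.rpow_nonneg (by linarith) _
    norm_num [smoothWeight] at h1 h2 ⊢
    nlinarith
  potential := by simp [weightPotential]

/-- The loop cannot go on for too long. -/
theorem BoostInv.rounds_le (hγ0 : 0 < γ) (hγ : γ < 1) (hε : 0 < ε) (hs : BoostInv P γ ε t s) :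
    (t : ℝ) ≤ 160 / (ε * γ ^ 2) := by
  -- Each round has contributed at least `γ ε / 80` to a potential that never exceeds `2 / γ`.
  have h1 : ∫ z, weightPotential γ (s.g z) ∂P ≤ 2 / γ := by
    calc _ ≤ ∫ _, 2 / γ ∂P := integral_mono
          (integrable_weightPotential hγ0 hγ hs.measurable_g (hs.abs_g_le hγ0))
          (integrable_const _) fun z => weightPotential_le hγ0 hγ _
      _ = 2 / γ := by simp
  have h2 := hs.potential.trans h1
  rw [le_div_iff₀ hγ0] at h2
  rw [le_div_iff₀ (by positivity)]
  nlinarith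

end BoostInvariant

theorem measurePreserving_prod_prod_prod_comm {Ω₁ Ω₂ Ω₃ Ω₄ : Type*} [MeasurableSpace Ω₁]
    [MeasurableSpace Ω₂] [MeasurableSpace Ω₃] [MeasurableSpace Ω₄] (μ₁ : Measure Ω₁)
    (μ₂ : Measure Ω₂) (μ₃ : Measure Ω₃) (μ₄ : Measure Ω₄) [SFinite μ₁] [SFinite μ₂] [SFinite μ₃]
    [SFinite μ₄] :
    MeasurePreserving (fun p : (Ω₁ × Ω₂) × (Ω₃ × Ω₄) => ((p.1.1, p.2.1), (p.1.2, p.2.2)))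
      ((μ₁.prod μ₂).prod (μ₃.prod μ₄)) ((μ₁.prod μ₃).prod (μ₂.prod μ₄)) := by
  have h1 : MeasurePreserving (fun p : Ω₂ × (Ω₃ × Ω₄) => (p.2.1, (p.1, p.2.2)))
      (μ₂.prod (μ₃.prod μ₄)) (μ₃.prod (μ₂.prod μ₄)) :=
    (measurePreserving_prodAssoc μ₃ μ₂ μ₄).comp
      ((Measure.measurePreserving_swap.prod (MeasurePreserving.id μ₄)).comp
        (measurePreserving_prodAssoc μ₂ μ₃ μ₄).symm)
  exact (measurePreserving_prodAssoc μ₁ μ₃ (μ₂.prod μ₄)).symm.comp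
    (((MeasurePreserving.id μ₁).prod h1).comp (measurePreserving_prodAssoc μ₁ μ₂ (μ₃.prod μ₄)))

/-- Applied twice, this resamples both samples and the seed simultaneously. -/
theorem measurePreserving_prod_resample {Ω Ω' : Type*} [MeasurableSpace Ω] [MeasurableSpace Ω']
    {μ : Measure Ω} {ν : Measure Ω'} [SFinite μ] [SFinite ν] {res : Ω × Ω → Ω}
    {res' : Ω' × Ω' → Ω'} (h : MeasurePreserving res (μ.prod μ) μ)
    (h' : MeasurePreserving res' (ν.prod ν) ν) :
    MeasurePreserving (fun p : (Ω × Ω') × (Ω × Ω') => (res (p.1.1, p.2.1), res' (p.1.2, p.2.2)))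
      ((μ.prod ν).prod (μ.prod ν)) (μ.prod ν) :=
  (h.prod h').comp (measurePreserving_prod_prod_prod_comm μ ν μ ν)

/-! ### The run of `rBoost*` on two samples. -/

section BoostProcess

variable {X R : Type*} {K : ℕ} {ρ ε γ : ℝ} {m : ℕ}

/-- The state of `rBoost*` after `k` rounds. -/
def boostRun (W : (Fin m → X × Bool) → R → X → Bool) (S : BoostIdx K ρ ε γ m → X × Bool)
    (r : BoostSeed K ρ ε γ m R) (k : ℕ) : BoostState X :=
  iterRounds (boostStep K ρ ε γ W S r) ⟨fun _ => 0, fun _ => 0, false, 0⟩ k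

theorem rBoostStar_eq (W : (Fin m → X × Bool) → R → X → Bool)
    (S : BoostIdx K ρ ε γ m → X × Bool) (r : BoostSeed K ρ ε γ m R) :
    (rBoostStar K ρ ε γ W S r).1 = voteHyp (boostRun W S r (boostRounds ε γ)).vote := by
  unfold rBoostStar boostRun
  rw [foldl_eq_iterRounds]
  rfl

theorem boostRun_succ (W : (Fin m → X × Bool) → R → X → Bool)
    (S : BoostIdx K ρ ε γ m → X × Bool) (r : BoostSeed K ρ ε γ m R) (t : Fin (boostRounds ε γ)) :
    boostRun W S r (t + 1) = boostRound γ ε W (decide (IsCheckRound γ t)) (boostRun W S r t)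
      (fun i => S ⟨t, .inl i⟩) (fun i => S ⟨t, .inr i⟩) (r t) := by
  unfold boostRun
  rw [iterRounds_succ, boostStep_eq]

/-- The state before round `t` ignores block `t`, so this block may be redrawn. -/
theorem boostRun_congr {W : (Fin m → X × Bool) → R → X → Bool}
    {S S' : BoostIdx K ρ ε γ m → X × Bool} {r r' : BoostSeed K ρ ε γ m R}
    {t : Fin (boostRounds ε γ)} (hS : ∀ i, i.1 ≠ t → S i = S' i) (hr : ∀ i, i ≠ t → r i = r' i) :
    boostRun W S r t = boostRun W S' r' t := by
  refine iterRounds_congr _ t.2.le t.2.le fun k hk s => ?_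
  have hne : (⟨k, hk.trans t.2⟩ : Fin (boostRounds ε γ)) ≠ t := Fin.ne_of_lt hk
  rw [boostStep_eq, boostStep_eq, hr _ hne]
  congr 1
  · funext i; exact hS _ hne
  · funext i; exact hS _ hne

/-- The call count of `rBoost*` is at most the number of rounds. -/
theorem rBoostStar_calls_le (W : (Fin m → X × Bool) → R → X → Bool)
    (S : BoostIdx K ρ ε γ m → X × Bool) (r : BoostSeed K ρ ε γ m R) :
    (rBoostStar K ρ ε γ W S r).2 ≤ boostRounds ε γ := by
  have h : ∀ k, (boostRun W S r k).calls ≤ k := by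
    intro k
    induction k with
    | zero => exact le_rfl
    | succ k ih =>
      by_cases hk : k < boostRounds ε γ
      · have e := boostRun_succ W S r ⟨k, hk⟩
        simp only at e
        rw [e]
        unfold boostRound
        split_ifs
        · omega
        · unfold boostUpdate
          split
          · exact ih.trans k.le_succ
          · exact Nat.succ_le_succ ih
      · have e : boostRun W S r (k + 1) = boostRun W S r k := by
          unfold boostRun; rw [iterRounds, dif_neg hk]
        rw [e]; omega
  have e : (rBoostStar K ρ ε γ W S r).2 = (boostRun W S r (boostRounds ε γ)).calls := by
    unfold rBoostStar boostRun
    rw [foldl_eq_iterRounds]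
  rw [e]; exact h _

/-- Two samples agree for `rBoost*` if they lead to the same states. -/
def BoostAgree (W : (Fin m → X × Bool) → R → X → Bool) (r : BoostSeed K ρ ε γ m R)
    (S₁ S₂ : BoostIdx K ρ ε γ m → X × Bool) : Prop :=
  ∀ k, k ≤ boostRounds ε γ → boostRun W S₁ r k = boostRun W S₂ r k

variable [MeasurableSpace X] [MeasurableSpace R] {W : (Fin m → X × Bool) → R → X → Bool}

theorem measurable_boostRun (hW : Measurable fun q : ((Fin m → X × Bool) × R) × X => W q.1.1 q.1.2 q.2)
    {Θ : Type*} [MeasurableSpace Θ] {S : Θ → BoostIdx K ρ ε γ m → X × Bool} (hS : Measurable S)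
    {r : Θ → BoostSeed K ρ ε γ m R} (hr : Measurable r) (k : ℕ) :
    MeasurableBoost fun θ => boostRun W (S θ) (r θ) k := by
  induction k with
  | zero => exact ⟨measurable_const, measurable_const, measurable_const⟩
  | succ k ih =>
    by_cases hk : k < boostRounds ε γ
    · have e : ∀ θ, boostRun W (S θ) (r θ) (k + 1) = _ :=
        fun θ => boostRun_succ W (S θ) (r θ) ⟨k, hk⟩
      simp only [e]
      refine ih.boostRound γ ε _ hW ?_ ?_ ?_
      · fun_prop
      · fun_prop
      · exact (measurable_pi_apply _).comp hr
    · have e : ∀ θ, boostRun W (S θ) (r θ) (k + 1) = boostRun W (S θ) (r θ) k := by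
        intro θ; unfold boostRun; rw [iterRounds, dif_neg hk]
      simp only [e]; exact ih

/-- Induction on the round: where the states after `n` rounds coincide, the next ones result from
rounds with a common initial state, and `measurableSet_boostRound_eq` applies. `BoostAgree` demands
equality after every round to make this possible. -/
theorem measurableSet_boostAgree
    (hW : Measurable fun q : ((Fin m → X × Bool) × R) × X => W q.1.1 q.1.2 q.2)
    (hW' : MeasurableSet {q : ((Fin m → X × Bool) × (Fin m → X × Bool)) × R |
      W q.1.1 q.2 = W q.1.2 q.2}) :
    MeasurableSet {q : ((BoostIdx K ρ ε γ m → X × Bool) × (BoostIdx K ρ ε γ m → X × Bool)) ×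
      BoostSeed K ρ ε γ m R | BoostAgree W q.2 q.1.1 q.1.2} := by
  have h : ∀ n, n ≤ boostRounds ε γ → MeasurableSet {q : ((BoostIdx K ρ ε γ m → X × Bool) ×
      (BoostIdx K ρ ε γ m → X × Bool)) × BoostSeed K ρ ε γ m R |
      ∀ k, k ≤ n → boostRun W q.1.1 q.2 k = boostRun W q.1.2 q.2 k} := by
    intro n
    induction n with
    | zero =>
      intro _
      convert MeasurableSet.univ
      simp [boostRun, iterRounds]
    | succ n ih =>
      intro hn
      have hs := measurable_boostRun (K := K) (ρ := ρ) (ε := ε) (γ := γ) hW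
        (S := fun q : ((BoostIdx K ρ ε γ m → X × Bool) ×
          (BoostIdx K ρ ε γ m → X × Bool)) × BoostSeed K ρ ε γ m R => q.1.1) (by fun_prop)
        (r := fun q => q.2) measurable_snd n
      have h2 := measurableSet_boostRound_eq γ ε (decide (IsCheckRound γ n)) hW' hs
        (v₁ := fun q i => q.1.1 ⟨⟨n, hn⟩, .inl i⟩) (v₂ := fun q i => q.1.2 ⟨⟨n, hn⟩, .inl i⟩)
        (by fun_prop) (by fun_prop) (w₁ := fun q i => q.1.1 ⟨⟨n, hn⟩, .inr i⟩)
        (w₂ := fun q i => q.1.2 ⟨⟨n, hn⟩, .inr i⟩) (by fun_prop) (by fun_prop)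
        (q := fun q => q.2 ⟨n, hn⟩) ((measurable_pi_apply _).comp measurable_snd)
      convert (ih (Nat.le_of_succ_le hn)).inter h2 using 1
      ext q
      simp only [mem_ofPred_eq, mem_inter_iff]
      have e1 := boostRun_succ W q.1.1 q.2 ⟨n, hn⟩
      have e2 := boostRun_succ W q.1.2 q.2 ⟨n, hn⟩
      simp only at e1 e2
      constructor
      · intro hk
        refine ⟨fun k hk' => hk k (by omega), ?_⟩
        have := hk (n + 1) le_rfl
        rw [e1, e2, ← hk n (by omega)] at this
        exact this
      · rintro ⟨hk, hk2⟩ k hk'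
        rcases Nat.lt_or_ge n k with h | h
        · have : k = n + 1 := by omega
          subst this
          rw [e1, e2, ← hk n le_rfl]
          exact hk2
        · exact hk k h
  exact h _ le_rfl

/-- Violations of the specification of a round of `rBoost*`. -/
def boostBad (K : ℕ) (ρ ε γ : ℝ) {m : ℕ} (P : Measure (X × Bool))
    (W : (Fin m → X × Bool) → R → X → Bool) (t : Fin (boostRounds ε γ)) :
    Set (((BoostIdx K ρ ε γ m → X × Bool) × (BoostIdx K ρ ε γ m → X × Bool)) ×
      BoostSeed K ρ ε γ m R) :=
  {ω | (boostRun W ω.1.1 ω.2 t).halted = false ∧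
    ε / 8 ≤ ∫ z, smoothWeight γ ((boostRun W ω.1.1 ω.2 t).g z) ∂P ∧
    ¬ BoostSpec P γ ε W (decide (IsCheckRound γ t)) (boostRun W ω.1.1 ω.2 t)
      (fun i => ω.1.1 ⟨t, .inl i⟩) (fun i => ω.1.2 ⟨t, .inl i⟩)
      (fun i => ω.1.1 ⟨t, .inr i⟩) (fun i => ω.1.2 ⟨t, .inr i⟩) (ω.2 t)}

/-- If no round violates its specification, then the two runs agree, and are accurate. -/
theorem boostAgree_and_lawErr_le {P : Measure (X × Bool)} [IsProbabilityMeasure P]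
    (hW : Measurable fun q : ((Fin m → X × Bool) × R) × X => W q.1.1 q.1.2 q.2) (hγ0 : 0 < γ)
    (hγ : γ < 1 / 2) (hε : 0 < ε) (hε1 : ε ≤ 1)
    {ω : ((BoostIdx K ρ ε γ m → X × Bool) × (BoostIdx K ρ ε γ m → X × Bool)) ×
      BoostSeed K ρ ε γ m R} (hω : ∀ t, ω ∉ boostBad K ρ ε γ P W t) :
    BoostAgree W ω.2 ω.1.1 ω.1.2 ∧
      lawErr P (rBoostStar K ρ ε γ W ω.1.1 ω.2).1 ≤ 3 / 2 * ε := by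
  have hWS : ∀ S r, Measurable (W S r) := fun S r => hW.comp (measurable_prodMk_left (x := (S, r)))
  have key : ∀ k, k ≤ boostRounds ε γ →
      boostRun W ω.1.1 ω.2 k = boostRun W ω.1.2 ω.2 k ∧
      ((boostRun W ω.1.1 ω.2 k).halted = false → BoostInv P γ ε k (boostRun W ω.1.1 ω.2 k)) ∧
      ((boostRun W ω.1.1 ω.2 k).halted = true →
        lawErr P (voteHyp (boostRun W ω.1.1 ω.2 k).vote) ≤ 3 / 2 * ε) := by
    intro k
    induction k with
    | zero =>
      intro _
      refine ⟨rfl, fun _ => ?_, fun h => ?_⟩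
      · exact_mod_cast BoostInv.init hγ0 (by linarith) hε hε1
      · simp [boostRun, iterRounds] at h
    | succ k ih =>
      intro hk
      obtain ⟨h1, h2, h3⟩ := ih (Nat.le_of_succ_le hk)
      have e1 := boostRun_succ W ω.1.1 ω.2 ⟨k, hk⟩
      have e2 := boostRun_succ W ω.1.2 ω.2 ⟨k, hk⟩
      simp only at e1 e2
      rw [e1, e2, ← h1]
      cases hh : (boostRun W ω.1.1 ω.2 k).halted with
      | true =>
        have e : ∀ v w q, boostRound γ ε W (decide (IsCheckRound γ k)) (boostRun W ω.1.1 ω.2 k)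
            (a := boostDraw K ρ ε γ m) (b := boostCheck K ρ ε γ k) v w q =
            boostRun W ω.1.1 ω.2 k := by
          intro v w q; simp [boostRound, hh]
        rw [e, e]
        exact ⟨rfl, fun h => absurd (hh.symm.trans h) (by simp), h3⟩
      | false =>
        have hinv := h2 hh
        have hspec := hω ⟨k, hk⟩
        simp only [boostBad, mem_ofPred_eq, not_and, not_not] at hspec
        have hv : Measurable (boostRun W ω.1.1 ω.2 k).vote :=
          (measurable_boostRun (K := K) (ρ := ρ) (ε := ε) (γ := γ) hW (Θ := Unit)
            (S := fun _ => ω.1.1) measurable_const (r := fun _ => ω.2) measurable_const k).vote.comp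
            (f := fun x : X => ((), x)) (by fun_prop)
        exact hinv.boostRound hγ0 hγ hε hWS hv rfl hh
          (hspec hh (hinv.density_ge hγ0 hγ hε))
  refine ⟨fun k hk => (key k hk).1, ?_⟩
  rw [rBoostStar_eq]
  obtain ⟨-, h2, h3⟩ := key _ le_rfl
  cases hh : (boostRun W ω.1.1 ω.2 (boostRounds ε γ)).halted with
  | true => exact h3 hh
  | false =>
    -- Without a halt the invariant limits the number of rounds to `160 / (ε γ²)`, which is below
    -- the cut-off.
    exfalso
    have h4 := (h2 hh).rounds_le hγ0 (by linarith) hε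
    have h5 : 256 / (ε * γ ^ 2) ≤ boostRounds ε γ := Nat.le_ceil _
    have h6 : 160 / (ε * γ ^ 2) < 256 / (ε * γ ^ 2) := by gcongr; norm_num
    linarith

theorem measurable_thresholdSpec {Θ : Type*} [MeasurableSpace Θ] {z : ℝ} {c : Θ → ℝ}
    (hc : Measurable c) {b₁ b₂ : Θ → Bool} (h₁ : Measurable b₁) (h₂ : Measurable b₂) :
    Measurable fun θ => ThresholdSpec z (c θ) (b₁ θ) (b₂ θ) := by
  refine Measurable.and (measurableSet_setOfPred.mp (measurableSet_eq_fun h₁ h₂))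
    (Measurable.and (Measurable.imp ?_ ?_) (Measurable.imp ?_ ?_))
  · exact measurableSet_setOfPred.mp (h₁ (measurableSet_singleton true))
  · exact measurableSet_setOfPred.mp (measurableSet_le measurable_const hc)
  · exact measurableSet_setOfPred.mp (h₁ (measurableSet_singleton false))
  · exact measurableSet_setOfPred.mp (measurableSet_le hc measurable_const)

theorem measurable_boostSpec {f : X → Bool} {ν : Measure R} {p : ℝ} {P : Measure (X × Bool)}
    [IsProbabilityMeasure P]
    (hW : IsLearner f ν W (fun r S₁ S₂ => W S₁ r = W S₂ r) p (1 / 2 - γ)) (chk : Bool)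
    {Θ : Type*} [MeasurableSpace Θ] {s : Θ → BoostState X} (hs : MeasurableBoost s) {a b : ℕ}
    {v₁ v₂ : Θ → Fin a → X × Bool} (hv₁ : Measurable v₁)
    (hv₂ : Measurable v₂) {w₁ w₂ : Θ → Fin b → X × Bool} (hw₁ : Measurable w₁)
    (hw₂ : Measurable w₂) {q : Θ → (Fin a → I) × R × I} (hq : Measurable q) :
    Measurable fun θ => (s θ).halted = false ∧ ε / 8 ≤ ∫ z, smoothWeight γ ((s θ).g z) ∂P ∧
      ¬ BoostSpec P γ ε W chk (s θ) (v₁ θ) (v₂ θ) (w₁ θ) (w₂ θ) (q θ) := by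
  have hint := measurable_integral_weight P (μ := fun θ z => smoothWeight γ ((s θ).g z))
    (hs.weight γ)
  refine Measurable.and ?_ (Measurable.and ?_ (Measurable.not (Measurable.and ?_
    (Measurable.imp measurable_const ?_))))
  · exact measurableSet_setOfPred.mp (hs.halted (measurableSet_singleton false))
  · exact measurableSet_setOfPred.mp (measurableSet_le measurable_const hint)
  · exact measurableSet_setOfPred.mp (measurableSet_callSpec hW P
      (μ := fun θ z => smoothWeight γ ((s θ).g z)) (hs.weight γ) hv₁ hv₂ (by fun_prop)
      (by fun_prop))
  · exact measurable_thresholdSpec hint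
      (measurable_rThreshold hw₁ (ε / 2) (φ := fun θ z => smoothWeight γ ((s θ).g z))
        (hs.weight γ) (by fun_prop))
      (measurable_rThreshold hw₂ (ε / 2) (φ := fun θ z => smoothWeight γ ((s θ).g z))
        (hs.weight γ) (by fun_prop))

theorem measurableSet_boostBad {f : X → Bool} {ν : Measure R} {p : ℝ} {P : Measure (X × Bool)}
    [IsProbabilityMeasure P]
    (hW : IsLearner f ν W (fun r S₁ S₂ => W S₁ r = W S₂ r) p (1 / 2 - γ))
    (t : Fin (boostRounds ε γ)) : MeasurableSet (boostBad K ρ ε γ P W t) := by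
  refine measurableSet_setOfPred.mpr (measurable_boostSpec hW _
    (measurable_boostRun hW.measurable_eval (by fun_prop) measurable_snd t) ?_ ?_ ?_ ?_
    ((measurable_pi_apply t).comp measurable_snd)) <;> fun_prop

end BoostProcess

theorem measure_rejectionSampler_none_le' {Z : Type*} [MeasurableSpace Z] (P : Measure Z)
    [IsProbabilityMeasure P] {μ : Z → ℝ} (hμ : IsWeight μ) {m n : ℕ} {d κ : ℝ}
    (hd : d ≤ ∫ z, μ z ∂P) (hκ : m = 0 ∨ (m ≤ n * d / 2 ∧ 2 * Real.exp (-(n * d / 16)) ≤ κ)) :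
    ((Measure.pi fun _ : Fin n => P).prod (Measure.pi fun _ : Fin n => (volume : Measure I)))
      {q | rejectionSampler μ m q.1 q.2 = none} ≤ ENNReal.ofReal κ := by
  rcases hκ with rfl | ⟨h1, h2⟩
  · have : {q : (Fin n → Z) × (Fin n → I) | rejectionSampler μ 0 q.1 q.2 = none} = ∅ := by
      ext q
      obtain ⟨SW, h⟩ := exists_rejectionSampler_zero μ q.1 q.2
      simp [h]
    rw [this]; simp
  · have h3 : (n : ℝ) * d ≤ n * ∫ z, μ z ∂P := by gcongr
    refine (measure_rejectionSampler_none_le P hμ (h1.trans (by linarith))).trans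
      (ENNReal.ofReal_le_ofReal (le_trans ?_ h2))
    have : Real.exp (-(n * (∫ z, μ z ∂P) / 16)) ≤ Real.exp (-(n * d / 16)) :=
      Real.exp_le_exp.mpr (by linarith)
    linarith

/-! ### Failure probabilities in `rBoost*`. -/

section BoostProbability

variable {X R : Type*} [MeasurableSpace X] [MeasurableSpace R] {K : ℕ} {ρ ε γ : ℝ} {m : ℕ}
  {W : (Fin m → X × Bool) → R → X → Bool} {f : X → Bool} {ν : Measure R} [IsProbabilityMeasure ν]
  {p κ η τ : ℝ}

instance : IsProbabilityMeasure (boostSeedLaw K ρ ε γ m ν) := by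
  unfold boostSeedLaw; infer_instance

/-- Replace the examples and seeds of a round. -/
def boostResample (t : Fin (boostRounds ε γ))
    (p : (((BoostIdx K ρ ε γ m → X × Bool) × (BoostIdx K ρ ε γ m → X × Bool)) ×
      BoostSeed K ρ ε γ m R) × (((BoostIdx K ρ ε γ m → X × Bool) ×
      (BoostIdx K ρ ε γ m → X × Bool)) × BoostSeed K ρ ε γ m R)) :
    ((BoostIdx K ρ ε γ m → X × Bool) × (BoostIdx K ρ ε γ m → X × Bool)) ×
      BoostSeed K ρ ε γ m R :=
  (((fun i => if i.1 = t then p.2.1.1 i else p.1.1.1 i),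
    (fun i => if i.1 = t then p.2.1.2 i else p.1.1.2 i)),
    fun i => if i = t then p.2.2 i else p.1.2 i)

theorem measurePreserving_boostResample (P : Measure (X × Bool)) [IsProbabilityMeasure P]
    (t : Fin (boostRounds ε γ)) :
    MeasurePreserving (boostResample (K := K) (ρ := ρ) (ε := ε) (γ := γ) (m := m) (X := X) (R := R) t)
      ((((Measure.pi fun _ => P).prod (Measure.pi fun _ => P)).prod
        (boostSeedLaw K ρ ε γ m ν)).prod (((Measure.pi fun _ => P).prod
        (Measure.pi fun _ => P)).prod (boostSeedLaw K ρ ε γ m ν)))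
      (((Measure.pi fun _ => P).prod (Measure.pi fun _ => P)).prod (boostSeedLaw K ρ ε γ m ν)) := by
  have h1 := measurePreserving_resample (fun _ : BoostIdx K ρ ε γ m => P) (fun i => i.1 = t)
  have h2 := measurePreserving_resample (fun _ : Fin (boostRounds ε γ) =>
    (Measure.pi fun _ : Fin (boostDraw K ρ ε γ m) => (volume : Measure I)).prod
      (ν.prod (volume : Measure I))) (fun i => i = t)
  exact measurePreserving_prod_resample (measurePreserving_prod_resample h1 h1) h2

/-- The probability of violating the specification of a round of `rBoost*`. -/
theorem measure_boostBad_le (hW : IsLearner f ν W (fun r S₁ S₂ => W S₁ r = W S₂ r) p (1 / 2 - γ))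
    (hγ0 : 0 < γ) (hγ : γ < 1) (hε : 0 < ε) (hp : 0 ≤ p) (hκ0 : 0 ≤ κ) (hτ0 : 0 ≤ τ)
    (hη0 : 0 ≤ η) (hη1 : η ≤ 1 / 8)
    (hκ : m = 0 ∨ (m ≤ boostDraw K ρ ε γ m * (ε / 8) / 2 ∧
      2 * Real.exp (-(boostDraw K ρ ε γ m * (ε / 8) / 16)) ≤ κ))
    {t : Fin (boostRounds ε γ)} (hτ : IsCheckRound γ t →
      6 * η + 4 * Real.exp (-(boostCheck K ρ ε γ t * η ^ 2 * (ε / 2) / 4)) ≤ τ)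
    {P : Measure (X × Bool)} (hP : IsLaw f P) :
    (((Measure.pi fun _ => P).prod (Measure.pi fun _ => P)).prod (boostSeedLaw K ρ ε γ m ν))
      (boostBad K ρ ε γ P W t) ≤
      ENNReal.ofReal (2 * κ + 3 * p + if IsCheckRound γ t then τ else 0) := by
  have := hP.1
  set ℙ := ((Measure.pi fun _ : BoostIdx K ρ ε γ m => P).prod
    (Measure.pi fun _ : BoostIdx K ρ ε γ m => P)).prod (boostSeedLaw K ρ ε γ m ν) with hℙ
  refine measure_le_of_resample (measurePreserving_boostResample P t)
    (measurableSet_boostBad hW t) fun ω => ?_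
  -- With `ω` fixed and only block `t` redrawn, the state `s` and its weight are constants, and the
  -- examples and seeds of the round are independent of them.
  set s := boostRun W ω.1.1 ω.2 t with hs
  have hrun : ∀ ω', boostRun W (boostResample t (ω, ω')).1.1 (boostResample t (ω, ω')).2 t = s := by
    intro ω'
    exact boostRun_congr (fun i hi => by simp [boostResample, hi])
      (fun i hi => by simp [boostResample, hi])
  have hsub : {ω' | boostResample t (ω, ω') ∈ boostBad K ρ ε γ P W t} =
      {ω' | s.halted = false ∧ ε / 8 ≤ ∫ z, smoothWeight γ (s.g z) ∂P ∧
        ¬ BoostSpec P γ ε W (decide (IsCheckRound γ t)) s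
        (fun i => ω'.1.1 ⟨t, .inl i⟩) (fun i => ω'.1.2 ⟨t, .inl i⟩)
        (fun i => ω'.1.1 ⟨t, .inr i⟩) (fun i => ω'.1.2 ⟨t, .inr i⟩) (ω'.2 t)} := by
    ext ω'
    simp only [boostBad, mem_ofPred_eq, hrun]
    simp [boostResample]
  rw [hsub]
  -- For lower density the section is empty. As the density condition is part of `boostBad`, the
  -- bound is uniform in `ω` and no conditioning on good earlier rounds is needed.
  by_cases hden : ε / 8 ≤ ∫ z, smoothWeight γ (s.g z) ∂P
  swap
  · simp [hden]
  have hgm : Measurable s.g := (measurable_boostRun (K := K) (ρ := ρ) (ε := ε) (γ := γ)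
    hW.measurable_eval (Θ := Unit) (S := fun _ => ω.1.1) measurable_const (r := fun _ => ω.2)
    measurable_const t).g.comp (f := fun z : X × Bool => ((), z)) (by fun_prop)
  have hwt := isWeight_smoothWeight hγ0 hγ hgm
  have ha : 0 < ∫ z, smoothWeight γ (s.g z) ∂P := by linarith
  have hinl : Function.Injective fun i : Fin (boostDraw K ρ ε γ m) =>
      (⟨t, .inl i⟩ : BoostIdx K ρ ε γ m) := by
    intro i j h; simpa using h
  have hinr : Function.Injective fun i : Fin (boostCheck K ρ ε γ t) =>
      (⟨t, .inr i⟩ : BoostIdx K ρ ε γ m) := by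
    intro i j h; simpa using h
  have hl := measurePreserving_comp_injective (fun _ : BoostIdx K ρ ε γ m => P) _ hinl
  have hr := measurePreserving_comp_injective (fun _ : BoostIdx K ρ ε γ m => P) _ hinr
  have hseed : MeasurePreserving (fun r : BoostSeed K ρ ε γ m R => r t)
      (boostSeedLaw K ρ ε γ m ν)
      ((Measure.pi fun _ : Fin (boostDraw K ρ ε γ m) => (volume : Measure I)).prod
        (ν.prod (volume : Measure I))) := measurePreserving_eval _ t
  have hseed1 := ((MeasurePreserving.id (Measure.pi fun _ : Fin (boostDraw K ρ ε γ m) =>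
    (volume : Measure I))).prod (measurePreserving_fst (μ := ν) (ν := (volume : Measure I)))).comp
    hseed
  have hseed2 := ((measurePreserving_snd (μ := ν) (ν := (volume : Measure I))).comp
    (measurePreserving_snd (μ := Measure.pi fun _ : Fin (boostDraw K ρ ε γ m) =>
    (volume : Measure I)))).comp hseed
  have hcall := (measure_preimage_le_of_measurePreserving ((hl.prod hl).prod hseed1) _).trans
    (measure_not_callSpec_le hW hp hP hwt ha hκ0
      (measure_rejectionSampler_none_le' P hwt hden hκ))
  have h0 : 0 ≤ 2 * κ + 3 * p := by positivity
  by_cases hc : IsCheckRound γ t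
  · rw [if_pos hc, ENNReal.ofReal_add h0 hτ0]
    have hthr := (measure_preimage_le_of_measurePreserving ((hr.prod hr).prod hseed2) _).trans
      ((measure_not_thresholdSpec_le P hwt.measurable hwt.nonneg hwt.le_one hη0 hη1
      (half_pos hε)).trans (ENNReal.ofReal_le_ofReal (hτ hc)))
    refine (measure_mono ?_).trans ((measure_union_le _ _).trans (add_le_add hcall hthr))
    rintro ω' ⟨-, -, h⟩
    by_contra hcon
    simp only [mem_union, not_or, mem_preimage, mem_ofPred_eq, not_not] at hcon
    exact h ⟨hcon.1, fun _ => hcon.2⟩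
  · rw [if_neg hc, add_zero]
    refine (measure_mono ?_).trans hcall
    rintro ω' ⟨-, -, h⟩
    intro hcon
    exact h ⟨hcon, fun h' => absurd (of_decide_eq_true h') hc⟩

theorem measurable_lawErr {Θ : Type*} [MeasurableSpace Θ] (P : Measure (X × Bool))
    [IsProbabilityMeasure P] {h : Θ → X → Bool} (hh : Measurable fun p : Θ × X => h p.1 p.2) :
    Measurable fun θ => lawErr P (h θ) := by
  have e : ∀ θ, lawErr P (h θ) = weightedErr P (fun _ => 1) (h θ) := by
    intro θ
    have hm : Measurable (h θ) := hh.comp (f := fun x => (θ, x)) (by fun_prop)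
    rw [weightedErr, lawErr, ← integral_indicator_one (measurableSet_ne_label hm)]
    congr 1; ext z; simp [indicator_apply]
  simp only [e]
  exact measurable_weightedErr P (μ := fun _ _ => 1) measurable_const hh

/-- `rBoost*` turns a replicable weak learner into a replicable learner. -/
theorem isLearner_rBoostStar
    (hW : IsLearner f ν W (fun r S₁ S₂ => W S₁ r = W S₂ r) p (1 / 2 - γ))
    (hγ0 : 0 < γ) (hγ : γ < 1 / 2) (hε : 0 < ε) (hε1 : ε ≤ 1) (hp : 0 ≤ p) (hκ0 : 0 ≤ κ)
    (hτ0 : 0 ≤ τ) (hη0 : 0 ≤ η) (hη1 : η ≤ 1 / 8)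
    (hκ : m = 0 ∨ (m ≤ boostDraw K ρ ε γ m * (ε / 8) / 2 ∧
      2 * Real.exp (-(boostDraw K ρ ε γ m * (ε / 8) / 16)) ≤ κ))
    (hτ : ∀ t, IsCheckRound γ t →
      6 * η + 4 * Real.exp (-(boostCheck K ρ ε γ t * η ^ 2 * (ε / 2) / 4)) ≤ τ) {δ : ℝ}
    (hδ : ∑ t : Fin (boostRounds ε γ), (2 * κ + 3 * p + if IsCheckRound γ t then τ else 0) ≤ δ) :
    IsLearner f (boostSeedLaw K ρ ε γ m ν) (fun S r => (rBoostStar K ρ ε γ W S r).1)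
      (BoostAgree W) δ (3 / 2 * ε) := by
  have heval : Measurable fun q : ((BoostIdx K ρ ε γ m → X × Bool) × BoostSeed K ρ ε γ m R) × X =>
      (rBoostStar K ρ ε γ W q.1.1 q.1.2).1 q.2 := by
    simp only [rBoostStar_eq]
    refine measurable_decide (measurableSet_le measurable_const ?_)
    exact (measurable_boostRun (K := K) (ρ := ρ) (ε := ε) (γ := γ) hW.measurable_eval
      (S := fun q : (BoostIdx K ρ ε γ m → X × Bool) × BoostSeed K ρ ε γ m R => q.1) measurable_fst
      (r := fun q => q.2) measurable_snd _).vote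
  have hbad : ∀ P, IsLaw f P → (((Measure.pi fun _ => P).prod (Measure.pi fun _ => P)).prod
      (boostSeedLaw K ρ ε γ m ν)) (⋃ t, boostBad K ρ ε γ P W t) ≤ ENNReal.ofReal δ := by
    intro P hP
    have hγ1 : γ < 1 := by linarith
    have := hP.1
    refine (measure_iUnion_fintype_le _ _).trans ((Finset.sum_le_sum fun (t : Fin _) _ =>
      measure_boostBad_le (t := t) hW hγ0 hγ1 hε hp hκ0 hτ0 hη0 hη1 hκ (hτ t) hP).trans ?_)
    rw [← ENNReal.ofReal_sum_of_nonneg]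
    · exact ENNReal.ofReal_le_ofReal hδ
    · intro t _
      split_ifs <;> positivity
  refine ⟨heval, measurableSet_boostAgree hW.measurable_eval hW.measurableSet_agree, fun r =>
    ⟨fun S k _ => rfl, fun h k hk => (h k hk).symm, fun h h' k hk => (h k hk).trans (h' k hk)⟩,
    fun {r S₁ S₂} h => ?_, fun P hP => ?_, fun P hP => ?_⟩
  · rw [rBoostStar_eq, rBoostStar_eq, h _ le_rfl]
  · have := hP.1
    refine (measure_mono fun ω hω => ?_).trans (hbad P hP)
    by_contra hc
    simp only [mem_iUnion, not_exists] at hc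
    exact hω (boostAgree_and_lawErr_le hW.measurable_eval hγ0 hγ hε hε1 hc).1
  · have := hP.1
    have hmp : MeasurePreserving (fun ω : ((BoostIdx K ρ ε γ m → X × Bool) ×
        (BoostIdx K ρ ε γ m → X × Bool)) × BoostSeed K ρ ε γ m R => (ω.1.1, ω.2))
        (((Measure.pi fun _ => P).prod (Measure.pi fun _ => P)).prod (boostSeedLaw K ρ ε γ m ν))
        ((Measure.pi fun _ => P).prod (boostSeedLaw K ρ ε γ m ν)) :=
      measurePreserving_fst.prod (MeasurePreserving.id _)
    rw [← hmp.measure_preimage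
      (measurableSet_lt measurable_const (measurable_lawErr P heval)).nullMeasurableSet]
    refine (measure_mono fun ω hω => ?_).trans (hbad P hP)
    by_contra hc
    simp only [mem_iUnion, not_exists] at hc
    exact absurd (boostAgree_and_lawErr_le hW.measurable_eval hγ0 hγ hε hε1 hc).2 (not_le.mpr hω)

end BoostProbability

/-! ### A round of `rMetaBoost` and its measurability. -/

section MetaRound

variable {X R : Type*}

/-- The capped count after a further hypothesis `h`, before the new cap is applied. -/
def nextCount (M : X × Bool → ℕ) (h : X → Bool) (z : X × Bool) : ℕ :=
  M z + if h z.1 ≠ z.2 then 1 else 0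

/-- The indicator function of the examples whose count exceeds the cap `c`. -/
def overflow (M : X × Bool → ℕ) (c : ℕ) (h : X → Bool) (z : X × Bool) : ℝ :=
  if nextCount M h z = c + 1 then 1 else 0

/-- The weight function of `rMetaBoost`. -/
def metaWeight (s : MetaState X) (z : X × Bool) : ℝ := Real.exp ((s.M z : ℝ) - s.c)

/-- The state after a round of `rMetaBoost`, apart from the number of calls, given the outcome `o`
of the rejection sampler. -/
def metaUpdate (ε : ℝ) {m b : ℕ} (A : (Fin m → X × Bool) → R → X → Bool)
    (s : MetaState X) (o : Option (Fin m → X × Bool)) (w : Fin b → X × Bool) (r : R) (u : I) :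
    MetaState X :=
  match o with
  | none => { s with halted := true }
  | some SW =>
    let c' := s.c + (rThreshold w (ε / 16) (overflow s.M s.c (A SW r)) u).toNat
    { M := fun z => min (nextCount s.M (A SW r) z) c'
      c := c'
      vote := fun x => s.vote x + sgn (A SW r x)
      halted := false
      calls := s.calls }

/-- A round of `rMetaBoost`, apart from the number of calls, as a function of its fresh examples
and its randomness. -/
def metaRound (ε : ℝ) {m a b : ℕ} (A : (Fin m → X × Bool) → R → X → Bool)
    (s : MetaState X) (v : Fin a → X × Bool) (w : Fin b → X × Bool)
    (q : (Fin a → I) × R × I) : MetaState X :=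
  if s.halted then s else
    metaUpdate ε A s (rejectionSampler (metaWeight s) m v q.1) w q.2.1 q.2.2

variable [MeasurableSpace X] [MeasurableSpace R]

/-- Measurable dependence of a state on parameters. -/
structure MeasurableMeta {Θ : Type*} [MeasurableSpace Θ] (s : Θ → MetaState X) : Prop where
  M : Measurable fun p : Θ × (X × Bool) => (s p.1).M p.2
  c : Measurable fun θ => (s θ).c
  vote : Measurable fun p : Θ × X => (s p.1).vote p.2
  halted : Measurable fun θ => (s θ).halted

theorem MeasurableMeta.weight {Θ : Type*} [MeasurableSpace Θ] {s : Θ → MetaState X}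
    (hs : MeasurableMeta s) : Measurable fun p : Θ × (X × Bool) => metaWeight (s p.1) p.2 := by
  have h1 : Measurable (fun n : ℕ => (n : ℝ)) := measurable_from_top
  exact Real.measurable_exp.comp ((h1.comp hs.M).sub (h1.comp (hs.c.comp measurable_fst)))

theorem measurable_nextCount {Θ : Type*} [MeasurableSpace Θ] {M : Θ → X × Bool → ℕ}
    (hM : Measurable fun p : Θ × (X × Bool) => M p.1 p.2) {h : Θ → X → Bool}
    (hh : Measurable fun p : Θ × X => h p.1 p.2) :
    Measurable fun p : Θ × (X × Bool) => nextCount (M p.1) (h p.1) p.2 := by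
  refine hM.add (Measurable.ite ?_ measurable_const measurable_const)
  refine (measurableSet_eq_fun ?_ (by fun_prop)).compl
  exact hh.comp (f := fun p : Θ × (X × Bool) => (p.1, p.2.1)) (by fun_prop)

theorem measurable_overflow {Θ : Type*} [MeasurableSpace Θ] {M : Θ → X × Bool → ℕ}
    (hM : Measurable fun p : Θ × (X × Bool) => M p.1 p.2) {c : Θ → ℕ} (hc : Measurable c)
    {h : Θ → X → Bool} (hh : Measurable fun p : Θ × X => h p.1 p.2) :
    Measurable fun p : Θ × (X × Bool) => overflow (M p.1) (c p.1) (h p.1) p.2 := by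
  refine Measurable.ite ?_ measurable_const measurable_const
  exact measurableSet_eq_fun (measurable_nextCount hM hh)
    ((hc.comp measurable_fst).add measurable_const)

variable {Θ : Type*} [MeasurableSpace Θ] {m a b : ℕ} {A : (Fin m → X × Bool) → R → X → Bool}
  {s : Θ → MetaState X}

/-- The threshold check after a call is measurable. -/
theorem MeasurableMeta.rThreshold
    (hA : Measurable fun q : ((Fin m → X × Bool) × R) × X => A q.1.1 q.1.2 q.2)
    (hs : MeasurableMeta s) {w : Θ → Fin b → X × Bool} (hw : Measurable w) {r : Θ → R}
    (hr : Measurable r) {u : Θ → I} (hu : Measurable u) (z : ℝ) :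
    Measurable fun p : Θ × (Fin m → X × Bool) =>
      rThreshold (w p.1) z (overflow (s p.1).M (s p.1).c (A p.2 (r p.1))) (u p.1) := by
  refine measurable_rThreshold (Θ := Θ × (Fin m → X × Bool)) (w := fun p => w p.1) (by fun_prop) z
    (φ := fun p => overflow (s p.1).M (s p.1).c (A p.2 (r p.1))) ?_ (by fun_prop)
  refine measurable_overflow (Θ := Θ × (Fin m → X × Bool)) (M := fun p => (s p.1).M)
    (h := fun p => A p.2 (r p.1)) (c := fun p => (s p.1).c) ?_ (hs.c.comp measurable_fst) ?_
  · exact hs.M.comp (f := fun p : (Θ × (Fin m → X × Bool)) × (X × Bool) => (p.1.1, p.2))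
      (by fun_prop)
  · exact hA.comp (f := fun p : (Θ × (Fin m → X × Bool)) × X => ((p.1.2, r p.1.1), p.2))
      (by fun_prop)

theorem MeasurableMeta.metaRound (ε : ℝ)
    (hA : Measurable fun q : ((Fin m → X × Bool) × R) × X => A q.1.1 q.1.2 q.2)
    (hs : MeasurableMeta s) {v : Θ → Fin a → X × Bool} (hv : Measurable v)
    {w : Θ → Fin b → X × Bool} (hw : Measurable w) {q : Θ → (Fin a → I) × R × I}
    (hq : Measurable q) :
    MeasurableMeta fun θ => metaRound ε A (s θ) (v θ) (w θ) (q θ) := by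
  have hhalt : MeasurableSet {θ | (s θ).halted = true} := hs.halted (measurableSet_singleton true)
  -- a field of the next state is measurable if it is so for both outcomes of the sampler
  have key : ∀ {Y Z : Type _} [MeasurableSpace Y] [MeasurableSpace Z] (π : MetaState X → Y → Z),
      Measurable (fun p : Θ × Y => π (s p.1) p.2) →
      Measurable (fun p : Θ × Y => π { s p.1 with halted := true } p.2) →
      Measurable (fun p : (Θ × Y) × (Fin m → X × Bool) => π (metaUpdate ε A (s p.1.1) (some p.2)
        (w p.1.1) (q p.1.1).2.1 (q p.1.1).2.2) p.1.2) →
      Measurable fun p : Θ × Y => π (ReplicableBoosting.metaRound ε A (s p.1) (v p.1) (w p.1)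
        (q p.1)) p.2 := by
    intro Y Z _ _ π h1 h2 h3
    have h : Measurable fun p : Θ × Y => π (metaUpdate ε A (s p.1) (rejectionSampler
        (metaWeight (s p.1)) m (v p.1) (q p.1).1) (w p.1) (q p.1).2.1 (q p.1).2.2) p.2 :=
      measurable_rejectionSampler (Θ := Θ × Y) (μ := fun p => metaWeight (s p.1))
        (hs.weight.comp (f := fun p : (Θ × Y) × (X × Bool) => (p.1.1, p.2)) (by fun_prop))
        (S := fun p => v p.1) (by fun_prop) (u := fun p => (q p.1).1) (by fun_prop)
        (F := fun p o => π (metaUpdate ε A (s p.1) o (w p.1) (q p.1).2.1 (q p.1).2.2) p.2) h2 h3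
    have e : (fun p : Θ × Y => π (ReplicableBoosting.metaRound ε A (s p.1) (v p.1) (w p.1)
        (q p.1)) p.2) = fun p => if (s p.1).halted = true then π (s p.1) p.2 else
        π (metaUpdate ε A (s p.1) (rejectionSampler
        (metaWeight (s p.1)) m (v p.1) (q p.1).1) (w p.1) (q p.1).2.1 (q p.1).2.2) p.2 := by
      funext p; unfold ReplicableBoosting.metaRound; split_ifs <;> rfl
    rw [e]
    exact Measurable.ite (measurable_fst hhalt) h1 h
  have hthr := hs.rThreshold hA hw (r := fun θ => (q θ).2.1) (by fun_prop)
    (u := fun θ => (q θ).2.2) (by fun_prop) (ε / 16)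
  have hc' : Measurable fun p : Θ × (Fin m → X × Bool) => (s p.1).c + (ReplicableBoosting.rThreshold
      (w p.1) (ε / 16) (overflow (s p.1).M (s p.1).c (A p.2 (q p.1).2.1)) (q p.1).2.2).toNat :=
    (hs.c.comp measurable_fst).add ((measurable_from_top (f := Bool.toNat)).comp hthr)
  constructor
  · refine key (fun s z => s.M z) hs.M hs.M ?_
    refine Measurable.min ?_ (hc'.comp (f := fun p : (Θ × (X × Bool)) × (Fin m → X × Bool) =>
      (p.1.1, p.2)) (by fun_prop))
    have hN := measurable_nextCount (Θ := Θ × (Fin m → X × Bool)) (M := fun p => (s p.1).M)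
      (h := fun p => A p.2 (q p.1).2.1)
      (hs.M.comp (f := fun p : (Θ × (Fin m → X × Bool)) × (X × Bool) => (p.1.1, p.2)) (by fun_prop))
      (hA.comp (f := fun p : (Θ × (Fin m → X × Bool)) × X => ((p.1.2, (q p.1.1).2.1), p.2))
        (by fun_prop))
    exact hN.comp (f := fun p : (Θ × (X × Bool)) × (Fin m → X × Bool) =>
      ((p.1.1, p.2), p.1.2)) (by fun_prop)
  · have := key (fun s (_ : PUnit) => s.c) (hs.c.comp measurable_fst) (hs.c.comp measurable_fst)
      (hc'.comp (f := fun p : (Θ × PUnit) × (Fin m → X × Bool) => (p.1.1, p.2)) (by fun_prop))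
    exact this.comp (f := fun θ => (θ, PUnit.unit)) (by fun_prop)
  · refine key (fun s x => s.vote x) hs.vote hs.vote ?_
    refine Measurable.add (hs.vote.comp measurable_fst) (measurable_sgn.comp ?_)
    exact hA.comp (f := fun p : (Θ × X) × (Fin m → X × Bool) =>
      ((p.2, (q p.1.1).2.1), p.1.2)) (by fun_prop)
  · have := key (fun s (_ : PUnit) => s.halted) (hs.halted.comp measurable_fst) measurable_const
      measurable_const
    exact this.comp (f := fun θ => (θ, PUnit.unit)) (by fun_prop)

/-- The specification of a round of `rMetaBoost`, for two samples. -/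
def MetaSpec (P : Measure (X × Bool)) (ε β : ℝ) (A : (Fin m → X × Bool) → R → X → Bool)
    (agree : R → (Fin m → X × Bool) → (Fin m → X × Bool) → Prop) (s : MetaState X)
    (v₁ v₂ : Fin a → X × Bool) (w₁ w₂ : Fin b → X × Bool) (q : (Fin a → I) × R × I) : Prop :=
  CallSpec P A agree β (metaWeight s) v₁ v₂ q.1 q.2.1 ∧
  ∀ SW, rejectionSampler (metaWeight s) m v₁ q.1 = some SW →
    ThresholdSpec (ε / 16) (∫ z, overflow s.M s.c (A SW q.2.1) z ∂P)
      (rThreshold w₁ (ε / 16) (overflow s.M s.c (A SW q.2.1)) q.2.2)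
      (rThreshold w₂ (ε / 16) (overflow s.M s.c (A SW q.2.1)) q.2.2)

/-- The part of the specification that concerns the threshold check is measurable. -/
theorem measurable_metaThreshold (P : Measure (X × Bool)) [IsProbabilityMeasure P] (ε : ℝ)
    (hA : Measurable fun q : ((Fin m → X × Bool) × R) × X => A q.1.1 q.1.2 q.2)
    (hs : MeasurableMeta s) {v₁ : Θ → Fin a → X × Bool} (hv₁ : Measurable v₁)
    {w₁ w₂ : Θ → Fin b → X × Bool} (hw₁ : Measurable w₁) (hw₂ : Measurable w₂)
    {q : Θ → (Fin a → I) × R × I} (hq : Measurable q) :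
    Measurable fun θ => ∀ SW, rejectionSampler (metaWeight (s θ)) m (v₁ θ) (q θ).1 = some SW →
      ThresholdSpec (ε / 16) (∫ z, overflow (s θ).M (s θ).c (A SW (q θ).2.1) z ∂P)
      (rThreshold (w₁ θ) (ε / 16) (overflow (s θ).M (s θ).c (A SW (q θ).2.1)) (q θ).2.2)
      (rThreshold (w₂ θ) (ε / 16) (overflow (s θ).M (s θ).c (A SW (q θ).2.1)) (q θ).2.2) := by
  refine measurable_rejectionSampler (μ := fun θ => metaWeight (s θ)) hs.weight hv₁ (by fun_prop)
    (F := fun θ o => ∀ SW, o = some SW →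
      ThresholdSpec (ε / 16) (∫ z, overflow (s θ).M (s θ).c (A SW (q θ).2.1) z ∂P)
      (rThreshold (w₁ θ) (ε / 16) (overflow (s θ).M (s θ).c (A SW (q θ).2.1)) (q θ).2.2)
      (rThreshold (w₂ θ) (ε / 16) (overflow (s θ).M (s θ).c (A SW (q θ).2.1)) (q θ).2.2)) ?_ ?_
  · simp
  · simp only [Option.some.injEq, forall_eq']
    refine measurable_thresholdSpec ?_ (hs.rThreshold hA hw₁ (r := fun θ => (q θ).2.1)
      (by fun_prop) (u := fun θ => (q θ).2.2) (by fun_prop) _) (hs.rThreshold hA hw₂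
      (r := fun θ => (q θ).2.1) (by fun_prop) (u := fun θ => (q θ).2.2) (by fun_prop) _)
    refine measurable_integral_weight (Θ := Θ × (Fin m → X × Bool)) P
      (μ := fun p => overflow (s p.1).M (s p.1).c (A p.2 (q p.1).2.1)) ?_
    refine measurable_overflow (Θ := Θ × (Fin m → X × Bool)) (M := fun p => (s p.1).M)
      (h := fun p => A p.2 (q p.1).2.1) (c := fun p => (s p.1).c) ?_ (hs.c.comp measurable_fst) ?_
    · exact hs.M.comp (f := fun p : (Θ × (Fin m → X × Bool)) × (X × Bool) => (p.1.1, p.2))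
        (by fun_prop)
    · exact hA.comp (f := fun p : (Θ × (Fin m → X × Bool)) × X => ((p.1.2, (q p.1.1).2.1), p.2))
        (by fun_prop)

end MetaRound

/-! ### The invariant of `rMetaBoost` and the accuracy of the vote. -/

section MetaInvariant

variable {X R : Type*}

theorem metaRound_M_le {ε : ℝ} {m a b : ℕ} {A : (Fin m → X × Bool) → R → X → Bool}
    {s : MetaState X} (hs : ∀ z, s.M z ≤ s.c) (v : Fin a → X × Bool) (w : Fin b → X × Bool)
    (q : (Fin a → I) × R × I) (z : X × Bool) :
    (metaRound ε A s v w q).M z ≤ (metaRound ε A s v w q).c := by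
  unfold metaRound
  split_ifs
  · exact hs z
  · unfold metaUpdate
    split
    · exact hs z
    · exact min_le_right _ _

variable [MeasurableSpace X]

/-- The invariant of the loop of `rMetaBoost` after `t` rounds. The third condition bounds the part
of the true counts of errors that was cut off by the cap. -/
structure MetaInv (P : Measure (X × Bool)) (ε : ℝ) (t : ℕ) (s : MetaState X) : Prop where
  halted : s.halted = false
  measurable_M : Measurable s.M
  measurable_vote : Measurable s.vote
  M_le : ∀ z, s.M z ≤ s.c
  M_le_rounds : ∀ z, s.M z ≤ t
  abs_vote_le : ∀ x, |s.vote x| ≤ t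
  le_errors : ∀ z, (s.M z : ℝ) ≤ (t - s.vote z.1 * sgn z.2) / 2
  mass : ε / 32 ≤ P.real {z | s.M z = s.c}
  exp_le : ∫ z, Real.exp (s.M z) ∂P ≤ Real.exp (t / 4)
  loss_le : ∫ z, ((t - s.vote z.1 * sgn z.2) / 2 - s.M z) ∂P ≤ t * (ε / 8)

theorem isWeight_metaWeight {s : MetaState X} (hM : Measurable s.M) (hs : ∀ z, s.M z ≤ s.c) :
    IsWeight (metaWeight s) := by
  have h1 : Measurable (fun n : ℕ => (n : ℝ)) := measurable_from_top
  refine ⟨Real.measurable_exp.comp ((h1.comp hM).sub measurable_const),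
    fun z => (Real.exp_pos _).le, fun z => Real.exp_le_one_iff.mpr ?_⟩
  have : (s.M z : ℝ) ≤ s.c := by exact_mod_cast hs z
  linarith

theorem measurable_natCast_comp {Y : Type*} [MeasurableSpace Y] {M : Y → ℕ} (hM : Measurable M) :
    Measurable fun z => (M z : ℝ) :=
  (measurable_from_top (f := fun n : ℕ => (n : ℝ))).comp hM

variable {P : Measure (X × Bool)} [IsProbabilityMeasure P] {ε : ℝ} {t : ℕ} {s : MetaState X}

/-- Examples at the cap have weight 1, and their mass is part of the invariant. -/
theorem MetaInv.density_ge (hs : MetaInv P ε t s) : ε / 32 ≤ ∫ z, metaWeight s z ∂P := by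
  have hw := isWeight_metaWeight hs.measurable_M hs.M_le
  have hS : MeasurableSet {z | s.M z = s.c} := hs.measurable_M (measurableSet_singleton _)
  refine hs.mass.trans ?_
  rw [← integral_indicator_one hS]
  refine integral_mono ((integrable_const (1 : ℝ)).indicator hS) (hw.integrable P) fun z => ?_
  by_cases hz : s.M z = s.c
  · rw [indicator_of_mem (show z ∈ {z | s.M z = s.c} from hz)]; simp [metaWeight, hz]
  · rw [indicator_of_notMem (show z ∉ {z | s.M z = s.c} from hz)]; exact hw.nonneg z

theorem integrable_of_abs_le {Y : Type*} [MeasurableSpace Y] {Q : Measure Y} [IsFiniteMeasure Q]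
    {φ : Y → ℝ} (hφ : Measurable φ) (B : ℝ) (hB : ∀ y, |φ y| ≤ B) : Integrable φ Q :=
  Integrable.of_bound hφ.aestronglyMeasurable B (ae_of_all _ hB)

theorem MetaInv.integrable_loss (hs : MetaInv P ε t s) :
    Integrable (fun z : X × Bool => (t - s.vote z.1 * sgn z.2) / 2 - s.M z) P := by
  refine integrable_of_abs_le ?_ (t + t) fun z => ?_
  · exact ((measurable_const.sub ((hs.measurable_vote.comp measurable_fst).mul
      (measurable_sgn.comp measurable_snd))).div_const 2).sub
      (measurable_natCast_comp hs.measurable_M)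
  · have h1 : |s.vote z.1 * sgn z.2| ≤ t := by
      rw [abs_mul, abs_sgn, mul_one]; exact hs.abs_vote_le _
    have h2 : (s.M z : ℝ) ≤ t := by exact_mod_cast hs.M_le_rounds z
    have h3 : (0 : ℝ) ≤ s.M z := by positivity
    have h4 := abs_le.mp h1
    rw [abs_le]; constructor <;> linarith

theorem MetaInv.init (hε : ε ≤ 1) : MetaInv P ε 0 ⟨fun _ => 0, 0, fun _ => 0, false, 0⟩ where
  halted := rfl
  measurable_M := measurable_const
  measurable_vote := measurable_const
  M_le _ := le_rfl
  M_le_rounds _ := le_rfl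
  abs_vote_le _ := by simp
  le_errors _ := by simp
  mass := by simp; linarith
  exp_le := by simp
  loss_le := by simp

omit [MeasurableSpace X] in
theorem nextCount_le {M : X × Bool → ℕ} {h : X → Bool} (z : X × Bool) :
    nextCount M h z ≤ M z + 1 := by
  unfold nextCount; split_ifs <;> omega

omit [MeasurableSpace X] in
theorem le_nextCount {M : X × Bool → ℕ} {h : X → Bool} (z : X × Bool) :
    M z ≤ nextCount M h z := by
  unfold nextCount; split_ifs <;> omega

/-- A round that meets its specification leads to the same state for both samples (apart from the
number of calls), and preserves the invariant. -/
theorem MetaInv.metaRound {β : ℝ} (hβ : β ≤ 1 / 8) (hε : 0 < ε) {m a b : ℕ}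
    {A : (Fin m → X × Bool) → R → X → Bool}
    {agree : R → (Fin m → X × Bool) → (Fin m → X × Bool) → Prop}
    (hAm : ∀ S r, Measurable (A S r)) (hA : ∀ {r S₁ S₂}, agree r S₁ S₂ → A S₁ r = A S₂ r)
    (hs : MetaInv P ε t s) {v₁ v₂ : Fin a → X × Bool} {w₁ w₂ : Fin b → X × Bool}
    {q : (Fin a → I) × R × I} (hspec : MetaSpec P ε β A agree s v₁ v₂ w₁ w₂ q) :
    metaRound ε A s v₁ w₁ q = metaRound ε A s v₂ w₂ q ∧
      MetaInv P ε (t + 1) (metaRound ε A s v₁ w₁ q) := by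
  obtain ⟨⟨SW₁, SW₂, h₁, h₂, hagree, herr⟩, hthr⟩ := hspec
  replace hthr := hthr SW₁ h₁
  have hA' := hA hagree
  have e₁ : ReplicableBoosting.metaRound ε A s v₁ w₁ q =
      metaUpdate ε A s (some SW₁) w₁ q.2.1 q.2.2 := by
    simp [ReplicableBoosting.metaRound, hs.halted, h₁]
  have e₂ : ReplicableBoosting.metaRound ε A s v₂ w₂ q =
      metaUpdate ε A s (some SW₂) w₂ q.2.1 q.2.2 := by
    simp [ReplicableBoosting.metaRound, hs.halted, h₂]
  have hh' : Measurable (A SW₁ q.2.1) := hAm _ _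
  have e₃ : metaUpdate ε A s (some SW₁) w₁ q.2.1 q.2.2 =
      metaUpdate ε A s (some SW₂) w₂ q.2.1 q.2.2 := by
    simp only [metaUpdate]
    rw [← hA', hthr.1]
  refine ⟨by rw [e₁, e₂, e₃], ?_⟩
  rw [e₁]
  simp only [metaUpdate]
  set h := A SW₁ q.2.1
  set bt := rThreshold w₁ (ε / 16) (overflow s.M s.c h) q.2.2
  have hNm : Measurable (nextCount s.M h) :=
    (measurable_nextCount (Θ := Unit) (M := fun _ => s.M) (h := fun _ => h)
      (hs.measurable_M.comp measurable_snd) (hh'.comp measurable_snd)).comp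
      (f := fun z : X × Bool => ((), z)) (by fun_prop)
  have hNc : ∀ z, nextCount s.M h z ≤ s.c + 1 := fun z =>
    (nextCount_le z).trans (Nat.succ_le_succ (hs.M_le z))
  have hM'm : Measurable fun z => min (nextCount s.M h z) (s.c + bt.toNat) :=
    hNm.min measurable_const
  have hB : MeasurableSet {z | nextCount s.M h z = s.c + 1} := hNm (measurableSet_singleton _)
  have hov : ∀ z, overflow s.M s.c h z =
      {z | nextCount s.M h z = s.c + 1}.indicator (fun _ => (1 : ℝ)) z := by
    intro z; simp [overflow, indicator_apply]
  have hovI : ∫ z, overflow s.M s.c h z ∂P = P.real {z | nextCount s.M h z = s.c + 1} := by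
    simp_rw [hov]; exact integral_indicator_one hB
  have hovint : Integrable (overflow s.M s.c h) P := by
    rw [funext hov]; exact (integrable_const (1 : ℝ)).indicator hB
  -- Counts grow by at most one, so an unchanged cap removes exactly the overflow, and a raised cap
  -- removes nothing.
  have hcut : ∀ z, (nextCount s.M h z : ℝ) - (min (nextCount s.M h z) (s.c + bt.toNat) : ℕ) =
      if bt = true then 0 else overflow s.M s.c h z := by
    intro z
    have := hNc z
    cases bt with
    | true => simp [min_eq_left this]
    | false =>
      simp only [overflow, Bool.toNat_false, add_zero, Bool.false_eq_true, if_false]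
      split_ifs with hz
      · rw [hz, min_eq_right (Nat.le_succ _)]; push_cast; ring
      · rw [min_eq_left (by omega)]; ring
  -- `(t - vote · y) / 2` is the true number of errors. It increases together with the uncapped
  -- count, so the gap widens only by what the cap cuts off.
  have herrs : ∀ z : X × Bool, ((t + 1 : ℕ) - (s.vote z.1 + sgn (h z.1)) * sgn z.2) / 2 -
      (min (nextCount s.M h z) (s.c + bt.toNat) : ℕ) =
      ((t - s.vote z.1 * sgn z.2) / 2 - s.M z) + if bt = true then 0 else overflow s.M s.c h z := by
    intro z
    rw [← hcut z]
    have h1 := sgn_mul_sgn (h z.1) z.2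
    have h2 : (nextCount s.M h z : ℝ) = s.M z + if h z.1 ≠ z.2 then 1 else 0 := by
      unfold nextCount; split_ifs <;> simp
    rw [h2, add_mul, h1]
    push_cast
    split_ifs <;> ring
  have hov0 : ∀ z, 0 ≤ overflow s.M s.c h z := by
    intro z; unfold overflow; split_ifs <;> norm_num
  refine ⟨rfl, hM'm, hs.measurable_vote.add (measurable_sgn.comp hh'), fun z => min_le_right _ _,
    fun z => (min_le_left _ _).trans ((nextCount_le z).trans (Nat.succ_le_succ (hs.M_le_rounds z))),
    fun x => ?_, fun z => ?_, ?_, ?_, ?_⟩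
  · push_cast
    calc _ ≤ |s.vote x| + |sgn (h x)| := abs_add_le _ _
      _ ≤ t + 1 := by rw [abs_sgn]; linarith [hs.abs_vote_le x]
  · have h1 := herrs z
    have h2 := hs.le_errors z
    have h3 : 0 ≤ if bt = true then 0 else overflow s.M s.c h z := by
      split_ifs
      exacts [le_rfl, hov0 z]
    simp only at h1 ⊢
    linarith
  -- If the cap is kept, the examples at the cap stay there. If it is raised, the overflowing
  -- examples are at the new cap, and a positive check at level `ε/16` gives them mass at least
  -- `ε/32`.
  · rcases hbt : bt with _ | _
    · refine hs.mass.trans (measureReal_mono fun z hz => ?_)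
      have h1 : s.M z = s.c := hz
      have := le_nextCount (M := s.M) (h := h) z
      simp only [mem_ofPred_eq, Bool.toNat_false, add_zero]
      exact min_eq_right (h1 ▸ this)
    · have h1 := hthr.2.1 hbt
      rw [hovI] at h1
      refine le_trans (by linarith) (h1.trans (measureReal_mono fun z hz => ?_))
      have h2 : nextCount s.M h z = s.c + 1 := hz
      simp [h2]
  · have hexpM : Integrable (fun z => Real.exp (s.M z)) P := by
      refine integrable_of_abs_le (Real.measurable_exp.comp
        (measurable_natCast_comp hs.measurable_M)) (Real.exp t) fun z => ?_
      rw [abs_of_pos (Real.exp_pos _)]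
      exact Real.exp_le_exp.mpr (by exact_mod_cast hs.M_le_rounds z)
    have hW := isWeight_metaWeight hs.measurable_M hs.M_le
    have hwi : Integrable (fun z => if h z.1 ≠ z.2 then metaWeight s z else 0) P := by
      refine ((hW.integrable P).indicator (measurableSet_ne_label hh')).congr
        (ae_of_all _ fun z => ?_)
      simp [indicator_apply]
    have hexpw : ∀ z, Real.exp (s.M z) = Real.exp s.c * metaWeight s z := by
      intro z; rw [metaWeight, ← Real.exp_add]; congr 1; ring
    -- An error multiplies `exp M` by at most `exp 1 < 3`, so it adds at most `2 exp M`.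
    have hpt : ∀ z, Real.exp ((min (nextCount s.M h z) (s.c + bt.toNat) : ℕ) : ℝ) ≤
        Real.exp (s.M z) + 2 * (Real.exp s.c * if h z.1 ≠ z.2 then metaWeight s z else 0) := by
      intro z
      have h1 : ((min (nextCount s.M h z) (s.c + bt.toNat) : ℕ) : ℝ) ≤ nextCount s.M h z := by
        exact_mod_cast min_le_left _ _
      refine (Real.exp_le_exp.mpr h1).trans ?_
      unfold nextCount
      split_ifs
      · rw [← hexpw]; push_cast
        rw [Real.exp_add]
        have := Real.exp_one_lt_d9
        nlinarith [Real.exp_pos (s.M z : ℝ)]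
      · simp
    have h1 : ∫ z, Real.exp ((min (nextCount s.M h z) (s.c + bt.toNat) : ℕ) : ℝ) ∂P ≤
        ∫ z, Real.exp (s.M z) ∂P + 2 * (Real.exp s.c * weightedErr P (metaWeight s) h) := by
      rw [weightedErr, ← integral_const_mul, ← integral_const_mul,
        ← integral_add hexpM ((hwi.const_mul _).const_mul _)]
      refine integral_mono_of_nonneg (ae_of_all _ fun z => (Real.exp_pos _).le)
        (hexpM.add ((hwi.const_mul _).const_mul _)) (ae_of_all _ hpt)
    have h2 : ∫ z, Real.exp (s.M z) ∂P = Real.exp s.c * ∫ z, metaWeight s z ∂P := by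
      rw [← integral_const_mul]; congr 1; ext z; exact hexpw z
    have h3 : Real.exp s.c * weightedErr P (metaWeight s) h ≤
        1 / 8 * ∫ z, Real.exp (s.M z) ∂P := by
      rw [h2]
      have h4 : 0 ≤ ∫ z, metaWeight s z ∂P := integral_nonneg hW.nonneg
      calc _ ≤ Real.exp s.c * (β * ∫ z, metaWeight s z ∂P) :=
            mul_le_mul_of_nonneg_left herr (Real.exp_pos _).le
        _ ≤ Real.exp s.c * (1 / 8 * ∫ z, metaWeight s z ∂P) := by gcongr
        _ = _ := by ring
    have h5 : Real.exp (((t + 1 : ℕ) : ℝ) / 4) = Real.exp (1 / 4) * Real.exp (t / 4) := by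
      rw [← Real.exp_add]; congr 1; push_cast; ring
    -- With weighted error at most `1/8` of the total, a round multiplies the integral by at most `1
    -- + 2/8 ≤ exp (1/4)`.
    have h6 := Real.add_one_le_exp (1 / 4 : ℝ)
    rw [h5]
    have h7 := hs.exp_le
    have h8 := Real.exp_pos ((t : ℝ) / 4)
    nlinarith
  -- If the cap is kept, the overflow has mass at most `2 · ε/16 = ε/8`.
  · simp_rw [herrs]
    have h5 : 0 ≤ (t : ℝ) * (ε / 8) := by positivity
    cases hbt : bt with
    | true =>
      simp only [if_true, add_zero]
      refine hs.loss_le.trans ?_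
      push_cast; linarith
    | false =>
      simp only [Bool.false_eq_true, if_false]
      rw [integral_add hs.integrable_loss hovint]
      have := hthr.2.2 hbt
      have := hs.loss_le
      push_cast; linarith

/-- After sufficiently many rounds, the vote is accurate. -/
theorem MetaInv.lawErr_le (hε : 0 < ε) (hs : MetaInv P ε t s) (ht : 8 * Real.log (2 / ε) ≤ t) :
    lawErr P (voteHyp s.vote) ≤ ε := by
  by_contra hcon
  push Not at hcon
  have hHm : Measurable (voteHyp s.vote) :=
    measurable_decide (measurableSet_le measurable_const hs.measurable_vote)
  have hB := measurableSet_ne_label hHm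
  set B := {z : X × Bool | voteHyp s.vote z.1 ≠ z.2}
  set β := lawErr P (voteHyp s.vote) with hβ
  have hβB : P.real B = β := rfl
  -- A misclassified example has at least `t/2` errors, and in total at most `t ε / 8` was cut off.
  -- If `β > ε`, the mean of `M` on `B` is therefore at least `t/2 - t/8 = x`.
  set x := 3 / 8 * (t : ℝ) with hx
  have hMm := measurable_natCast_comp hs.measurable_M
  have hMint : Integrable (fun z => (s.M z : ℝ)) P :=
    integrable_of_abs_le hMm t fun z => by
      rw [abs_of_nonneg (by positivity)]; exact_mod_cast hs.M_le_rounds z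
  have hexpM : Integrable (fun z => Real.exp (s.M z)) P := by
    refine integrable_of_abs_le (Real.measurable_exp.comp hMm) (Real.exp t) fun z => ?_
    rw [abs_of_pos (Real.exp_pos _)]
    exact Real.exp_le_exp.mpr (by exact_mod_cast hs.M_le_rounds z)
  -- the capped counts on the misclassified examples
  have hL : ∀ z ∈ B, (t : ℝ) / 2 - ((t - s.vote z.1 * sgn z.2) / 2 - s.M z) ≤ s.M z := by
    intro z hz
    have hz' : voteHyp s.vote z.1 ≠ z.2 := hz
    have h1 : s.vote z.1 * sgn z.2 ≤ 0 := by
      rcases hb : z.2 with _ | _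
      · rw [hb] at hz'
        simp only [voteHyp, ne_eq, Bool.not_eq_false, decide_eq_true_eq] at hz'
        have : sgn false = -1 := by simp [sgn]
        rw [this]; linarith
      · rw [hb] at hz'
        simp only [voteHyp, ne_eq, Bool.not_eq_true, decide_eq_false_iff_not, not_le] at hz'
        simpa [sgn] using hz'.le
    linarith
  have hloss : ∫ z in B, ((t - s.vote z.1 * sgn z.2) / 2 - s.M z) ∂P ≤ t * (ε / 8) :=
    (setIntegral_le_integral hs.integrable_loss (ae_of_all _ fun z =>
      sub_nonneg.mpr (hs.le_errors z))).trans hs.loss_le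
  have hMB : β * t / 2 - t * (ε / 8) ≤ ∫ z in B, (s.M z : ℝ) ∂P := by
    have h1 : ∫ z in B, ((t : ℝ) / 2 - ((t - s.vote z.1 * sgn z.2) / 2 - s.M z)) ∂P ≤
        ∫ z in B, (s.M z : ℝ) ∂P :=
      setIntegral_mono_on ((integrable_const _).sub hs.integrable_loss).integrableOn
        hMint.integrableOn hB hL
    rw [integral_sub (integrable_const _) hs.integrable_loss.integrableOn, setIntegral_const,
      smul_eq_mul, hβB] at h1
    linarith
  -- Jensen's inequality on `B`, by means of the tangent of `exp` at `x`.
  have hexp : Real.exp x * (β + (∫ z in B, (s.M z : ℝ) ∂P) - x * β) ≤ Real.exp (t / 4) := by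
    have h1 : ∫ z in B, Real.exp x * (1 + ((s.M z : ℝ) - x)) ∂P ≤ ∫ z in B, Real.exp (s.M z) ∂P := by
      refine setIntegral_mono_on (((integrable_const _).add
        (hMint.sub (integrable_const _))).const_mul _).integrableOn hexpM.integrableOn hB
        fun z _ => ?_
      have h2 := Real.add_one_le_exp ((s.M z : ℝ) - x)
      calc _ ≤ Real.exp x * Real.exp ((s.M z : ℝ) - x) :=
            mul_le_mul_of_nonneg_left (by linarith) (Real.exp_pos _).le
        _ = _ := by rw [← Real.exp_add]; congr 1; ring
    have h3 : ∫ z in B, Real.exp x * (1 + ((s.M z : ℝ) - x)) ∂P =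
        Real.exp x * (β + (∫ z in B, (s.M z : ℝ) ∂P) - x * β) := by
      have hi : IntegrableOn (fun z => (s.M z : ℝ) - x) B P :=
        (hMint.sub (integrable_const _)).integrableOn
      rw [integral_const_mul, integral_add (integrable_const _) hi,
        integral_sub hMint.integrableOn (integrable_const _), setIntegral_const,
        setIntegral_const, hβB]
      simp only [smul_eq_mul]; ring
    rw [← h3]
    exact h1.trans ((setIntegral_le_integral hexpM (ae_of_all _ fun z =>
      (Real.exp_pos _).le)).trans hs.exp_le)
  have h4 : Real.exp x * β ≤ Real.exp (t / 4) := by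
    refine le_trans (mul_le_mul_of_nonneg_left ?_ (Real.exp_pos _).le) hexp
    have : (t : ℝ) * ε ≤ t * β := by gcongr
    rw [hx]; linarith
  have h5 : Real.exp x = Real.exp (t / 4) * Real.exp (t / 8) := by
    rw [← Real.exp_add]; congr 1; rw [hx]; ring
  have h6 : 2 / ε ≤ Real.exp (t / 8) := by
    rw [← Real.exp_log (by positivity : 0 < 2 / ε)]
    exact Real.exp_le_exp.mpr (by linarith)
  rw [h5] at h4
  have h7 : Real.exp (t / 8) * β ≤ 1 := by
    have h8 := Real.exp_pos ((t : ℝ) / 4)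
    by_contra hc
    push Not at hc
    nlinarith
  have h9 : 2 / ε * ε ≤ Real.exp (t / 8) * β := by gcongr
  rw [div_mul_cancel₀ _ hε.ne'] at h9
  linarith

end MetaInvariant

theorem measurePreserving_prod_sum {Z : Type*} [MeasurableSpace Z] {T a b : ℕ}
    (P : Measure Z) [IsProbabilityMeasure P] (t : Fin T) :
    MeasurePreserving (fun S : Fin T × (Fin a ⊕ Fin b) → Z =>
      ((fun i => S (t, .inl i)), (fun i => S (t, .inr i)))) (Measure.pi fun _ => P)
      ((Measure.pi fun _ : Fin a => P).prod (Measure.pi fun _ : Fin b => P)) :=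
  (measurePreserving_sumPiEquivProdPi (fun _ : Fin a ⊕ Fin b => P)).comp
    (measurePreserving_comp_injective (fun _ => P) (fun i : Fin a ⊕ Fin b => (t, i))
      (Prod.mk_right_injective t))

/-! ### The run of `rMetaBoost` with an abstract learner, and its failure probability. -/

section MetaProcess

variable {X R : Type*} {T m a b : ℕ}

/-- The state of `rMetaBoost`, apart from the number of calls, after `k` rounds. -/
def metaRun (ε : ℝ) (A : (Fin m → X × Bool) → R → X → Bool)
    (S : Fin T × (Fin a ⊕ Fin b) → X × Bool) (r : Fin T → (Fin a → I) × R × I) (k : ℕ) :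
    MetaState X :=
  iterRounds (fun s t => metaRound ε A s (fun i => S (t, .inl i)) (fun i => S (t, .inr i)) (r t))
    ⟨fun _ => 0, 0, fun _ => 0, false, 0⟩ k

theorem metaRun_succ (ε : ℝ) (A : (Fin m → X × Bool) → R → X → Bool)
    (S : Fin T × (Fin a ⊕ Fin b) → X × Bool) (r : Fin T → (Fin a → I) × R × I) (t : Fin T) :
    metaRun ε A S r (t + 1) = metaRound ε A (metaRun ε A S r t) (fun i => S (t, .inl i))
      (fun i => S (t, .inr i)) (r t) := by
  unfold metaRun
  rw [iterRounds_succ]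

theorem metaRun_congr {ε : ℝ} {A : (Fin m → X × Bool) → R → X → Bool}
    {S S' : Fin T × (Fin a ⊕ Fin b) → X × Bool} {r r' : Fin T → (Fin a → I) × R × I} {t : Fin T}
    (hS : ∀ i, i.1 ≠ t → S i = S' i) (hr : ∀ i, i ≠ t → r i = r' i) :
    metaRun ε A S r t = metaRun ε A S' r' t := by
  refine iterRounds_congr _ t.2.le t.2.le fun k hk s => ?_
  have hne : (⟨k, hk.trans t.2⟩ : Fin T) ≠ t := Fin.ne_of_lt hk
  rw [hr _ hne]
  congr 1
  · funext i; exact hS _ hne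
  · funext i; exact hS _ hne

theorem metaRun_M_le (ε : ℝ) (A : (Fin m → X × Bool) → R → X → Bool)
    (S : Fin T × (Fin a ⊕ Fin b) → X × Bool) (r : Fin T → (Fin a → I) × R × I) (k : ℕ)
    (z : X × Bool) : (metaRun ε A S r k).M z ≤ (metaRun ε A S r k).c := by
  induction k generalizing z with
  | zero => exact le_rfl
  | succ k ih =>
    by_cases hk : k < T
    · have e := metaRun_succ ε A S r ⟨k, hk⟩
      simp only at e
      rw [e]
      exact metaRound_M_le ih _ _ _ z
    · have e : metaRun ε A S r (k + 1) = metaRun ε A S r k := by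
        unfold metaRun; rw [iterRounds, dif_neg hk]
      rw [e]; exact ih z

variable [MeasurableSpace X] [MeasurableSpace R] {ε β δ : ℝ} {f : X → Bool} {ν : Measure R}
  {A : (Fin m → X × Bool) → R → X → Bool}
  {agree : R → (Fin m → X × Bool) → (Fin m → X × Bool) → Prop}

theorem measurable_metaRun (ε : ℝ)
    (hA : Measurable fun q : ((Fin m → X × Bool) × R) × X => A q.1.1 q.1.2 q.2)
    {Θ : Type*} [MeasurableSpace Θ] {S : Θ → Fin T × (Fin a ⊕ Fin b) → X × Bool}
    (hS : Measurable S) {r : Θ → Fin T → (Fin a → I) × R × I} (hr : Measurable r) (k : ℕ) :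
    MeasurableMeta fun θ => metaRun ε A (S θ) (r θ) k := by
  induction k with
  | zero => exact ⟨measurable_const, measurable_const, measurable_const, measurable_const⟩
  | succ k ih =>
    by_cases hk : k < T
    · have e : ∀ θ, metaRun ε A (S θ) (r θ) (k + 1) = _ :=
        fun θ => metaRun_succ ε A (S θ) (r θ) ⟨k, hk⟩
      simp only [e]
      refine ih.metaRound ε hA ?_ ?_ ?_
      · fun_prop
      · fun_prop
      · exact (measurable_pi_apply _).comp hr
    · have e : ∀ θ, metaRun ε A (S θ) (r θ) (k + 1) = metaRun ε A (S θ) (r θ) k := by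
        intro θ; unfold metaRun; rw [iterRounds, dif_neg hk]
      simp only [e]; exact ih

/-- Violations of the specification of a round of `rMetaBoost`. -/
def metaBad (P : Measure (X × Bool)) (ε β : ℝ) (A : (Fin m → X × Bool) → R → X → Bool)
    (agree : R → (Fin m → X × Bool) → (Fin m → X × Bool) → Prop) (t : Fin T) :
    Set (((Fin T × (Fin a ⊕ Fin b) → X × Bool) × (Fin T × (Fin a ⊕ Fin b) → X × Bool)) ×
      (Fin T → (Fin a → I) × R × I)) :=
  {ω | ε / 32 ≤ ∫ z, metaWeight (metaRun ε A ω.1.1 ω.2 t) z ∂P ∧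
    ¬ MetaSpec P ε β A agree (metaRun ε A ω.1.1 ω.2 t)
      (fun i => ω.1.1 (t, .inl i)) (fun i => ω.1.2 (t, .inl i))
      (fun i => ω.1.1 (t, .inr i)) (fun i => ω.1.2 (t, .inr i)) (ω.2 t)}

/-- If no round violates its specification, then the two runs agree, and are accurate. -/
theorem metaRun_eq_and_lawErr_le {P : Measure (X × Bool)} [IsProbabilityMeasure P]
    (hA : IsLearner f ν A agree δ β) (hβ : β ≤ 1 / 8) (hε : 0 < ε) (hε1 : ε ≤ 1)
    (hT : 8 * Real.log (2 / ε) ≤ T)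
    {ω : ((Fin T × (Fin a ⊕ Fin b) → X × Bool) × (Fin T × (Fin a ⊕ Fin b) → X × Bool)) ×
      (Fin T → (Fin a → I) × R × I)} (hω : ∀ t, ω ∉ metaBad P ε β A agree t) :
    metaRun ε A ω.1.1 ω.2 T = metaRun ε A ω.1.2 ω.2 T ∧
      lawErr P (voteHyp (metaRun ε A ω.1.1 ω.2 T).vote) ≤ ε := by
  have hAS : ∀ S r, Measurable (A S r) :=
    fun S r => hA.measurable_eval.comp (measurable_prodMk_left (x := (S, r)))
  have key : ∀ k, k ≤ T → metaRun ε A ω.1.1 ω.2 k = metaRun ε A ω.1.2 ω.2 k ∧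
      MetaInv P ε k (metaRun ε A ω.1.1 ω.2 k) := by
    intro k
    induction k with
    | zero => exact fun _ => ⟨rfl, MetaInv.init hε1⟩
    | succ k ih =>
      intro hk
      obtain ⟨h1, h2⟩ := ih (Nat.le_of_succ_le hk)
      have e1 := metaRun_succ ε A ω.1.1 ω.2 ⟨k, hk⟩
      have e2 := metaRun_succ ε A ω.1.2 ω.2 ⟨k, hk⟩
      simp only at e1 e2
      rw [e1, e2, ← h1]
      have hspec := hω ⟨k, hk⟩
      simp only [metaBad, mem_ofPred_eq, not_and, not_not] at hspec
      exact h2.metaRound hβ hε hAS hA.eq_of_agree (hspec h2.density_ge)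
  obtain ⟨h1, h2⟩ := key T le_rfl
  exact ⟨h1, h2.lawErr_le hε hT⟩

theorem measurableSet_metaBad {P : Measure (X × Bool)} [IsProbabilityMeasure P]
    (hA : IsLearner f ν A agree δ β) (t : Fin T) :
    MeasurableSet (metaBad (a := a) (b := b) P ε β A agree t) := by
  have hs := measurable_metaRun (T := T) (a := a) (b := b) ε hA.measurable_eval
    (S := fun ω : ((Fin T × (Fin a ⊕ Fin b) → X × Bool) × (Fin T × (Fin a ⊕ Fin b) → X × Bool)) ×
      (Fin T → (Fin a → I) × R × I) => ω.1.1) (by fun_prop) (r := fun ω => ω.2) measurable_snd t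
  have hq : Measurable fun ω : ((Fin T × (Fin a ⊕ Fin b) → X × Bool) ×
      (Fin T × (Fin a ⊕ Fin b) → X × Bool)) × (Fin T → (Fin a → I) × R × I) => ω.2 t :=
    (measurable_pi_apply t).comp measurable_snd
  refine measurableSet_setOfPred.mpr (Measurable.and ?_ (Measurable.not (Measurable.and ?_ ?_)))
  · exact measurableSet_setOfPred.mp (measurableSet_le measurable_const
      (measurable_integral_weight P hs.weight))
  · exact measurableSet_setOfPred.mp (measurableSet_callSpec hA P hs.weight (by fun_prop)
      (by fun_prop) (by fun_prop) (by fun_prop))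
  · exact measurable_metaThreshold P ε hA.measurable_eval hs (by fun_prop) (by fun_prop)
      (by fun_prop) hq

/-- Replace the examples and seeds of a round. -/
def metaResample (t : Fin T)
    (p : (((Fin T × (Fin a ⊕ Fin b) → X × Bool) × (Fin T × (Fin a ⊕ Fin b) → X × Bool)) ×
      (Fin T → (Fin a → I) × R × I)) × (((Fin T × (Fin a ⊕ Fin b) → X × Bool) ×
      (Fin T × (Fin a ⊕ Fin b) → X × Bool)) × (Fin T → (Fin a → I) × R × I))) :
    ((Fin T × (Fin a ⊕ Fin b) → X × Bool) × (Fin T × (Fin a ⊕ Fin b) → X × Bool)) ×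
      (Fin T → (Fin a → I) × R × I) :=
  (((fun i => if i.1 = t then p.2.1.1 i else p.1.1.1 i),
    (fun i => if i.1 = t then p.2.1.2 i else p.1.1.2 i)),
    fun i => if i = t then p.2.2 i else p.1.2 i)

/-- The law of the seeds of a loop with independent rounds. -/
def loopSeedLaw (T a : ℕ) (ν : Measure R) : Measure (Fin T → (Fin a → I) × R × I) :=
  Measure.pi fun _ => (Measure.pi fun _ => volume).prod (ν.prod volume)

instance [IsProbabilityMeasure ν] : IsProbabilityMeasure (loopSeedLaw T a ν) := by
  unfold loopSeedLaw; infer_instance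

theorem measurePreserving_metaResample [IsProbabilityMeasure ν] (P : Measure (X × Bool))
    [IsProbabilityMeasure P] (t : Fin T) :
    MeasurePreserving (metaResample (a := a) (b := b) (X := X) (R := R) t)
      ((((Measure.pi fun _ => P).prod (Measure.pi fun _ => P)).prod
        (loopSeedLaw T a ν)).prod (((Measure.pi fun _ => P).prod
        (Measure.pi fun _ => P)).prod (loopSeedLaw T a ν)))
      (((Measure.pi fun _ => P).prod (Measure.pi fun _ => P)).prod (loopSeedLaw T a ν)) := by
  have h1 := measurePreserving_resample (fun _ : Fin T × (Fin a ⊕ Fin b) => P) (fun i => i.1 = t)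
  have h2 := measurePreserving_resample (fun _ : Fin T =>
    (Measure.pi fun _ : Fin a => (volume : Measure I)).prod
      (ν.prod (volume : Measure I))) (fun i => i = t)
  exact measurePreserving_prod_resample (measurePreserving_prod_resample h1 h1) h2

/-- The threshold check of a round of `rMetaBoost` rarely violates its specification. -/
theorem measure_not_metaThreshold_le [IsProbabilityMeasure ν] (P : Measure (X × Bool))
    [IsProbabilityMeasure P]
    (hA : Measurable fun q : ((Fin m → X × Bool) × R) × X => A q.1.1 q.1.2 q.2) (hε : 0 < ε)
    {η τ : ℝ} (hη0 : 0 ≤ η) (hη1 : η ≤ 1 / 8)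
    (hτ : 6 * η + 4 * Real.exp (-(b * η ^ 2 * (ε / 16) / 4)) ≤ τ) {s : MetaState X}
    (hs : Measurable s.M) :
    ((((Measure.pi fun _ : Fin a => P).prod (Measure.pi fun _ : Fin b => P)).prod
      ((Measure.pi fun _ : Fin a => P).prod (Measure.pi fun _ : Fin b => P))).prod
      ((Measure.pi fun _ : Fin a => (volume : Measure I)).prod (ν.prod (volume : Measure I))))
      {p | ¬ ∀ SW, rejectionSampler (metaWeight s) m p.1.1.1 p.2.1 = some SW →
        ThresholdSpec (ε / 16) (∫ z, overflow s.M s.c (A SW p.2.2.1) z ∂P)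
        (rThreshold p.1.1.2 (ε / 16) (overflow s.M s.c (A SW p.2.2.1)) p.2.2.2)
        (rThreshold p.1.2.2 (ε / 16) (overflow s.M s.c (A SW p.2.2.1)) p.2.2.2)} ≤
      ENNReal.ofReal τ := by
  set PA := Measure.pi fun _ : Fin a => P
  set PB := Measure.pi fun _ : Fin b => P
  set V := Measure.pi fun _ : Fin a => (volume : Measure I)
  set E : Set (((Fin a → X × Bool) × ((Fin a → I) × R)) ×
      (((Fin b → X × Bool) × (Fin b → X × Bool)) × I)) :=
    {p | ¬ ∀ SW, rejectionSampler (metaWeight s) m p.1.1 p.1.2.1 = some SW →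
      ThresholdSpec (ε / 16) (∫ z, overflow s.M s.c (A SW p.1.2.2) z ∂P)
      (rThreshold p.2.1.1 (ε / 16) (overflow s.M s.c (A SW p.1.2.2)) p.2.2)
      (rThreshold p.2.1.2 (ε / 16) (overflow s.M s.c (A SW p.1.2.2)) p.2.2)}
  -- The function tested by the check depends on the hypothesis of the round. The data that
  -- determine it are grouped first; the examples and the level of the check are independent of
  -- them, so the bound for a fixed function can be integrated.
  have hmp : MeasurePreserving (fun p : (((Fin a → X × Bool) × (Fin b → X × Bool)) ×
      ((Fin a → X × Bool) × (Fin b → X × Bool))) × ((Fin a → I) × R × I) =>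
      ((p.1.1.1, (p.2.1, p.2.2.1)), ((p.1.1.2, p.1.2.2), p.2.2.2)))
      (((PA.prod PB).prod (PA.prod PB)).prod (V.prod (ν.prod volume)))
      ((PA.prod (V.prod ν)).prod ((PB.prod PB).prod volume)) := by
    have h1 := (measurePreserving_prodAssoc PA PB PB).comp
      ((MeasurePreserving.id (PA.prod PB)).prod (measurePreserving_snd (μ := PA) (ν := PB)))
    have h2 := (measurePreserving_prodAssoc V ν (volume : Measure I)).symm
    exact (measurePreserving_prod_prod_prod_comm PA (PB.prod PB) (V.prod ν) volume).comp
      (h1.prod h2)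
  refine (measure_preimage_le_of_measurePreserving hmp E).trans ?_
  have hsm : MeasurableMeta fun _ : ((Fin a → X × Bool) × ((Fin a → I) × R)) ×
      (((Fin b → X × Bool) × (Fin b → X × Bool)) × I) => (⟨s.M, s.c, fun _ => 0, false, 0⟩ :
      MetaState X) :=
    ⟨hs.comp measurable_snd, measurable_const, measurable_const, measurable_const⟩
  have hE : MeasurableSet E := by
    refine measurableSet_setOfPred.mpr (Measurable.not ?_)
    exact measurable_metaThreshold P ε hA hsm (v₁ := fun p => p.1.1) (by fun_prop)
      (w₁ := fun p => p.2.1.1) (w₂ := fun p => p.2.1.2) (by fun_prop) (by fun_prop)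
      (q := fun p => (p.1.2.1, p.1.2.2, p.2.2)) (by fun_prop)
  rw [Measure.prod_apply hE]
  calc _ ≤ ∫⁻ _, ENNReal.ofReal τ ∂(PA.prod (V.prod ν)) := lintegral_mono fun x => ?_
    _ = ENNReal.ofReal τ := by simp
  rcases ho : rejectionSampler (metaWeight s) m x.1 x.2.1 with _ | SW
  · have e : Prod.mk x ⁻¹' E = ∅ := by ext y; simp [E, ho]
    rw [e]; simp
  · have hm : Measurable (overflow s.M s.c (A SW x.2.2)) :=
      (measurable_overflow (Θ := Unit) (M := fun _ => s.M) (c := fun _ => s.c)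
        (h := fun _ => A SW x.2.2) (hs.comp measurable_snd) measurable_const
        (hA.comp (f := fun p : Unit × X => ((SW, x.2.2), p.2)) (by fun_prop))).comp
        (f := fun z : X × Bool => ((), z)) (by fun_prop)
    have h := (measure_not_thresholdSpec_le (n := b) P hm
      (fun z => by unfold overflow; split_ifs <;> norm_num)
      (fun z => by unfold overflow; split_ifs <;> norm_num) hη0 hη1
      (z := ε / 16) (by positivity)).trans (ENNReal.ofReal_le_ofReal hτ)
    refine (measure_mono ?_).trans h
    intro y hy
    simpa [E, ho] using hy

/-- The probability of violating the specification of a round of `rMetaBoost`. -/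
theorem measure_metaBad_le [IsProbabilityMeasure ν] (hA : IsLearner f ν A agree δ β) (hδ : 0 ≤ δ)
    (hε : 0 < ε) {κ η τ : ℝ} (hκ0 : 0 ≤ κ) (hτ0 : 0 ≤ τ) (hη0 : 0 ≤ η) (hη1 : η ≤ 1 / 8)
    (hκ : m = 0 ∨ (m ≤ a * (ε / 32) / 2 ∧ 2 * Real.exp (-(a * (ε / 32) / 16)) ≤ κ))
    (hτ : 6 * η + 4 * Real.exp (-(b * η ^ 2 * (ε / 16) / 4)) ≤ τ)
    {P : Measure (X × Bool)} (hP : IsLaw f P) (t : Fin T) :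
    (((Measure.pi fun _ => P).prod (Measure.pi fun _ => P)).prod (loopSeedLaw T a ν))
      (metaBad (b := b) P ε β A agree t) ≤ ENNReal.ofReal (2 * κ + 3 * δ + τ) := by
  have := hP.1
  set ℙ := ((Measure.pi fun _ : Fin T × (Fin a ⊕ Fin b) => P).prod
    (Measure.pi fun _ : Fin T × (Fin a ⊕ Fin b) => P)).prod (loopSeedLaw T a ν) with hℙ
  refine measure_le_of_resample (measurePreserving_metaResample P t)
    (measurableSet_metaBad hA t) fun ω => ?_
  set s := metaRun ε A ω.1.1 ω.2 t with hs
  have hrun : ∀ ω', metaRun ε A (metaResample t (ω, ω')).1.1 (metaResample t (ω, ω')).2 t = s := by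
    intro ω'
    exact metaRun_congr (fun i hi => by simp [metaResample, hi])
      (fun i hi => by simp [metaResample, hi])
  have hsub : {ω' | metaResample t (ω, ω') ∈ metaBad P ε β A agree t} =
      {ω' | ε / 32 ≤ ∫ z, metaWeight s z ∂P ∧ ¬ MetaSpec P ε β A agree s
        (fun i => ω'.1.1 (t, .inl i)) (fun i => ω'.1.2 (t, .inl i))
        (fun i => ω'.1.1 (t, .inr i)) (fun i => ω'.1.2 (t, .inr i)) (ω'.2 t)} := by
    ext ω'
    simp only [metaBad, mem_ofPred_eq, hrun]
    simp [metaResample]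
  rw [hsub]
  by_cases hden : ε / 32 ≤ ∫ z, metaWeight s z ∂P
  swap
  · simp [hden]
  have hMm : Measurable s.M := (measurable_metaRun (T := T) (a := a) (b := b) ε hA.measurable_eval
    (Θ := Unit) (S := fun _ => ω.1.1) measurable_const (r := fun _ => ω.2) measurable_const
    t).M.comp (f := fun z : X × Bool => ((), z)) (by fun_prop)
  have hwt := isWeight_metaWeight hMm (metaRun_M_le ε A ω.1.1 ω.2 t)
  have ha : 0 < ∫ z, metaWeight s z ∂P := by linarith
  have hsamp := measurePreserving_prod_sum (a := a) (b := b) P t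
  have hl := measurePreserving_fst.comp hsamp
  have hseed : MeasurePreserving (fun r : Fin T → (Fin a → I) × R × I => r t)
      (loopSeedLaw T a ν)
      ((Measure.pi fun _ : Fin a => (volume : Measure I)).prod (ν.prod (volume : Measure I))) :=
    measurePreserving_eval _ t
  have hseed1 := ((MeasurePreserving.id (Measure.pi fun _ : Fin a =>
    (volume : Measure I))).prod (measurePreserving_fst (μ := ν) (ν := (volume : Measure I)))).comp
    hseed
  have hcall := (measure_preimage_le_of_measurePreserving ((hl.prod hl).prod hseed1) _).trans
    (measure_not_callSpec_le hA hδ hP hwt ha hκ0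
      (measure_rejectionSampler_none_le' P hwt hden hκ))
  have hthr := (measure_preimage_le_of_measurePreserving ((hsamp.prod hsamp).prod hseed) _).trans
    (measure_not_metaThreshold_le (m := m) (A := A) P hA.measurable_eval hε hη0 hη1 hτ hMm)
  rw [ENNReal.ofReal_add (by positivity) hτ0]
  refine (measure_mono ?_).trans ((measure_union_le _ _).trans (add_le_add hcall hthr))
  rintro ω' ⟨-, h⟩
  by_contra hcon
  simp only [mem_union, not_or, mem_preimage, mem_ofPred_eq, not_not] at hcon
  exact h ⟨hcon.1, hcon.2⟩

/-- With high probability, two runs of `rMetaBoost` with the same seed agree, and are accurate. -/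
theorem measure_iUnion_metaBad_le [IsProbabilityMeasure ν] (hA : IsLearner f ν A agree δ β)
    (hδ : 0 ≤ δ) (hε : 0 < ε) {κ η τ : ℝ} (hκ0 : 0 ≤ κ) (hτ0 : 0 ≤ τ) (hη0 : 0 ≤ η)
    (hη1 : η ≤ 1 / 8)
    (hκ : m = 0 ∨ (m ≤ a * (ε / 32) / 2 ∧ 2 * Real.exp (-(a * (ε / 32) / 16)) ≤ κ))
    (hτ : 6 * η + 4 * Real.exp (-(b * η ^ 2 * (ε / 16) / 4)) ≤ τ) {ρ : ℝ}
    (hρ : T * (2 * κ + 3 * δ + τ) ≤ ρ) {P : Measure (X × Bool)} (hP : IsLaw f P) :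
    (((Measure.pi fun _ => P).prod (Measure.pi fun _ => P)).prod (loopSeedLaw T a ν))
      (⋃ t, metaBad (T := T) (b := b) P ε β A agree t) ≤ ENNReal.ofReal ρ := by
  have := hP.1
  refine (measure_iUnion_fintype_le _ _).trans ((Finset.sum_le_sum fun (t : Fin T) _ =>
    measure_metaBad_le (t := t) hA hδ hε hκ0 hτ0 hη0 hη1 hκ hτ hP).trans ?_)
  rw [Finset.sum_const, Finset.card_univ, Fintype.card_fin, ← ENNReal.ofReal_nsmul]
  refine ENNReal.ofReal_le_ofReal ?_
  rwa [nsmul_eq_mul]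

end MetaProcess

/-! ### `rMetaBoost` with `rBoost*` as its learner. -/

section MetaBoost

variable {X R : Type*} {K : ℕ} {ρ ε γ : ℝ} {m : ℕ}

/-- The calls to `rBoost*` in `rMetaBoost`. -/
def subBoost (K : ℕ) (ρ ε γ : ℝ) {m : ℕ} (W : (Fin m → X × Bool) → R → X → Bool)
    (S : Fin (Fintype.card (SubIdx K ρ ε γ m)) → X × Bool)
    (r : BoostSeed K (subRho ρ ε) (1 / 16) γ m R) : X → Bool :=
  (rBoostStar K (subRho ρ ε) (1 / 16) γ W
    (fun i => S (Fintype.equivFin (SubIdx K ρ ε γ m) i)) r).1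

/-- The call count is erased because an abstract learner returns a hypothesis only; no other
variable depends on that count. -/
theorem metaStep_eq (W : (Fin m → X × Bool) → R → X → Bool)
    (S : MetaIdx K ρ ε γ m → X × Bool) (r : MetaSeed K ρ ε γ m R) (s : MetaState X)
    (t : Fin (metaRounds ε)) :
    { metaStep K ρ ε γ W S r s t with calls := 0 } =
      metaRound ε (subBoost K ρ ε γ W) { s with calls := 0 } (fun i => S (t, .inl i))
        (fun i => S (t, .inr i)) (r t) := by
  unfold metaStep metaRound metaUpdate metaWeight
  split_ifs with h
  · rfl
  · dsimp only
    rcases rejectionSampler (fun z => Real.exp ((s.M z : ℝ) - s.c))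
      (Fintype.card (SubIdx K ρ ε γ m)) (fun i => S (t, .inl i)) (r t).1 with _ | SW <;> rfl

theorem metaStep_calls_le (W : (Fin m → X × Bool) → R → X → Bool)
    (S : MetaIdx K ρ ε γ m → X × Bool) (r : MetaSeed K ρ ε γ m R) (s : MetaState X)
    (t : Fin (metaRounds ε)) :
    (metaStep K ρ ε γ W S r s t).calls ≤ s.calls + boostRounds (1 / 16) γ := by
  unfold metaStep
  split_ifs
  · exact Nat.le_add_right _ _
  · dsimp only
    split
    · exact Nat.le_add_right _ _
    · exact Nat.add_le_add_left (rBoostStar_calls_le _ _ _) _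

theorem rMetaBoost_eq (W : (Fin m → X × Bool) → R → X → Bool)
    (S : MetaIdx K ρ ε γ m → X × Bool) (r : MetaSeed K ρ ε γ m R) :
    (rMetaBoost K ρ ε γ W S r).1 =
      voteHyp (metaRun ε (subBoost K ρ ε γ W) S r (metaRounds ε)).vote := by
  have h : ∀ k, { iterRounds (metaStep K ρ ε γ W S r) ⟨fun _ => 0, 0, fun _ => 0, false, 0⟩ k with
      calls := 0 } = metaRun ε (subBoost K ρ ε γ W) S r k := by
    intro k
    induction k with
    | zero => rfl
    | succ k ih =>
      unfold metaRun at ih ⊢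
      by_cases hk : k < metaRounds ε
      · rw [iterRounds, iterRounds, dif_pos hk, dif_pos hk, ← ih, metaStep_eq]
      · rw [iterRounds, iterRounds, dif_neg hk, dif_neg hk, ih]
  unfold rMetaBoost
  rw [foldl_eq_iterRounds, ← h]
  rfl

/-- The call count of `rMetaBoost`. -/
theorem rMetaBoost_calls_le (W : (Fin m → X × Bool) → R → X → Bool)
    (S : MetaIdx K ρ ε γ m → X × Bool) (r : MetaSeed K ρ ε γ m R) :
    (rMetaBoost K ρ ε γ W S r).2 ≤ metaRounds ε * boostRounds (1 / 16) γ := by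
  have h : ∀ k, (iterRounds (metaStep K ρ ε γ W S r) ⟨fun _ => 0, 0, fun _ => 0, false, 0⟩
      k).calls ≤ k * boostRounds (1 / 16) γ := by
    intro k
    induction k with
    | zero => simp [iterRounds]
    | succ k ih =>
      rw [iterRounds, Nat.succ_mul]
      split_ifs
      · exact (metaStep_calls_le _ _ _ _ _).trans (Nat.add_le_add_right ih _)
      · exact ih.trans (Nat.le_add_right _ _)
  unfold rMetaBoost
  rw [foldl_eq_iterRounds]
  exact h _

variable [MeasurableSpace X] [MeasurableSpace R] {f : X → Bool} {ν : Measure R}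
  [IsProbabilityMeasure ν] {W : (Fin m → X × Bool) → R → X → Bool}

/-- Replicability and accuracy of `rMetaBoost`, given bounds for the failures of its parts. -/
theorem rMetaBoost_replicable_and_accurate (hf : Measurable f) {δ β : ℝ}
    {agree : BoostSeed K (subRho ρ ε) (1 / 16) γ m R →
      (SubIdx K ρ ε γ m → X × Bool) → (SubIdx K ρ ε γ m → X × Bool) → Prop}
    (hA : IsLearner f (boostSeedLaw K (subRho ρ ε) (1 / 16) γ m ν)
      (fun S r => (rBoostStar K (subRho ρ ε) (1 / 16) γ W S r).1) agree δ β)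
    (hβ : β ≤ 1 / 8) (hδ : 0 ≤ δ) (hε : 0 < ε) (hε1 : ε ≤ 1) {κ η τ : ℝ} (hκ0 : 0 ≤ κ)
    (hτ0 : 0 ≤ τ) (hη0 : 0 ≤ η) (hη1 : η ≤ 1 / 8)
    (hκ : Fintype.card (SubIdx K ρ ε γ m) = 0 ∨
      (Fintype.card (SubIdx K ρ ε γ m) ≤ metaDraw K ρ ε γ m * (ε / 32) / 2 ∧
        2 * Real.exp (-(metaDraw K ρ ε γ m * (ε / 32) / 16)) ≤ κ))
    (hτ : 6 * η + 4 * Real.exp (-(metaCheck K ρ ε * η ^ 2 * (ε / 16) / 4)) ≤ τ)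
    (hρ : metaRounds ε * (2 * κ + 3 * δ + τ) ≤ ρ) (D : Measure X) [IsProbabilityMeasure D] :
    IsReplicable (labelled D f) (metaSeedLaw K ρ ε γ m ν)
      (fun S r => (rMetaBoost K ρ ε γ W S r).1) ρ ∧
    ((Measure.pi fun _ : MetaIdx K ρ ε γ m => labelled D f).prod (metaSeedLaw K ρ ε γ m ν))
      {ω | ε < er D f (rMetaBoost K ρ ε γ W ω.1 ω.2).1} ≤ ENNReal.ofReal ρ := by
  have hP := isLaw_labelled hf D
  have := hP.1
  have hA' : IsLearner f _ (subBoost K ρ ε γ W) _ δ β :=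
    hA.reindex (Fintype.equivFin (SubIdx K ρ ε γ m))
  have hbad := measure_iUnion_metaBad_le hA' hδ hε hκ0 hτ0 hη0 hη1 hκ hτ hρ hP
  have hgood := fun ω hω => metaRun_eq_and_lawErr_le (T := metaRounds ε) (a := metaDraw K ρ ε γ m)
    (b := metaCheck K ρ ε) (P := labelled D f) (ω := ω) hA' hβ hε hε1
    (Nat.le_ceil _ : 8 * Real.log (2 / ε) ≤ metaRounds ε) hω
  have heval : Measurable fun q : ((MetaIdx K ρ ε γ m → X × Bool) × MetaSeed K ρ ε γ m R) × X =>
      (rMetaBoost K ρ ε γ W q.1.1 q.1.2).1 q.2 := by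
    simp only [rMetaBoost_eq]
    refine measurable_decide (measurableSet_le measurable_const ?_)
    exact (measurable_metaRun (T := metaRounds ε) (a := metaDraw K ρ ε γ m) (b := metaCheck K ρ ε)
      ε hA'.measurable_eval (S := fun q : (MetaIdx K ρ ε γ m → X × Bool) × MetaSeed K ρ ε γ m R =>
      q.1) measurable_fst (r := fun q => q.2) measurable_snd _).vote
  refine ⟨(measure_mono fun ω hω => ?_).trans hbad, ?_⟩
  · by_contra hc
    simp only [mem_iUnion, not_exists] at hc
    refine hω ?_
    simp only [rMetaBoost_eq]
    rw [(hgood ω hc).1]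
  · have hmp : MeasurePreserving (fun ω : ((MetaIdx K ρ ε γ m → X × Bool) ×
        (MetaIdx K ρ ε γ m → X × Bool)) × MetaSeed K ρ ε γ m R => (ω.1.1, ω.2))
        (((Measure.pi fun _ => labelled D f).prod (Measure.pi fun _ => labelled D f)).prod
          (loopSeedLaw _ _ (boostSeedLaw K (subRho ρ ε) (1 / 16) γ m ν)))
        ((Measure.pi fun _ => labelled D f).prod (metaSeedLaw K ρ ε γ m ν)) :=
      measurePreserving_fst.prod (MeasurePreserving.id _)
    have hh : ∀ S r, Measurable (rMetaBoost K ρ ε γ W S r).1 := fun S r =>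
      heval.comp (f := fun x : X => ((S, r), x)) (by fun_prop)
    simp_rw [← lawErr_labelled hf (hh _ _)]
    have hset : MeasurableSet {q : (MetaIdx K ρ ε γ m → X × Bool) × MetaSeed K ρ ε γ m R |
        ε < lawErr (labelled D f) (rMetaBoost K ρ ε γ W q.1 q.2).1} :=
      measurableSet_lt measurable_const (measurable_lawErr _ heval)
    refine (hmp.measure_preimage hset.nullMeasurableSet).symm.le.trans ?_
    refine (measure_mono fun ω hω => ?_).trans hbad
    by_contra hc
    simp only [mem_iUnion, not_exists] at hc
    have h := (hgood ω hc).2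
    rw [← rMetaBoost_eq] at h
    exact absurd h (not_le.mpr hω)

end MetaBoost

/-! ### Numerical parameters, sample complexity and number of calls. -/

section Parameters

/-- Through this the logarithmic factors of the sample sizes become polynomially small failure
probabilities. -/
theorem exp_neg_le_pow {x y : ℝ} {N : ℕ} (hx : 0 < x) (hy : N * Real.log (1 / x) ≤ y) :
    Real.exp (-y) ≤ x ^ N := by
  rw [one_div, Real.log_inv] at hy
  calc Real.exp (-y) ≤ Real.exp (N * Real.log x) := Real.exp_le_exp.mpr (by linarith)
    _ = x ^ N := by rw [← Real.log_pow, Real.exp_log (by positivity)]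

theorem natCeil_le_add_one {x y : ℝ} (hxy : x ≤ y) (hy : 0 ≤ y) : (⌈x⌉₊ : ℝ) ≤ y + 1 :=
  (Nat.cast_le.mpr (Nat.ceil_mono hxy)).trans (Nat.ceil_lt_add_one hy).le

variable {K : ℕ} {ρ ε γ : ℝ} {m : ℕ}

theorem boostRounds_sixteenth_le (hγ0 : 0 < γ) (hγ : γ < 1 / 2) :
    (boostRounds (1 / 16) γ : ℝ) ≤ 4097 / γ ^ 2 := by
  have h1 : 256 / (1 / 16 * γ ^ 2) = 4096 / γ ^ 2 := by field_simp; norm_num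
  have h2 : (1 : ℝ) ≤ 1 / γ ^ 2 := by
    rw [le_div_iff₀ (by positivity)]; nlinarith
  have h3 : 4097 / γ ^ 2 = 4096 / γ ^ 2 + 1 / γ ^ 2 := by ring
  unfold boostRounds
  rw [h1, h3]
  exact (natCeil_le_add_one le_rfl (by positivity)).trans (by linarith)

/-- The number of threshold checks in a call to `rBoost*` is small. -/
theorem sum_isCheckRound_le (hγ0 : 0 < γ) (hγ : γ < 1 / 2) {τ : ℝ} (hτ : 0 ≤ τ) :
    ∑ t : Fin (boostRounds (1 / 16) γ), (if IsCheckRound γ t then τ else 0) ≤ 8194 / γ * τ := by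
  have h2 : 2 ≤ 1 / γ := by rw [le_div_iff₀ hγ0]; linarith
  -- Rounding loses at most half, as `1 / γ ≥ 2`.
  have hq : 1 / (2 * γ) ≤ (⌊1 / γ⌋₊ : ℝ) := by
    have h1 := Nat.lt_floor_add_one (1 / γ)
    have h3 : 1 / (2 * γ) = 1 / γ / 2 := by field_simp
    linarith
  rw [Fin.sum_univ_eq_sum_range (fun t => if IsCheckRound γ t then τ else 0), ← Finset.sum_filter,
    Finset.sum_const, Nat.card_multiples, nsmul_eq_mul]
  refine mul_le_mul_of_nonneg_right ?_ hτ
  calc ((boostRounds (1 / 16) γ / ⌊1 / γ⌋₊ : ℕ) : ℝ)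
      ≤ (boostRounds (1 / 16) γ : ℝ) / (⌊1 / γ⌋₊ : ℝ) := Nat.cast_div_le
    _ ≤ (4097 / γ ^ 2) / (1 / (2 * γ)) := by
        gcongr
        exact boostRounds_sixteenth_le hγ0 hγ
    _ = 8194 / γ := by field_simp; norm_num

theorem half_lt_log (hε0 : 0 < ε) (hε : ε < 1) : 69 / 100 < Real.log (2 / ε) := by
  have h1 := Real.log_two_gt_d9
  have h2 : Real.log 2 ≤ Real.log (2 / ε) :=
    Real.log_le_log (by norm_num) (by rw [le_div_iff₀ hε0]; linarith)
  linarith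

theorem metaRounds_bounds (hε0 : 0 < ε) (hε : ε < 1) :
    (6 : ℝ) ≤ metaRounds ε ∧ (metaRounds ε : ℝ) ≤ 10 * Real.log (2 / ε) := by
  have h := half_lt_log hε0 hε
  constructor
  · have h1 : 5 < metaRounds ε := by
      unfold metaRounds
      rw [Nat.lt_ceil]; push_cast; linarith
    exact_mod_cast h1
  · have := natCeil_le_add_one (le_refl (8 * Real.log (2 / ε))) (by positivity)
    unfold metaRounds
    linarith

theorem subRho_bounds (hρ0 : 0 < ρ) (hρ : ρ < 1) (hε0 : 0 < ε) (hε : ε < 1) :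
    0 < subRho ρ ε ∧ subRho ρ ε ≤ 1 / 36 := by
  obtain ⟨hT, -⟩ := metaRounds_bounds hε0 hε
  unfold subRho
  refine ⟨by positivity, ?_⟩
  rw [div_le_div_iff₀ (by positivity) (by norm_num)]
  linarith

/-- A fourth power leaves the factor `x γ²`, enough for a union bound over `O(1/γ²)` rounds. -/
theorem four_mul_pow_le {x γ : ℝ} (hx0 : 0 < x) (hx : x ≤ 1 / 36) (hγ0 : 0 < γ) (hγ : γ < 1 / 2) :
    (x * (1 / 16) * γ) ^ 4 ≤ x * γ ^ 2 / 10 ^ 9 := by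
  have h1 : x ^ 3 ≤ (1 / 36) ^ 3 := by gcongr
  have h2 : γ ^ 2 ≤ (1 / 2) ^ 2 := by gcongr
  have h3 : x ^ 3 * γ ^ 2 ≤ (1 / 36) ^ 3 * (1 / 2) ^ 2 := by gcongr
  have h4 := mul_le_mul_of_nonneg_left h3 (by positivity : 0 ≤ x * γ ^ 2 / 16 ^ 4)
  have h5 : 0 < x * γ ^ 2 := by positivity
  calc (x * (1 / 16) * γ) ^ 4 = x * γ ^ 2 / 16 ^ 4 * (x ^ 3 * γ ^ 2) := by ring
    _ ≤ x * γ ^ 2 / 16 ^ 4 * ((1 / 36) ^ 3 * (1 / 2) ^ 2) := h4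
    _ ≤ x * γ ^ 2 / 10 ^ 9 := by
        have : x * γ ^ 2 / 16 ^ 4 * ((1 / 36) ^ 3 * (1 / 2) ^ 2) =
            x * γ ^ 2 * (1 / 16 ^ 4 * ((1 / 36) ^ 3 * (1 / 2) ^ 2)) := by ring
        rw [this, div_eq_mul_inv]
        exact mul_le_mul_of_nonneg_left (by norm_num) h5.le

/-- With sufficiently large samples, `rBoost*` fails in `rMetaBoost` with small probability. -/
theorem isLearner_rBoostStar_subRho {X R : Type*} [MeasurableSpace X] [MeasurableSpace R]
    {W : (Fin m → X × Bool) → R → X → Bool} {f : X → Bool} {ν : Measure R} [IsProbabilityMeasure ν]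
    {p : ℝ} (hW : IsLearner f ν W (fun r S₁ S₂ => W S₁ r = W S₂ r) p (1 / 2 - γ))
    (hρ0 : 0 < ρ) (hρ : ρ < 1) (hε0 : 0 < ε) (hε : ε < 1) (hγ0 : 0 < γ) (hγ : γ < 1 / 2)
    (hp0 : 0 ≤ p) (hp : p ≤ subRho ρ ε * γ ^ 2 / 10 ^ 6) (hK : (10 : ℝ) ^ 20 ≤ K) :
    IsLearner f (boostSeedLaw K (subRho ρ ε) (1 / 16) γ m ν)
      (fun S r => (rBoostStar K (subRho ρ ε) (1 / 16) γ W S r).1)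
      (BoostAgree W) (subRho ρ ε / 10) (3 / 2 * (1 / 16)) := by
  obtain ⟨hx0, hx⟩ := subRho_bounds hρ0 hρ hε0 hε
  set x := subRho ρ ε
  set y := x * (1 / 16) * γ with hy
  have hy0 : 0 < y := by positivity
  have hy4 : y ^ 4 ≤ x * γ ^ 2 / 10 ^ 9 := four_mul_pow_le hx0 hx hγ0 hγ
  have hL : 1 ≤ Real.log (1 / y) := by
    rw [Real.le_log_iff_exp_le (by positivity), le_div_iff₀ hy0]
    have h1 := Real.exp_one_lt_d9
    have h2 : y ≤ 1 / 36 * (1 / 16) * (1 / 2) := by rw [hy]; gcongr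
    have : 0 < Real.exp 1 := Real.exp_pos 1
    nlinarith
  set L := Real.log (1 / y) with hLdef
  have hη : x * γ / 10 ^ 7 ≤ 1 / 8 := by nlinarith
  -- As only `O(1/γ)` rounds contain a check, `η` may be of order `x γ` instead of `x γ²`. A check
  -- then needs a sample of order `1 / (x² γ²)`, up to a logarithm.
  refine isLearner_rBoostStar (κ := 2 * y ^ 4) (η := x * γ / 10 ^ 7)
    (τ := 6 * (x * γ / 10 ^ 7) + 4 * y ^ 4) hW hγ0 hγ (by norm_num) (by norm_num) hp0
    (by positivity) (by positivity) (by positivity) hη ?_ ?_ ?_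
  · rcases Nat.eq_zero_or_pos m with rfl | hm
    · exact Or.inl rfl
    right
    have hm1 : (1 : ℝ) ≤ m := by exact_mod_cast hm
    have hn : K * L * m / (1 / 16) ≤ (boostDraw K x (1 / 16) γ m : ℝ) := Nat.le_ceil _
    have hKL : 10 ^ 20 * L ≤ K * L := by gcongr
    have hKm : K * L ≤ K * L * m := le_mul_of_one_le_right (by positivity) hm1
    have hKm2 : (10 : ℝ) ^ 20 * m ≤ K * L * m := by
      refine mul_le_mul_of_nonneg_right ?_ (by positivity)
      linarith
    constructor
    · linarith
    · refine mul_le_mul_of_nonneg_left (exp_neg_le_pow hy0 ?_) zero_le_two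
      push_cast
      rw [← hLdef]
      linarith
  · intro t ht
    refine add_le_add_right (mul_le_mul_of_nonneg_left (exp_neg_le_pow hy0 ?_) (by norm_num)) _
    have hn : K * L / (x ^ 2 * (1 / 16) ^ 3 * γ ^ 2) ≤ (boostCheck K x (1 / 16) γ t : ℝ) := by
      rw [boostCheck, if_pos ht]; exact Nat.le_ceil _
    have hKL : 10 ^ 20 * L ≤ K * L := by gcongr
    push_cast
    rw [← hLdef]
    calc 4 * L ≤ 10 ^ 20 * L * (32 / 10 ^ 14) := by linarith
      _ ≤ K * L * (32 / 10 ^ 14) := by gcongr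
      _ = K * L / (x ^ 2 * (1 / 16) ^ 3 * γ ^ 2) * (x * γ / 10 ^ 7) ^ 2 * (1 / 16 / 2) / 4 := by
          field_simp; norm_num
      _ ≤ _ := by gcongr
  -- The calls contribute about `0.0123 x` and the checks about `0.005 x`, together less than `x /
  -- 10`.
  · rw [Finset.sum_add_distrib, Finset.sum_const, Finset.card_univ, Fintype.card_fin, nsmul_eq_mul]
    have h1 := boostRounds_sixteenth_le hγ0 hγ
    have h2 := sum_isCheckRound_le hγ0 hγ (τ := 6 * (x * γ / 10 ^ 7) + 4 * y ^ 4) (by positivity)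
    have h3 : (boostRounds (1 / 16) γ : ℝ) * (2 * (2 * y ^ 4) + 3 * p) ≤
        4097 / γ ^ 2 * (2 * (2 * (x * γ ^ 2 / 10 ^ 9)) + 3 * (x * γ ^ 2 / 10 ^ 6)) := by gcongr
    have h4 : 4097 / γ ^ 2 * (2 * (2 * (x * γ ^ 2 / 10 ^ 9)) + 3 * (x * γ ^ 2 / 10 ^ 6)) =
        4097 * (4 / 10 ^ 9 + 3 / 10 ^ 6) * x := by field_simp; ring
    have h5 : 8194 / γ * (6 * (x * γ / 10 ^ 7) + 4 * y ^ 4) ≤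
        8194 / γ * (6 * (x * γ / 10 ^ 7) + 4 * (x * γ ^ 2 / 10 ^ 9)) := by gcongr
    have h6 : 8194 / γ * (6 * (x * γ / 10 ^ 7) + 4 * (x * γ ^ 2 / 10 ^ 9)) =
        8194 * (6 / 10 ^ 7 * x + 4 / 10 ^ 9 * (x * γ)) := by field_simp
    have h7 : x * γ ≤ x := by nlinarith
    linarith

/-- `rMetaBoost` with a sufficiently large constant is replicable and accurate. -/
theorem rMetaBoost_isReplicable_and_er_le {X R : Type*} [MeasurableSpace X] [MeasurableSpace R]
    {W : (Fin m → X × Bool) → R → X → Bool} {f : X → Bool} (hf : Measurable f) {ν : Measure R}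
    [IsProbabilityMeasure ν]
    {p : ℝ} (hW : IsLearner f ν W (fun r S₁ S₂ => W S₁ r = W S₂ r) p (1 / 2 - γ))
    (hρ0 : 0 < ρ) (hρ : ρ < 1) (hε0 : 0 < ε) (hε : ε < 1) (hγ0 : 0 < γ) (hγ : γ < 1 / 2)
    (hp0 : 0 ≤ p) (hp : p ≤ subRho ρ ε * γ ^ 2 / 10 ^ 6) (hK : (10 : ℝ) ^ 20 ≤ K)
    (D : Measure X) [IsProbabilityMeasure D] :
    IsReplicable (labelled D f) (metaSeedLaw K ρ ε γ m ν)
      (fun S r => (rMetaBoost K ρ ε γ W S r).1) ρ ∧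
    ((Measure.pi fun _ : MetaIdx K ρ ε γ m => labelled D f).prod (metaSeedLaw K ρ ε γ m ν))
      {ω | ε < er D f (rMetaBoost K ρ ε γ W ω.1 ω.2).1} ≤ ENNReal.ofReal ρ := by
  obtain ⟨hT, -⟩ := metaRounds_bounds hε0 hε
  obtain ⟨hx0, -⟩ := subRho_bounds hρ0 hρ hε0 hε
  have hT0 : (0 : ℝ) < metaRounds ε := by linarith
  set y := ρ / metaRounds ε with hy
  have hy0 : 0 < y := by positivity
  have hyT : metaRounds ε * y = ρ := by rw [hy]; field_simp
  have hy1 : y ≤ 1 / 6 := by rw [hy, div_le_div_iff₀ hT0 (by norm_num)]; linarith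
  have hyinv : (metaRounds ε : ℝ) / ρ = 1 / y := by rw [hy]; field_simp
  have hL : 1 ≤ Real.log (1 / y) := by
    rw [Real.le_log_iff_exp_le (by positivity), le_div_iff₀ hy0]
    have h1 := Real.exp_one_lt_d9
    have : 0 < Real.exp 1 := Real.exp_pos 1
    nlinarith
  set L := Real.log (1 / y) with hLdef
  have hKL : 10 ^ 20 * L ≤ K * L := by gcongr
  refine rMetaBoost_replicable_and_accurate hf
    (isLearner_rBoostStar_subRho hW hρ0 hρ hε0 hε hγ0 hγ hp0 hp hK) (κ := 2 * y ^ 4)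
    (η := y / 10 ^ 7) (τ := 6 * (y / 10 ^ 7) + 4 * y ^ 4) (by norm_num) (by positivity) hε0 hε.le
    (by positivity) (by positivity) (by positivity) (by linarith) ?_ ?_ ?_ D
  · rcases Nat.eq_zero_or_pos (Fintype.card (SubIdx K ρ ε γ m)) with h | h
    · exact Or.inl h
    right
    set m₀ := Fintype.card (SubIdx K ρ ε γ m) with hm₀
    have hm1 : (1 : ℝ) ≤ m₀ := by exact_mod_cast h
    have hn : K * L * m₀ / ε ≤ (metaDraw K ρ ε γ m : ℝ) := by
      rw [hLdef, ← hyinv]; exact Nat.le_ceil _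
    rw [div_le_iff₀ hε0] at hn
    have hKm : K * L ≤ K * L * m₀ := le_mul_of_one_le_right (by positivity) hm1
    have hKm2 : (10 : ℝ) ^ 20 * m₀ ≤ K * L * m₀ := by
      refine mul_le_mul_of_nonneg_right ?_ (by positivity)
      linarith
    constructor
    · linarith
    · refine mul_le_mul_of_nonneg_left (exp_neg_le_pow hy0 ?_) zero_le_two
      push_cast
      rw [← hLdef]
      linarith
  · refine add_le_add_right (mul_le_mul_of_nonneg_left (exp_neg_le_pow hy0 ?_) (by norm_num)) _
    have hn : K * L * (metaRounds ε : ℝ) ^ 2 / (ρ ^ 2 * ε) ≤ (metaCheck K ρ ε : ℝ) := by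
      rw [hLdef, ← hyinv]; exact Nat.le_ceil _
    push_cast
    rw [← hLdef]
    calc 4 * L ≤ 10 ^ 20 * L / (64 * 10 ^ 14) := by linarith
      _ ≤ K * L / (64 * 10 ^ 14) := by gcongr
      _ = K * L * (metaRounds ε : ℝ) ^ 2 / (ρ ^ 2 * ε) * (y / 10 ^ 7) ^ 2 * (ε / 16) / 4 := by
          rw [hy]; field_simp; norm_num
      _ ≤ _ := by gcongr
  · have h1 : subRho ρ ε = y / 6 := by rw [hy, subRho]; field_simp
    have h2 : y ^ 4 ≤ y * (1 / 6) ^ 3 := by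
      have : y ^ 3 ≤ (1 / 6) ^ 3 := by gcongr
      nlinarith
    rw [h1]
    -- Per round the inner booster accounts for `y / 20`, the tails for `8 y ^ 4 ≤ 8 y / 216`, and
    -- the random level for `6 y / 10 ^ 7`.
    calc (metaRounds ε : ℝ) * (2 * (2 * y ^ 4) + 3 * (y / 6 / 10) + (6 * (y / 10 ^ 7) + 4 * y ^ 4))
        ≤ metaRounds ε * y := by gcongr; linarith
      _ = ρ := hyT

/-- The sample size of the calls to `rBoost*`. -/
theorem card_subIdx_le {Λ L : ℝ} (hρ0 : 0 < ρ) (hρ : ρ < 1) (hγ0 : 0 < γ) (hγ : γ < 1 / 2)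
    (hΛ : 1 ≤ Λ) (hT0 : (0 : ℝ) < metaRounds ε) (hT : (metaRounds ε : ℝ) ≤ 10 * Λ)
    (hL : Real.log (1 / (subRho ρ ε * (1 / 16) * γ)) ≤ L * Λ) (hL0 : 0 ≤ L) :
    (Fintype.card (SubIdx K ρ ε γ m) : ℝ) ≤
      (4097 * (16 * K * L + 1) + 8194 * (4096 * 3600 * K * L + 1)) * Λ ^ 3 *
        (m / γ ^ 2 + 1 / (ρ ^ 2 * γ ^ 3)) := by
  have hΛ0 : 0 < Λ := by linarith
  have hdraw : (boostDraw K (subRho ρ ε) (1 / 16) γ m : ℝ) ≤ 16 * K * L * Λ * m + 1 := by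
    refine natCeil_le_add_one ?_ (by positivity)
    calc K * Real.log (1 / (subRho ρ ε * (1 / 16) * γ)) * m / (1 / 16)
        ≤ K * (L * Λ) * m / (1 / 16) := by gcongr
      _ = 16 * K * L * Λ * m := by ring
  -- The cube of `Λ` collects the logarithm and the square of the number of rounds hidden in
  -- `subRho`. There are at most `8194 / γ` checks of this size.
  set Q := 4096 * 3600 * K * L * Λ ^ 3 / (ρ ^ 2 * γ ^ 2) + 1 with hQ
  have hcheck : ∀ t, (boostCheck K (subRho ρ ε) (1 / 16) γ t : ℝ) ≤
      if IsCheckRound γ t then Q else 0 := by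
    intro t
    unfold boostCheck
    split_ifs
    · refine natCeil_le_add_one ?_ (by positivity)
      calc K * Real.log (1 / (subRho ρ ε * (1 / 16) * γ)) /
            (subRho ρ ε ^ 2 * (1 / 16) ^ 3 * γ ^ 2)
          ≤ K * (L * Λ) / (subRho ρ ε ^ 2 * (1 / 16) ^ 3 * γ ^ 2) := by gcongr
        _ = 4096 * 36 * K * L * Λ * (metaRounds ε : ℝ) ^ 2 / (ρ ^ 2 * γ ^ 2) := by
          unfold subRho; field_simp; ring
        _ ≤ 4096 * 36 * K * L * Λ * (10 * Λ) ^ 2 / (ρ ^ 2 * γ ^ 2) := by gcongr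
        _ = 4096 * 3600 * K * L * Λ ^ 3 / (ρ ^ 2 * γ ^ 2) := by ring
    · simp
  set u := 1 / (ρ ^ 2 * γ ^ 3) with hu
  have hρ2 : ρ ^ 2 ≤ 1 := by nlinarith
  have hγ1 : γ ≤ 1 := by linarith
  have hu2 : 1 / γ ^ 2 ≤ u := by
    refine one_div_le_one_div_of_le (by positivity) ?_
    calc ρ ^ 2 * γ ^ 3 ≤ 1 * (γ ^ 2 * 1) := by rw [pow_succ γ 2]; gcongr
      _ = γ ^ 2 := by ring
  have hu1 : 1 / γ ≤ u := by
    refine le_trans (one_div_le_one_div_of_le (by positivity) ?_) hu2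
    nlinarith
  have hΛ1 : Λ ≤ Λ ^ 3 := le_self_pow₀ hΛ (by norm_num)
  have hΛ3 : 1 ≤ Λ ^ 3 := one_le_pow₀ hΛ
  have hu0 : 0 < u := by positivity
  have hB := boostRounds_sixteenth_le hγ0 hγ
  have hcard : (Fintype.card (SubIdx K ρ ε γ m) : ℝ) =
      (boostRounds (1 / 16) γ : ℝ) * boostDraw K (subRho ρ ε) (1 / 16) γ m +
      ∑ t : Fin (boostRounds (1 / 16) γ), (boostCheck K (subRho ρ ε) (1 / 16) γ t : ℝ) := by
    simp [Fintype.card_sigma, Fintype.card_sum, Finset.sum_add_distrib]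
  rw [hcard]
  have h1 : (boostRounds (1 / 16) γ : ℝ) * boostDraw K (subRho ρ ε) (1 / 16) γ m ≤
      4097 * (16 * K * L + 1) * Λ ^ 3 * (m / γ ^ 2 + u) := by
    calc _ ≤ 4097 / γ ^ 2 * (16 * K * L * Λ * m + 1) := by gcongr
      _ = 4097 * (16 * K * L * Λ * (m / γ ^ 2) + 1 / γ ^ 2) := by ring
      _ ≤ 4097 * (16 * K * L * Λ ^ 3 * (m / γ ^ 2) + Λ ^ 3 * u) := by
        gcongr
        exact hu2.trans (le_mul_of_one_le_left hu0.le hΛ3)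
      _ ≤ 4097 * (16 * K * L * Λ ^ 3 * (m / γ ^ 2 + u) + Λ ^ 3 * (m / γ ^ 2 + u)) := by
        have : 0 ≤ m / γ ^ 2 := by positivity
        gcongr <;> linarith
      _ = _ := by ring
  have h2 : ∑ t : Fin (boostRounds (1 / 16) γ), (boostCheck K (subRho ρ ε) (1 / 16) γ t : ℝ) ≤
      8194 * (4096 * 3600 * K * L + 1) * Λ ^ 3 * (m / γ ^ 2 + u) := by
    calc _ ≤ 8194 / γ * Q :=
          (Finset.sum_le_sum fun (t : Fin _) _ => hcheck t).trans
            (sum_isCheckRound_le hγ0 hγ (by positivity))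
      _ = 8194 * (4096 * 3600 * K * L * Λ ^ 3 * u + 1 / γ) := by
        rw [hQ, hu]; field_simp
      _ ≤ 8194 * (4096 * 3600 * K * L * Λ ^ 3 * u + Λ ^ 3 * u) := by
        gcongr
        exact hu1.trans (le_mul_of_one_le_left hu0.le hΛ3)
      _ ≤ 8194 * (4096 * 3600 * K * L * Λ ^ 3 * (m / γ ^ 2 + u) + Λ ^ 3 * (m / γ ^ 2 + u)) := by
        have : 0 ≤ m / γ ^ 2 := by positivity
        gcongr <;> linarith
      _ = _ := by ring
  linarith

/-- The crude bound `log c ≤ c` is harmless: `c` will be proportional to the number of rounds, which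
is itself logarithmic. -/
theorem log_le_of_le_mul {x y c : ℝ} (hx : 0 < x) (hy : 0 < y) (hc : 0 < c) (h : x ≤ c * y) :
    Real.log x ≤ c + Real.log y := by
  have h1 := Real.log_le_log hx h
  rw [Real.log_mul hc.ne' hy.ne'] at h1
  linarith [Real.log_le_self hc.le]

/-- The sample complexity of `rMetaBoost`. -/
theorem card_metaIdx_le (hρ0 : 0 < ρ) (hρ : ρ < 1) (hε0 : 0 < ε) (hε : ε < 1) (hγ0 : 0 < γ)
    (hγ : γ < 1 / 2) :
    (Fintype.card (MetaIdx K ρ ε γ m) : ℝ) ≤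
      10 * (11 * K * (4097 * (16 * K * 1056 + 1) + 8194 * (4096 * 3600 * K * 1056 + 1)) +
        1100 * K + 2) * Real.log (2 / (ρ * ε * γ)) ^ 5 *
        (m / (ε * γ ^ 2) + 1 / (ρ ^ 2 * ε * γ ^ 3)) := by
  obtain ⟨hT6, hT⟩ := metaRounds_bounds hε0 hε
  set Λ := Real.log (2 / (ρ * ε * γ)) with hΛdef
  have hργ : ρ * γ ≤ 1 := by nlinarith
  have hργε : ρ * ε * γ ≤ 1 / 2 := by
    calc ρ * ε * γ ≤ 1 * 1 * (1 / 2) := by gcongr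
      _ = 1 / 2 := by norm_num
  have hlow : ∀ {x : ℝ}, 0 < x → x ≤ 2 / (ρ * ε * γ) → Real.log x ≤ Λ :=
    fun h0 h => Real.log_le_log h0 h
  have hΛ : 1 ≤ Λ := by
    have h4 : Real.log 4 = 2 * Real.log 2 := by
      rw [show (4 : ℝ) = 2 ^ 2 by norm_num, Real.log_pow]; norm_num
    have h1 := Real.log_two_gt_d9
    have h2 : Real.log 4 ≤ Λ := hlow (by norm_num) (by
      rw [le_div_iff₀ (by positivity)]; linarith)
    linarith
  have hΛ0 : 0 < Λ := by linarith
  have hεΛ : Real.log (2 / ε) ≤ Λ := by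
    refine hlow (by positivity) ?_
    gcongr
    nlinarith
  replace hT : (metaRounds ε : ℝ) ≤ 10 * Λ := by linarith
  have hT0 : (0 : ℝ) < metaRounds ε := by linarith
  have hlog : Real.log (metaRounds ε / ρ) ≤ 11 * Λ := by
    have h1 := log_le_of_le_mul (x := metaRounds ε / ρ) (y := 1 / ρ) (c := metaRounds ε)
      (by positivity) (by positivity) hT0 (by rw [mul_one_div])
    have h2 : Real.log (1 / ρ) ≤ Λ := by
      refine hlow (by positivity) ?_
      rw [div_le_div_iff₀ hρ0 (by positivity)]
      nlinarith [mul_pos hρ0 hε0, mul_pos hε0 hγ0]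
    linarith
  -- The argument equals `96 T / (ρ γ)` with `T ≤ 10 Λ`, so already `961 Λ` would do.
  have hlog2 : Real.log (1 / (subRho ρ ε * (1 / 16) * γ)) ≤ 1056 * Λ := by
    have h1 := log_le_of_le_mul (x := 1 / (subRho ρ ε * (1 / 16) * γ)) (y := 1 / (ρ * γ))
      (c := 96 * metaRounds ε) (by unfold subRho; positivity) (by positivity) (by positivity)
      (le_of_eq (by unfold subRho; field_simp; norm_num))
    have h2 : Real.log (1 / (ρ * γ)) ≤ Λ := by
      refine hlow (by positivity) ?_
      rw [div_le_div_iff₀ (by positivity) (by positivity)]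
      nlinarith [mul_pos hρ0 hγ0]
    linarith
  have hsub := card_subIdx_le (K := K) (m := m) hρ0 hρ hγ0 hγ hΛ hT0 hT hlog2 (by norm_num)
  set C₁ : ℝ := 4097 * (16 * K * 1056 + 1) + 8194 * (4096 * 3600 * K * 1056 + 1) with hC₁
  have hC₁0 : 0 ≤ C₁ := by positivity
  set A := m / (ε * γ ^ 2) + 1 / (ρ ^ 2 * ε * γ ^ 3) with hA
  have hAε : (m / γ ^ 2 + 1 / (ρ ^ 2 * γ ^ 3)) / ε = A := by
    rw [hA]; field_simp
  have hu : 1 / (ρ ^ 2 * ε) ≤ A := by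
    have h1 : 1 / (ρ ^ 2 * ε) ≤ 1 / (ρ ^ 2 * ε * γ ^ 3) := by
      refine one_div_le_one_div_of_le (by positivity) ?_
      exact mul_le_of_le_one_right (by positivity) (pow_le_one₀ hγ0.le (by linarith))
    have h2 : 0 ≤ m / (ε * γ ^ 2) := by positivity
    linarith
  have hA1 : 1 ≤ A := by
    refine le_trans ?_ hu
    rw [le_div_iff₀ (by positivity), one_mul]
    calc ρ ^ 2 * ε ≤ 1 ^ 2 * 1 := by gcongr
      _ = 1 := by norm_num
  have hA0 : 0 < A := by linarith
  have hdraw : (metaDraw K ρ ε γ m : ℝ) ≤ 11 * K * C₁ * Λ ^ 4 * A + 1 := by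
    refine natCeil_le_add_one ?_ (by positivity)
    calc K * Real.log (metaRounds ε / ρ) * Fintype.card (SubIdx K ρ ε γ m) / ε
        ≤ K * (11 * Λ) * (C₁ * Λ ^ 3 * (m / γ ^ 2 + 1 / (ρ ^ 2 * γ ^ 3))) / ε := by gcongr
      _ = 11 * K * C₁ * Λ ^ 4 * ((m / γ ^ 2 + 1 / (ρ ^ 2 * γ ^ 3)) / ε) := by ring
      _ = _ := by rw [hAε]
  have hcheck : (metaCheck K ρ ε : ℝ) ≤ 1100 * K * Λ ^ 3 * A + 1 := by
    refine natCeil_le_add_one ?_ (by positivity)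
    calc K * Real.log (metaRounds ε / ρ) * (metaRounds ε : ℝ) ^ 2 / (ρ ^ 2 * ε)
        ≤ K * (11 * Λ) * (10 * Λ) ^ 2 / (ρ ^ 2 * ε) := by gcongr
      _ = 1100 * K * Λ ^ 3 * (1 / (ρ ^ 2 * ε)) := by ring
      _ ≤ _ := by gcongr
  have hΛ34 : Λ ^ 3 ≤ Λ ^ 4 := pow_le_pow_right₀ hΛ (by norm_num)
  have hone : 1 ≤ Λ ^ 4 * A := one_le_mul_of_one_le_of_one_le (one_le_pow₀ hΛ) hA1
  have hcard : (Fintype.card (MetaIdx K ρ ε γ m) : ℝ) =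
      metaRounds ε * (metaDraw K ρ ε γ m + metaCheck K ρ ε) := by
    simp [Fintype.card_prod, Fintype.card_sum]
  rw [hcard]
  -- Of the five powers of `Λ`, three come from the inner sample size, one from the logarithm in the
  -- sampler, and one from the number of rounds.
  calc (metaRounds ε : ℝ) * (metaDraw K ρ ε γ m + metaCheck K ρ ε)
      ≤ 10 * Λ * ((11 * K * C₁ * Λ ^ 4 * A + Λ ^ 4 * A) +
        (1100 * K * Λ ^ 4 * A + Λ ^ 4 * A)) := by
        gcongr
        · exact hdraw.trans (by linarith)
        · refine hcheck.trans (add_le_add ?_ hone)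
          gcongr
    _ = _ := by ring

/-- The number of calls to the weak learner. -/
theorem cast_rMetaBoost_calls_le {X R : Type*} (hε0 : 0 < ε) (hε : ε < 1) (hγ0 : 0 < γ)
    (hγ : γ < 1 / 2) (W : (Fin m → X × Bool) → R → X → Bool)
    (S : MetaIdx K ρ ε γ m → X × Bool) (r : MetaSeed K ρ ε γ m R) :
    ((rMetaBoost K ρ ε γ W S r).2 : ℝ) ≤ 40970 * Real.log (2 / ε) / γ ^ 2 := by
  obtain ⟨-, hT⟩ := metaRounds_bounds hε0 hε
  have hl := half_lt_log hε0 hε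
  calc ((rMetaBoost K ρ ε γ W S r).2 : ℝ) ≤ metaRounds ε * boostRounds (1 / 16) γ := by
        exact_mod_cast rMetaBoost_calls_le W S r
    _ ≤ 10 * Real.log (2 / ε) * (4097 / γ ^ 2) := by
        gcongr
        exact boostRounds_sixteenth_le hγ0 hγ
    _ = _ := by ring

end Parameters

end ReplicableBoosting

end

theorem theorem1 :
    ∃ (c C : ℝ) (k K : ℕ), 0 < c ∧
      ∀ (X : Type*) [MeasurableSpace X] (R : Type*) [MeasurableSpace R]
        (ν : Measure R) [IsProbabilityMeasure ν] (f : X → Bool) (_ : Measurable f)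
        (ρ ε γ : ℝ) (_ : ρ ∈ Ioo (0 : ℝ) 1) (_ : ε ∈ Ioo (0 : ℝ) 1) (_ : γ ∈ Ioo (0 : ℝ) (1 / 2))
        (m : ℕ) (W : (Fin m → X × Bool) → R → X → Bool)
        (_ : IsReplicableWeakLearner f ν W γ (c * ρ * γ ^ 2 / Real.log (2 / ε))),
        -- replicability
        (∀ (D : Measure X) [IsProbabilityMeasure D],
          IsReplicable (labelled D f) (metaSeedLaw K ρ ε γ m ν)
            (fun S r => (rMetaBoost K ρ ε γ W S r).1) ρ) ∧
        -- number of calls to the weak learner, in every run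
        (∀ (S : MetaIdx K ρ ε γ m → X × Bool) (r : MetaSeed K ρ ε γ m R),
          ((rMetaBoost K ρ ε γ W S r).2 : ℝ) ≤ C * Real.log (2 / ε) / γ ^ 2) ∧
        -- accuracy
        (∀ (D : Measure X) [IsProbabilityMeasure D],
          ((Measure.pi fun _ : MetaIdx K ρ ε γ m => labelled D f).prod (metaSeedLaw K ρ ε γ m ν))
            {ω | ε < er D f (rMetaBoost K ρ ε γ W ω.1 ω.2).1} ≤ ENNReal.ofReal ρ) ∧
        -- sample complexity
        (Fintype.card (MetaIdx K ρ ε γ m) : ℝ) ≤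
          C * Real.log (2 / (ρ * ε * γ)) ^ k *
            (m / (ε * γ ^ 2) + 1 / (ρ ^ 2 * ε * γ ^ 3)) := by
  set C₂ : ℝ := 10 * (11 * (10 ^ 20 : ℕ) * (4097 * (16 * (10 ^ 20 : ℕ) * 1056 + 1) +
    8194 * (4096 * 3600 * (10 ^ 20 : ℕ) * 1056 + 1)) + 1100 * (10 ^ 20 : ℕ) + 2) with hC₂
  refine ⟨1 / 10 ^ 8, max 40970 C₂, 5, 10 ^ 20, by norm_num, ?_⟩
  intro X _ R _ ν _ f hf ρ ε γ ⟨hρ0, hρ⟩ ⟨hε0, hε⟩ ⟨hγ0, hγ⟩ m W hW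
  have hl : 69 / 100 < Real.log (2 / ε) := half_lt_log hε0 hε
  have hp0 : 0 ≤ 1 / 10 ^ 8 * ρ * γ ^ 2 / Real.log (2 / ε) := by positivity
  -- Since `T ≤ 10 log (2/ε)`, the constant `10 ^ (-8)` stays below the tolerance of the inner
  -- booster by a factor `6/10`.
  have hp : 1 / 10 ^ 8 * ρ * γ ^ 2 / Real.log (2 / ε) ≤ subRho ρ ε * γ ^ 2 / 10 ^ 6 := by
    obtain ⟨hT6, hT⟩ := metaRounds_bounds hε0 hε
    have hT0 : (0 : ℝ) < metaRounds ε := by linarith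
    calc 1 / 10 ^ 8 * ρ * γ ^ 2 / Real.log (2 / ε)
        ≤ 1 / 10 ^ 8 * ρ * γ ^ 2 / (metaRounds ε / 10) := by
          gcongr
          linarith
      _ = 6 / 10 * (subRho ρ ε * γ ^ 2 / 10 ^ 6) := by
          unfold subRho; field_simp
      _ ≤ _ := mul_le_of_le_one_left (by unfold subRho; positivity) (by norm_num)
  have hmain : ∀ (D : Measure X) [IsProbabilityMeasure D], _ := fun D _ =>
    rMetaBoost_isReplicable_and_er_le (K := 10 ^ 20) hf (hW.isLearner hf) hρ0 hρ hε0 hε hγ0 hγ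
      hp0 hp (by norm_num) D
  refine ⟨fun D _ => (hmain D).1, fun S r => ?_, fun D _ => (hmain D).2, ?_⟩
  · refine (cast_rMetaBoost_calls_le hε0 hε hγ0 hγ W S r).trans ?_
    gcongr
    exact le_max_left _ _
  · refine (card_metaIdx_le hρ0 hρ hε0 hε hγ0 hγ).trans ?_
    have hlog : 0 ≤ Real.log (2 / (ρ * ε * γ)) := by
      refine Real.log_nonneg ?_
      rw [le_div_iff₀ (by positivity)]
      have : ρ * ε * γ ≤ 1 * 1 * (1 / 2) := by gcongr
      linarith
    gcongr
    exact le_max_right _ _
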